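/- **Setting.** Let $T^2=\mathbb R^2/\mathbb Z^2$ with coordinates $(x,y)$. For a Riemannian metric $h$ on $T^2$ let $d\mu_h$ be its volume element, $d\mu_1=d\mu_h/\int_{T^2}d\mu_h$ its normalization, and $h^*$ the metric induced by $h$ on $T^*T^2$. A metric is *flat* if it is locally isometric to the Euclidean plane; it is *rectangular* if $(T^2,h)$ is isometric to $\mathbb R^2/(\mathbb Z(\alpha,0)\oplus\mathbb Z(0,\beta))$ for some $\alpha,\beta>0$. A smooth map $\varphi\colon T^2\to \ell^2$ is *inflated* with respect to $(d\mu_h,h)$ if it maximizes $\int\|\varphi\|^2\,d\mu_1$ among all $C^\infty$ maps into $\ell^2$ with $\varphi^*h_{\ell^2}\le h$ and $\int\varphi\,d\mu_1=0$; maps into $\mathbb R^N$ are regarded as maps into $\ell^2\supset\mathbb R^N$. For a smooth positive semidefinite metric $g^*$ on $T^*T^2$ put $$\lambda_1(d\mu_h,g^*)=\inf\frac{\int g^*(du,du)\,d\mu_h}{\int u^2\,d\mu_h},$$ the infimum being over nonzero $C^1$ functions $u$ with $\int u\,d\mu_h=0$. We say that $g^*$ *solves the eigenvalue problem for* $(d\mu_h,h)$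 if $g^*\neq 0$ and $g^*$ maximizes $\lambda_1(d\mu_h,g^*)\big/\int g^{ij}h_{ij}\,d\mu_1$ over all smooth positive semidefinite $g^*\ne0$ on $T^*T^2$. First eigenfunctions of a metric $k$ are the elements of the eigenspace of $-\Delta_k$ for its smallest positive eigenvalue. Let $$h_{a,b}=dx^2+2a\,dx\,dy+(a^2+b^2)\,dy^2,\qquad h_{\mathrm{EL}}=h_{1/2,\sqrt3/2},\qquad h_{\mathrm{SQ}}=h_{0,1}.$$ **Proposition.** Let $h$ be a flat metric on $T^2$. 1. There are a diffeomorphism $\Phi$ of $T^2$, a constant $c>0$ and $0\le a\le\frac12$, $b\ge\sqrt{1-a^2}$ such that $h=c\,\Phi^*h_{a,b}$. If $h$ is rectangular, this is possible with $a=0$. 2. For all such $\Phi,c,a,b$, there is an isometric embedding $\varphi\colon(T^2,h)\to\mathbb R^6$ whose components are first eigenfunctions of the equilateral flat metric $\Phi^*h_{\mathrm{EL}}$. The map $\varphi$ is inflated with respect to $(d\mu_h,h)$, and $(\Phi^*h_{\mathrm{EL}})^*$ solves the eigenvalue problem for $(d\mu_h,h)$. 3. If $a=0$ in 2, then $\varphi$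 can moreover be taken with image in $\mathbb R^4=\mathbb R^4\times\{0\}\subset\mathbb R^6$; $(\Phi^*h_{\mathrm{SQ}})^*$ is another solution of the eigenvalue problem for $(d\mu_h,h)$, not proportional to $(\Phi^*h_{\mathrm{EL}})^*$; and all the metrics $(\Phi^*h_{s,\sqrt{1-s^2}})^*$, $0\le s\le\frac12$, which join $(\Phi^*h_{\mathrm{SQ}})^*$ and $(\Phi^*h_{\mathrm{EL}})^*$, solve it. -/

import Mathlib

open scoped ContDiff
open MeasureTheory

noncomputable section

namespace FlatTori

/-- The universal cover `ℝ²` of the torus (only its smooth structure is used). -/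
abbrev Plane := Fin 2 → ℝ

/-- The torus `T² = ℝ²/ℤ²`.  Its tangent spaces are identified with `ℝ²` by translations. -/
abbrev Torus := UnitAddTorus (Fin 2)

/-- The covering map `ℝ² → ℝ²/ℤ²`. -/
def proj (x : Plane) : Torus := fun i => (x i : UnitAddCircle)

/-- A choice of a point of `ℝ²` over a point of the torus. -/
def rep (p : Torus) : Plane := fun i => (p i).out

lemma proj_rep (p : Torus) : proj (rep p) = p := by
  funext i
  exact Quotient.out_eq (p i)

lemma proj_add (x y : Plane) : proj (x + y) = proj x + proj y := by
  funext i
  simp [proj]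

/-- A continuous map of the plane with values in a fibre of the covering is constant. -/
lemma const_of_proj_const {f : Plane → Plane} (hf : Continuous f) (q : Torus)
    (h : ∀ x, proj (f x) = q) (x y : Plane) : f x = f y := by
  funext i
  have hg : Continuous (fun z => f z i - f x i) := by fun_prop
  have hint : ∀ z, ∃ n : ℤ, f z i - f x i = n := by
    intro z
    have h1 : ((f z i - f x i : ℝ) : UnitAddCircle) = 0 := by
      have := congrFun ((h z).trans (h x).symm) i
      simp only [proj] at this
      rw [AddCircle.coe_sub, this, sub_self]
    obtain ⟨n, hn⟩ := (AddCircle.coe_eq_zero_iff (1 : ℝ)).1 h1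
    exact ⟨n, by simpa using hn.symm⟩
  choose n hn using hint
  have hr : Continuous (fun z => round (f z i - f x i)) := by
    have he : (fun z => round (f z i - f x i)) = n := by
      funext z; rw [hn z, round_intCast]
    rw [he]
    refine (Int.isClosedEmbedding_coe_real.isInducing.continuous_iff).2 ?_
    refine hg.congr fun z => ?_
    simp [hn z]
  have hc := PreconnectedSpace.constant (inferInstance : PreconnectedSpace Plane) hr (x := x) (y := y)
  simp only [hn, round_intCast] at hc
  have h2 := hn x
  have h3 := hn y
  rw [← hc] at h3
  linarith

/-- A map from the torus to a normed space is `C^n` iff its lift to `ℝ²` is. -/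
def SmoothOfOrder {E : Type*} [NormedAddCommGroup E] [NormedSpace ℝ E]
    (n : ℕ∞) (u : Torus → E) : Prop :=
  ContDiff ℝ n (fun x => u (proj x))

/-- The partial derivative `∂u/∂x_i` of a function on the torus. -/
def pd {E : Type*} [NormedAddCommGroup E] [NormedSpace ℝ E]
    (i : Fin 2) (u : Torus → E) (p : Torus) : E :=
  deriv (fun t : ℝ => u (p + proj (Pi.single i t))) 0

/-! ### Tensor fields and metrics -/

/-- Fields of `2 × 2` matrices: the components, in the coordinates `x, y` of `ℝ²/ℤ²`, of a
covariant or contravariant `2`-tensor field. -/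
abbrev TensorField := Torus → Matrix (Fin 2) (Fin 2) ℝ

def IsSmoothTensor (g : TensorField) : Prop :=
  ∀ i j, SmoothOfOrder ⊤ (fun p => g p i j)

/-- Riemannian metrics (on the tangent bundle). -/
def IsRiemannianMetric (h : TensorField) : Prop :=
  IsSmoothTensor h ∧ ∀ p, (h p).PosDef

/-- Smooth positive semidefinite metrics on the cotangent bundle. -/
def IsCometric (g : TensorField) : Prop :=
  IsSmoothTensor g ∧ ∀ p, (g p).PosSemidef

/-- The metric `h*` on the cotangent bundle given by a Riemannian metric `h`. -/
def dualMetric (h : TensorField) : TensorField := fun p => (h p)⁻¹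

/-- The pairing `(g*, h) = g^{ij} h_{ij}`. -/
def pairing (g h : TensorField) (p : Torus) : ℝ := ∑ i, ∑ j, g p i j * h p i j

/-- The pull-back by `φ` of the standard metric of the inner product space `E`. -/
def inducedMetric {E : Type*} [NormedAddCommGroup E] [InnerProductSpace ℝ E]
    (φ : Torus → E) : TensorField :=
  fun p => Matrix.of fun i j => inner ℝ (pd i φ p) (pd j φ p)

/-- The Riemannian volume element `√(det h) dx dy`. -/
def volumeElement (h : TensorField) : Measure Torus :=
  (volume : Measure Torus).withDensity fun p => ENNReal.ofReal (Real.sqrt (h p).det)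

/-- The normalization `dμ₁ = dμ / Vol(dμ)`. -/
def normalized (μ : Measure Torus) : Measure Torus := (μ Set.univ)⁻¹ • μ

/-- The Jacobian matrix of a map of the plane. -/
def jacobian (F : Plane → Plane) (x : Plane) : Matrix (Fin 2) (Fin 2) ℝ :=
  Matrix.of fun k i => fderiv ℝ F x (Pi.single i 1) k

/-- Flat metrics: Riemannian metrics that are locally isometric to the Euclidean plane. -/
def IsFlatMetric (h : TensorField) : Prop :=
  IsRiemannianMetric h ∧
    ∀ x : Plane, ∃ U : Set Plane, IsOpen U ∧ x ∈ U ∧ ∃ f : Plane → Plane,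
      ContDiffOn ℝ ∞ f U ∧ ∀ y ∈ U, h (proj y) = (jacobian f y).transpose * jacobian f y

/-! ### Diffeomorphisms of the torus -/

/-- `F` is a smooth lift of `Φ : T² → T²` to the universal cover. -/
def IsSmoothLift (F : Plane → Plane) (Φ : Torus → Torus) : Prop :=
  ContDiff ℝ ∞ F ∧ ∀ x, proj (F x) = Φ (proj x)

/-- Diffeomorphisms of the torus.  A self-map of the torus is smooth iff it has a smooth lift. -/
structure TorusDiffeo where
  toEquiv : Torus ≃ Torus
  smooth : ∃ F, IsSmoothLift F toEquiv
  smooth_symm : ∃ F, IsSmoothLift F toEquiv.symm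

/-- A smooth lift of a diffeomorphism. -/
def TorusDiffeo.lift (Φ : TorusDiffeo) : Plane → Plane := Classical.choose Φ.smooth

/-- The pull-back `Φ^* k` of a covariant tensor field; see `pullback_proj` for the independence
of the choices. -/
def pullback (Φ : TorusDiffeo) (k : TensorField) : TensorField := fun p =>
  (jacobian Φ.lift (rep p)).transpose * k (Φ.toEquiv p) * jacobian Φ.lift (rep p)

lemma fderiv_lift_eq {Φ : Torus → Torus} {F G : Plane → Plane} (hF : IsSmoothLift F Φ)
    (hG : IsSmoothLift G Φ) {x y : Plane} (hxy : proj x = proj y) :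
    fderiv ℝ F x = fderiv ℝ G y := by
  have hcst : ∀ z, F z - G (z + (y - x)) = F 0 - G (0 + (y - x)) := by
    intro z
    refine const_of_proj_const (f := fun z => F z - G (z + (y - x))) ?_ 0 ?_ z 0
    · exact hF.1.continuous.sub (hG.1.continuous.comp (by fun_prop))
    · intro w
      have hsub : ∀ u v : Plane, proj (u - v) = proj u - proj v := by
        intro u v; funext i; simp [proj]
      rw [hsub, hF.2, hG.2, proj_add, hsub, hxy, sub_self, add_zero, sub_self]
  have he : F = fun z => G (z + (y - x)) + (F 0 - G (0 + (y - x))) := by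
    funext z; rw [← hcst z]; abel
  rw [he, fderiv_add_const, fderiv_comp_add_right]
  congr 1
  abel

/-- The pull-back, computed with any lift at any point. -/
lemma pullback_proj (Φ : TorusDiffeo) (k : TensorField) {F : Plane → Plane}
    (hF : IsSmoothLift F Φ.toEquiv) (x : Plane) :
    pullback Φ k (proj x) =
      (jacobian F x).transpose * k (Φ.toEquiv (proj x)) * jacobian F x := by
  have hj : jacobian Φ.lift (rep (proj x)) = jacobian F x := by
    have hL : IsSmoothLift Φ.lift Φ.toEquiv := Classical.choose_spec Φ.smooth
    unfold jacobian
    rw [fderiv_lift_eq hL hF (proj_rep (proj x))]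
  simp only [pullback, hj]

/-! ### The flat metrics -/

/-- The metric `h_{a,b} = dx² + 2a dx dy + (a² + b²) dy²`, that is, the flat metric of
`ℝ²/(ℤ(1,0) ⊕ ℤ(a,b))` pulled back to `ℝ²/ℤ²` by the linear map fixing `(1,0)` and sending
`(0,1)` to `(a,b)`. -/
def hMetric (a b : ℝ) : TensorField := fun _ => !![1, a; a, a ^ 2 + b ^ 2]

/-- The equilateral flat metric. -/
def hEL : TensorField := hMetric (1 / 2) (Real.sqrt 3 / 2)

/-- The square flat metric. -/
def hSQ : TensorField := hMetric 0 1

/-- The metrics `h_{a,√(1-a²)}` join the square metric (`a = 0`) and the equilateral one. -/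
lemma hSQ_eq : hSQ = hMetric 0 (Real.sqrt (1 - 0 ^ 2)) := by
  simp [hSQ]

lemma hEL_eq : hEL = hMetric (1 / 2) (Real.sqrt (1 - (1 / 2) ^ 2)) := by
  have h4 : Real.sqrt 4 = 2 := by
    rw [show (4 : ℝ) = 2 ^ 2 by norm_num]
    exact Real.sqrt_sq (by norm_num)
  have : Real.sqrt (1 - (1 / 2) ^ 2) = Real.sqrt 3 / 2 := by
    rw [show (1 - (1 / 2) ^ 2 : ℝ) = 3 / 4 by norm_num, Real.sqrt_div (by norm_num), h4]
  rw [hEL, this]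

/-- Flat metrics corresponding to a rectangular lattice `ℤ(α,0) ⊕ ℤ(0,β)`. -/
def IsRectangular (h : TensorField) : Prop :=
  ∃ (Φ : TorusDiffeo) (α β : ℝ), 0 < α ∧ 0 < β ∧
    h = pullback Φ (fun _ => !![α ^ 2, 0; 0, β ^ 2])

/-- `Φ` identifies `h`, up to the scale `c`, with the metric `h_{a,b}` of a reduced lattice:
`h = c Φ^* h_{a,b}` with `0 ≤ a ≤ 1/2` and `b ≥ √(1 - a²)`. -/
def IsNormalForm (h : TensorField) (Φ : TorusDiffeo) (c a b : ℝ) : Prop :=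
  0 < c ∧ 0 ≤ a ∧ a ≤ 1 / 2 ∧ Real.sqrt (1 - a ^ 2) ≤ b ∧ h = c • pullback Φ (hMetric a b)

/-! ### First eigenfunctions of the Laplacian -/

/-- The Laplacian `Δ_h u = (det h)^{-1/2} ∂_i ((det h)^{1/2} h^{ij} ∂_j u)`. -/
def laplacian (h : TensorField) (u : Torus → ℝ) (p : Torus) : ℝ :=
  (Real.sqrt (h p).det)⁻¹ *
    ∑ i, pd i (fun q => Real.sqrt (h q).det * ∑ j, dualMetric h q i j * pd j u q) p

/-- `l` is an eigenvalue of `-Δ_h`. -/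
def IsEigenvalue (h : TensorField) (l : ℝ) : Prop :=
  ∃ u : Torus → ℝ, SmoothOfOrder ⊤ u ∧ u ≠ 0 ∧ ∀ p, -laplacian h u p = l * u p

/-- `u` lies in the eigenspace of `-Δ_h` for its smallest positive eigenvalue. -/
def IsFirstEigenfunction (h : TensorField) (u : Torus → ℝ) : Prop :=
  SmoothOfOrder ⊤ u ∧ ∃ l, IsLeast {l | 0 < l ∧ IsEigenvalue h l} l ∧
    ∀ p, -laplacian h u p = l * u p

/-- Smooth isometric embeddings of `(T², h)` into a Euclidean space. -/
def IsIsometricEmbedding {N : ℕ} (h : TensorField) (φ : Torus → EuclideanSpace ℝ (Fin N)) :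
    Prop :=
  SmoothOfOrder ⊤ φ ∧ Topology.IsEmbedding φ ∧ inducedMetric φ = h

/-! ### Inflated maps -/

/-- The Hilbert space `l²`. -/
abbrev ℓ2 := lp (fun _ : ℕ => ℝ) 2

/-- The standard inclusion `ℝ^N ⊂ l²`, appending zeros. -/
def toℓ2 {N : ℕ} (v : EuclideanSpace ℝ (Fin N)) : ℓ2 := ∑ i : Fin N, lp.single 2 (i : ℕ) (v i)

/-- The variance of a map into `l²`. -/
def variance (μ : Measure Torus) (ψ : Torus → ℓ2) : ℝ := ∫ p, ‖ψ p‖ ^ 2 ∂(normalized μ)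

/-- Smooth maps into `l²` that are short and have average zero. -/
def IsFeasible (μ : Measure Torus) (h : TensorField) (ψ : Torus → ℓ2) : Prop :=
  SmoothOfOrder ⊤ ψ ∧ (∀ p, (h p - inducedMetric ψ p).PosSemidef) ∧ ∫ p, ψ p ∂(normalized μ) = 0

/-- Inflated maps with respect to `(dμ, h)`. -/
def IsInflated (μ : Measure Torus) (h : TensorField) (ψ : Torus → ℓ2) : Prop :=
  IsFeasible μ h ψ ∧ ∀ ψ', IsFeasible μ h ψ' → variance μ ψ' ≤ variance μ ψ

/-! ### The first-eigenvalue maximization problem -/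

/-- `|du|² = g^{ij} ∂_i u ∂_j u`. -/
def energyDensity (g : TensorField) (u : Torus → ℝ) (p : Torus) : ℝ :=
  ∑ i, ∑ j, g p i j * pd i u p * pd j u p

/-- `λ₁(dμ, g*)`, the infimum of the Rayleigh quotient over the nonzero `C¹` functions with
mean value zero. -/
def lambda1 (μ : Measure Torus) (g : TensorField) : ℝ :=
  sInf {r | ∃ u : Torus → ℝ, SmoothOfOrder 1 u ∧ u ≠ 0 ∧ ∫ p, u p ∂μ = 0 ∧
    r = (∫ p, energyDensity g u p ∂μ) / ∫ p, u p ^ 2 ∂μ}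

/-- The functional `λ₁(dμ, g*) / ∫ (g*, h) dμ₁`. -/
def specFunctional (μ : Measure Torus) (h g : TensorField) : ℝ :=
  lambda1 μ g / ∫ p, pairing g h p ∂(normalized μ)

/-- `g*` maximizes `λ₁(dμ, g*) / ∫ (g*, h) dμ₁` over all positive semidefinite metrics on the
cotangent bundle (other than `0`, for which the quotient is not defined). -/
def SolvesSpecProblem (μ : Measure Torus) (h g : TensorField) : Prop :=
  IsCometric g ∧ g ≠ 0 ∧
    ∀ g', IsCometric g' → g' ≠ 0 → specFunctional μ h g' ≤ specFunctional μ h g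

end FlatTori

end

open FlatTori

/-!
The eigenvalue problem and the problem of inflating a map are dual to each other. If `ψ` is a short
map into `ℓ²` with mean value zero and `g*` a cometric, then the coordinates of `ψ` are test
functions for `λ₁(dμ, g*)`, and the sum of their energy densities is at most `(g*, h)` because `ψ`
is short. Hence `λ₁(dμ, g*) ∫ ‖ψ‖² dμ₁ ≤ ∫ (g*, h) dμ₁` (`lambda1_mul_variance_le`). A pair `ψ`, `g*`
for which equality holds solves both problems (`isInflated_of_eq`, `solvesSpecProblem_of_eq`).

For `h = c Φ^* h_{a,b}` with `0 ≤ a ≤ 1/2` and `a² + b² ≥ 1`, such pairs are explicit. Writing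
`e(t) = exp (2πit)`, the map `(r₁ e(x), r₂ e(y), r₃ e(x + y))` composed with `Φ` induces `h` for
`4π² r₁² = c (1 - a)`, `4π² r₂² = c (a² + b² - a)`, `4π² r₃² = c a` (`inflatedMap`). The vectors
`±(1, 0)`, `±(0, 1)`, `±(1, 1)` are the shortest ones of the dual equilateral lattice, so the
components of the map are first eigenfunctions of `Φ^* h_EL`; if `a = 0`, then `r₃ = 0`, and the
remaining vectors are shortest for all the metrics `h_{s,√(1-s²)}`, `0 ≤ s ≤ 1/2`. The inequality
`λ₁ ≥ 4π²/(1-s²)` for these metrics is Wirtinger's inequality (`wirtinger`), which follows from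
Parseval's identity and from `m² - 2smn + n² ≥ 1` for integers `(m, n) ≠ 0`. The diffeomorphism `Φ`
is dealt with by the change of variables formula `integral_comp_diffeo`, and, for the
eigenfunctions, by the naturality of the Laplacian, which is deduced from Green's formula.

The normal form of a flat metric comes from its developing map. Local isometries to the Euclidean
plane with the same source differ by rigid motions (`IsDev.exists_rigid`), so they can be glued
along growing balls to one local isometry `D` of the universal cover (`exists_isDev_univ`). Then
`D (x + e_i) = A_i (D x) + b_i` with commuting rotations `A_i`. If these were not all trivial, they
would have a common fixed point, and the distance of `D` to it, a function on the compact torus,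
would have a maximum, which is impossible for a local diffeomorphism. So the `A_i` are trivial, and
the `b_i` form a basis by a similar argument. In this basis `D` commutes with the deck
transformations; it is proper, hence a covering, hence a diffeomorphism
(`exists_inverse_of_equivariant`), and it exhibits the metric as the pull-back of a constant one
(`exists_pullback_const`). The reduction of the constant metric to some `c h_{a,b}` is the
reduction theory of the modular group (`exists_reduced_form`).
-/

noncomputable section

namespace FlatTori

/-! ### The covering map and functions on the torus -/

section Covering

lemma proj_zero : proj 0 = 0 := by
  funext i; simp [proj]

lemma proj_sub (x y : Plane) : proj (x - y) = proj x - proj y := by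
  funext i; simp [proj]

lemma proj_eq_zero_iff {x : Plane} : proj x = 0 ↔ ∃ n : Fin 2 → ℤ, x = fun i => (n i : ℝ) := by
  constructor
  · intro h
    have h1 : ∀ i, ∃ n : ℤ, x i = n := by
      intro i
      obtain ⟨n, hn⟩ := (AddCircle.coe_eq_zero_iff (1 : ℝ)).1 (congrFun h i)
      exact ⟨n, by simpa using hn.symm⟩
    choose n hn using h1
    exact ⟨n, funext hn⟩
  · rintro ⟨n, rfl⟩
    funext i
    exact (AddCircle.coe_eq_zero_iff (1 : ℝ)).2 ⟨n i, by simp⟩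

lemma proj_single_one (i : Fin 2) : proj (Pi.single i 1) = 0 :=
  proj_eq_zero_iff.2 ⟨Pi.single i 1, by
    funext j; by_cases h : j = i
    · subst h; simp
    · simp [h]⟩

lemma isOpenQuotientMap_proj : IsOpenQuotientMap proj :=
  IsOpenQuotientMap.piMap (f := fun (_ : Fin 2) (t : ℝ) => (t : UnitAddCircle))
    (fun _ => QuotientAddGroup.isOpenQuotientMap_mk)

lemma surjective_proj : Function.Surjective proj := fun p => ⟨rep p, proj_rep p⟩

lemma continuous_iff_lift {X : Type*} [TopologicalSpace X] {u : Torus → X} :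
    Continuous u ↔ Continuous (fun x => u (proj x)) :=
  isOpenQuotientMap_proj.isQuotientMap.continuous_iff

end Covering

section Smooth

variable {E : Type*} [NormedAddCommGroup E] [NormedSpace ℝ E]

lemma SmoothOfOrder.continuous {n : ℕ∞} {u : Torus → E} (hu : SmoothOfOrder n u) :
    Continuous u :=
  continuous_iff_lift.2 (ContDiff.continuous hu)

lemma SmoothOfOrder.of_top {n : ℕ∞} {u : Torus → E} (hu : SmoothOfOrder ⊤ u) :
    SmoothOfOrder n u :=
  ContDiff.of_le hu (by exact_mod_cast le_top)

lemma SmoothOfOrder.differentiable {u : Torus → E} (hu : SmoothOfOrder 1 u) :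
    Differentiable ℝ (fun x => u (proj x)) :=
  ContDiff.differentiable hu (by simp)

lemma hasDerivAt_line {U : Plane → E} (i : Fin 2) (x : Plane) (t : ℝ)
    (hU : DifferentiableAt ℝ U (x + Pi.single i t)) :
    HasDerivAt (fun t : ℝ => U (x + Pi.single i t))
      (fderiv ℝ U (x + Pi.single i t) (Pi.single i 1)) t := by
  have h1 : HasDerivAt (fun t : ℝ => x + (Pi.single i t : Plane)) (Pi.single i 1) t :=
    (hasDerivAt_single i t).const_add x
  exact hU.hasFDerivAt.comp_hasDerivAt t h1

/-- The partial derivatives of a differentiable function are those of its lift. -/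
lemma pd_proj' {u : Torus → E} {x : Plane} (i : Fin 2)
    (hu : DifferentiableAt ℝ (fun x => u (proj x)) x) :
    pd i u (proj x) = fderiv ℝ (fun x => u (proj x)) x (Pi.single i 1) := by
  have h := hasDerivAt_line (U := fun x => u (proj x)) i x 0 (by simpa using hu)
  simp only [proj_add, Pi.single_zero, add_zero] at h
  exact h.deriv

lemma pd_proj {u : Torus → E} (hu : SmoothOfOrder 1 u) (i : Fin 2) (x : Plane) :
    pd i u (proj x) = fderiv ℝ (fun x => u (proj x)) x (Pi.single i 1) :=
  pd_proj' i (hu.differentiable x)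

/-- The function `t ↦ u (p + t e_i)` has derivative `∂_i u`. -/
lemma hasDerivAt_pd {u : Torus → E} (hu : SmoothOfOrder 1 u) (i : Fin 2) (p : Torus) (t : ℝ) :
    HasDerivAt (fun t : ℝ => u (p + proj (Pi.single i t))) (pd i u (p + proj (Pi.single i t))) t := by
  obtain ⟨x, rfl⟩ := surjective_proj p
  have h := hasDerivAt_line (U := fun x => u (proj x)) i x t (hu.differentiable _)
  simp only [← proj_add]
  rwa [pd_proj hu]

lemma hasDerivAt_pd_zero {u : Torus → E} (hu : SmoothOfOrder 1 u) (i : Fin 2) (p : Torus) :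
    HasDerivAt (fun t : ℝ => u (p + proj (Pi.single i t))) (pd i u p) 0 := by
  have := hasDerivAt_pd hu i p 0
  simpa only [Pi.single_zero, proj_zero, add_zero] using this

lemma SmoothOfOrder.pd_of_le {m n : ℕ∞} {u : Torus → E} (hu : SmoothOfOrder n u) (h : m + 1 ≤ n)
    (i : Fin 2) : SmoothOfOrder m (pd i u) := by
  have h1 : SmoothOfOrder 1 u := ContDiff.of_le hu (by exact_mod_cast (le_add_self.trans h))
  unfold SmoothOfOrder
  simp only [pd_proj h1]
  exact (ContDiff.fderiv_right hu (by exact_mod_cast h)).clm_apply contDiff_const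

lemma SmoothOfOrder.pd {u : Torus → E} (hu : SmoothOfOrder ⊤ u) (i : Fin 2) :
    SmoothOfOrder ⊤ (pd i u) :=
  hu.pd_of_le (by simp) i

lemma SmoothOfOrder.continuous_pd {u : Torus → E} (hu : SmoothOfOrder 1 u) (i : Fin 2) :
    Continuous (FlatTori.pd i u) :=
  (hu.pd_of_le (m := 0) (by simp) i).continuous

lemma SmoothOfOrder.mul {𝔸 : Type*} [NormedRing 𝔸] [NormedAlgebra ℝ 𝔸] {n : ℕ∞} {u v : Torus → 𝔸}
    (hu : SmoothOfOrder n u)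
    (hv : SmoothOfOrder n v) : SmoothOfOrder n (fun p => u p * v p) :=
  ContDiff.mul hu hv

lemma SmoothOfOrder.sum {n : ℕ∞} {ι : Type*} {s : Finset ι} {u : ι → Torus → E}
    (hu : ∀ i ∈ s, SmoothOfOrder n (u i)) : SmoothOfOrder n (fun p => ∑ i ∈ s, u i p) :=
  ContDiff.sum hu

lemma SmoothOfOrder.const {n : ℕ∞} (c : E) : SmoothOfOrder n (fun _ : Torus => c) :=
  contDiff_const

lemma pd_mul {𝔸 : Type*} [NormedRing 𝔸] [NormedAlgebra ℝ 𝔸] {u v : Torus → 𝔸}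
    (hu : SmoothOfOrder 1 u) (hv : SmoothOfOrder 1 v) (i : Fin 2) (p : Torus) :
    pd i (fun q => u q * v q) p = pd i u p * v p + u p * pd i v p := by
  have h := (hasDerivAt_pd_zero hu i p).mul (hasDerivAt_pd_zero hv i p)
  simp only [Pi.single_zero, proj_zero, add_zero] at h
  exact h.deriv

lemma pd_clm {F : Type*} [NormedAddCommGroup F] [NormedSpace ℝ F] {u : Torus → E}
    (hu : SmoothOfOrder 1 u) (L : E →L[ℝ] F) (i : Fin 2) (p : Torus) :
    pd i (fun q => L (u q)) p = L (pd i u p) :=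
  (L.hasFDerivAt.comp_hasDerivAt 0 (hasDerivAt_pd_zero hu i p)).deriv

end Smooth

section Integrals

instance : IsProbabilityMeasure (volume : Measure UnitAddCircle) :=
  ⟨by simp [AddCircle.measure_univ]⟩

instance : IsProbabilityMeasure (volume : Measure Torus) :=
  inferInstanceAs (IsProbabilityMeasure (Measure.pi fun _ : Fin 2 => (volume : Measure UnitAddCircle)))

variable {E : Type*} [NormedAddCommGroup E]

lemma integrable_of_continuous {u : Torus → E} (hu : Continuous u) (μ : Measure Torus)
    [IsFiniteMeasure μ] : Integrable u μ :=
  hu.integrable_of_hasCompactSupport (HasCompactSupport.of_compactSpace u)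

/-- Stokes' theorem on the torus: by translation invariance, `∫ u (p + t e_i)` does not depend
on `t`. -/
lemma integral_pd [NormedSpace ℝ E] {u : Torus → E} (hu : SmoothOfOrder 1 u) (i : Fin 2) :
    ∫ p, pd i u p = 0 := by
  obtain ⟨C, hC⟩ := isCompact_univ.exists_bound_of_continuousOn (hu.continuous_pd i).continuousOn
  have hsh : ∀ t : ℝ, Continuous (fun p : Torus => p + proj (Pi.single i t)) := fun t => by fun_prop
  have h := (hasDerivAt_integral_of_dominated_loc_of_deriv_le (μ := (volume : Measure Torus))
    (s := Set.univ) (x₀ := (0 : ℝ)) (bound := fun _ => C)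
    (F := fun t p => u (p + proj (Pi.single i t)))
    (F' := fun t p => pd i u (p + proj (Pi.single i t))) Filter.univ_mem
    (Filter.Eventually.of_forall fun t =>
      (integrable_of_continuous (hu.continuous.comp (hsh t)) _).aestronglyMeasurable)
    (integrable_of_continuous (hu.continuous.comp (hsh 0)) _)
    (integrable_of_continuous ((hu.continuous_pd i).comp (hsh 0)) _).aestronglyMeasurable
    (Filter.Eventually.of_forall fun p t _ => hC _ (Set.mem_univ _))
    (integrable_const C)
    (Filter.Eventually.of_forall fun p t _ => hasDerivAt_pd hu i p t)).2
  simp only [integral_add_right_eq_self (fun p => u p), Pi.single_zero, proj_zero, add_zero] at h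
  exact h.unique (hasDerivAt_const _ _)

/-- Integration by parts on the torus. -/
lemma integral_pd_mul {𝔸 : Type*} [NormedRing 𝔸] [NormedAlgebra ℝ 𝔸] {u v : Torus → 𝔸}
    (hu : SmoothOfOrder 1 u) (hv : SmoothOfOrder 1 v)
    (i : Fin 2) : ∫ p, pd i u p * v p = -∫ p, u p * pd i v p := by
  have h := integral_pd (hu.mul hv) i
  simp only [pd_mul hu hv] at h
  rw [integral_add (f := fun p => pd i u p * v p) (g := fun p => u p * pd i v p)
    (integrable_of_continuous ((hu.continuous_pd i).mul hv.continuous) _)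
    (integrable_of_continuous (hu.continuous.mul (hv.continuous_pd i)) _)] at h
  exact eq_neg_of_add_eq_zero_left h

end Integrals

/-! ### Fourier series and the Wirtinger inequality -/

section Fourier

open UnitAddTorus

/-- The Fourier coefficients of a function on the torus. In contrast to Mathlib's
`mFourierCoeff`, the integral is over the volume measure of the torus, for which `integral_pd`
is stated. -/
def fc (u : Torus → ℂ) (n : Fin 2 → ℤ) : ℂ := ∫ p, mFourier (-n) p * u p

lemma volume_eq_pi_haar :
    (volume : Measure Torus) = Measure.pi fun _ => AddCircle.haarAddCircle := by
  have h : (volume : Measure UnitAddCircle) = AddCircle.haarAddCircle := by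
    simp [AddCircle.volume_eq_smul_haarAddCircle]
  rw [← h]; rfl

/-- Parseval's identity. -/
lemma hasSum_sq_fc {f : Torus → ℂ} (hf : Continuous f) :
    HasSum (fun n => ‖fc f n‖ ^ 2) (∫ p, ‖f p‖ ^ 2) := by
  set g : C(Torus, ℂ) := ⟨f, hf⟩ with hg
  have h := hasSum_sq_mFourierCoeff (d := Fin 2) (ContinuousMap.toLp 2
    (Measure.pi fun _ : Fin 2 => AddCircle.haarAddCircle (T := (1 : ℝ))) ℂ g)
  unfold fc
  rw [volume_eq_pi_haar]
  convert! h using 1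
  · funext n
    exact congrArg (fun z => ‖z‖ ^ 2) (mFourierCoeff_toLp g n).symm
  · refine integral_congr_ae ?_
    filter_upwards [ContinuousMap.coeFn_toLp (E := ℂ) (p := 2) (𝕜 := ℂ)
      (Measure.pi fun _ : Fin 2 => AddCircle.haarAddCircle (T := (1 : ℝ))) g] with p hp
    exact congrArg (fun z => ‖z‖ ^ 2) hp.symm

lemma mFourier_proj (n : Fin 2 → ℤ) (x : Plane) :
    mFourier n (proj x) = Complex.exp (2 * Real.pi * Complex.I * (n 0 * x 0 + n 1 * x 1)) := by
  simp only [mFourier, proj, ContinuousMap.coe_mk, Fin.prod_univ_two, fourier_coe_apply]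
  rw [← Complex.exp_add]
  congr 1
  simp
  ring

lemma smooth_mFourier (m : ℕ∞) (n : Fin 2 → ℤ) : SmoothOfOrder m (fun p => mFourier n p) := by
  unfold SmoothOfOrder
  simp only [mFourier_proj]
  have h : ∀ i, ContDiff ℝ m (fun x : Plane => ((x i : ℝ) : ℂ)) := fun i =>
    Complex.ofRealCLM.contDiff.comp (contDiff_apply ℝ ℝ i)
  exact (contDiff_const.mul ((contDiff_const.mul (h 0)).add (contDiff_const.mul (h 1)))).cexp

lemma pd_mFourier (n : Fin 2 → ℤ) (i : Fin 2) (p : Torus) :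
    pd i (fun p => mFourier n p) p = 2 * Real.pi * Complex.I * n i * mFourier n p := by
  obtain ⟨x, rfl⟩ := surjective_proj p
  have h1 : HasDerivAt (fun t : ℝ => (2 * Real.pi * Complex.I *
      (n 0 * ((x 0 : ℝ) : ℂ) + n 1 * ((x 1 : ℝ) : ℂ)) + 2 * Real.pi * Complex.I * n i * (t : ℂ)))
      (2 * Real.pi * Complex.I * n i * 1) 0 :=
    ((Complex.ofRealCLM.hasDerivAt (x := (0 : ℝ))).const_mul _).const_add _
  have h2 := h1.cexp
  have h3 : (fun t : ℝ => mFourier n (proj x + proj (Pi.single i t))) = fun t : ℝ =>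
      Complex.exp (2 * Real.pi * Complex.I * (n 0 * ((x 0 : ℝ) : ℂ) + n 1 * ((x 1 : ℝ) : ℂ)) +
        2 * Real.pi * Complex.I * n i * (t : ℂ)) := by
    funext t
    rw [← proj_add, mFourier_proj]
    congr 1
    fin_cases i <;> simp <;> ring
  unfold pd
  rw [h3, h2.deriv, mFourier_proj]
  simp
  ring

/-- Differentiation multiplies the Fourier coefficients by `2πi n`. -/
lemma fc_pd {u : Torus → ℂ} (hu : SmoothOfOrder 1 u) (i : Fin 2) (n : Fin 2 → ℤ) :
    fc (pd i u) n = 2 * Real.pi * Complex.I * n i * fc u n := by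
  have h := integral_pd_mul (smooth_mFourier 1 (-n)) hu i
  simp only [pd_mFourier] at h
  unfold fc
  rw [← neg_eq_iff_eq_neg] at h
  rw [← h, ← integral_const_mul, ← integral_neg]
  congr 1; funext p
  simp
  ring

lemma smooth_ofReal {m : ℕ∞} {u : Torus → ℝ} (hu : SmoothOfOrder m u) :
    SmoothOfOrder m (fun p => (u p : ℂ)) :=
  Complex.ofRealCLM.contDiff.comp hu

/-- **Wirtinger's inequality** for the flat metrics `h_{s,√(1-s²)}` with `|s| ≤ 1/2`: there are no
integers `(m, n) ≠ 0` with `m² - 2 s m n + n² < 1`. -/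
theorem wirtinger {s : ℝ} (hs0 : -(1 / 2) ≤ s) (hs1 : s ≤ 1 / 2) {u : Torus → ℝ}
    (hu : SmoothOfOrder 1 u) (h0 : ∫ p, u p = 0) :
    4 * Real.pi ^ 2 * ∫ p, u p ^ 2 ≤
      ∫ p, (pd 0 u p ^ 2 - 2 * s * (pd 0 u p * pd 1 u p) + pd 1 u p ^ 2) := by
  have hcu := hu.continuous
  have hc0 := hu.continuous_pd 0
  have hc1 := hu.continuous_pd 1
  set v : Torus → ℂ := fun p => (u p : ℂ) with hv
  have hvs : SmoothOfOrder 1 v := smooth_ofReal hu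
  have hpd : ∀ i p, pd i v p = ((pd i u p : ℝ) : ℂ) := fun i p => pd_clm hu Complex.ofRealCLM i p
  -- the integrand on the right is the sum of squares `|∂₀u - s ∂₁u|² + (1 - s²) |∂₁u|²`
  set w : Torus → ℂ := fun p => pd 0 v p - s * pd 1 v p with hw
  have hwc : Continuous w := (hvs.continuous_pd 0).sub (continuous_const.mul (hvs.continuous_pd 1))
  have hint : ∀ (n : Fin 2 → ℤ) {f : Torus → ℂ}, Continuous f →
      Integrable (fun p => mFourier (-n) p * f p) volume := fun n f hf =>
    integrable_of_continuous ((smooth_mFourier 1 (-n)).continuous.mul hf) _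
  have hfw : ∀ n, fc w n = 2 * Real.pi * Complex.I * (n 0 - s * n 1) * fc v n := by
    intro n
    have : fc w n = fc (pd 0 v) n - s * fc (pd 1 v) n := by
      unfold fc
      rw [← integral_const_mul, ← integral_sub (hint n (hvs.continuous_pd 0))
        ((hint n (hvs.continuous_pd 1)).const_mul _)]
      congr 1; funext p
      simp only [hw]; ring
    rw [this, fc_pd hvs, fc_pd hvs]
    ring
  have hPv := hasSum_sq_fc hvs.continuous
  have hPw := hasSum_sq_fc hwc
  have hP1 := hasSum_sq_fc (hvs.continuous_pd 1)
  have hle := hasSum_le (fun n => ?_) (hPv.mul_left (4 * Real.pi ^ 2))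
    (hPw.add (hP1.mul_left (1 - s ^ 2)))
  · have e1 : ∫ p, ‖v p‖ ^ 2 = ∫ p, u p ^ 2 := by
      congr 1; funext p; simp [hv]
    have e2 : (∫ p, ‖w p‖ ^ 2) + (1 - s ^ 2) * ∫ p, ‖pd 1 v p‖ ^ 2 =
        ∫ p, (pd 0 u p ^ 2 - 2 * s * (pd 0 u p * pd 1 u p) + pd 1 u p ^ 2) := by
      have i1 : Integrable (fun p => ‖w p‖ ^ 2) (volume : Measure Torus) :=
        integrable_of_continuous (hwc.norm.pow 2) _
      have i2 : Integrable (fun p => (1 - s ^ 2) * ‖pd 1 v p‖ ^ 2) (volume : Measure Torus) :=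
        (integrable_of_continuous ((hvs.continuous_pd 1).norm.pow 2) _).const_mul _
      rw [← integral_const_mul, ← integral_add i1 i2]
      congr 1; funext p
      simp only [hw, hpd]
      rw [← Complex.ofReal_mul, ← Complex.ofReal_sub, Complex.norm_real, Complex.norm_real,
        Real.norm_eq_abs, Real.norm_eq_abs, sq_abs, sq_abs]
      ring
    rw [e1, e2] at hle
    exact hle
  · rw [hfw, fc_pd hvs]
    have e3 : ((n 0 : ℂ) - s * n 1) = (((n 0 : ℝ) - s * n 1 : ℝ) : ℂ) := by push_cast; rfl
    have e4 : (n 1 : ℂ) = ((n 1 : ℝ) : ℂ) := by simp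
    rw [e3, e4]
    simp only [norm_mul, Complex.norm_real, Complex.norm_I, Complex.norm_ofNat, Real.norm_eq_abs,
      mul_pow, sq_abs, mul_one]
    by_cases hn : n = 0
    · have : fc v n = 0 := by
        subst hn
        simp only [fc, neg_zero, mFourier_zero, ContinuousMap.one_apply, one_mul, hv]
        rw [integral_complex_ofReal, h0]; simp
      rw [this]; simp
    -- `m² - 2smn + n² ≥ m² - |mn| + n²`, which is a positive integer
    · have hq : (1 : ℝ) ≤ ((n 0 : ℝ) - s * n 1) ^ 2 + (1 - s ^ 2) * (n 1 : ℝ) ^ 2 := by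
        have hz : (1 : ℤ) ≤ n 0 ^ 2 - |n 0 * n 1| + n 1 ^ 2 := by
          have hne : n 0 ≠ 0 ∨ n 1 ≠ 0 := by
            by_contra hcon
            push Not at hcon
            exact hn (by funext i; fin_cases i <;> simp [hcon])
          rw [abs_mul]
          have h1 := sq_abs (n 0)
          have h2 := sq_abs (n 1)
          have h3 := abs_nonneg (n 0)
          have h4 := abs_nonneg (n 1)
          rcases hne with h | h
          · have h5 := Int.one_le_abs h
            rcases le_total |n 0| |n 1| with h6 | h6 <;> nlinarith
          · have h5 := Int.one_le_abs h
            rcases le_total |n 0| |n 1| with h6 | h6 <;> nlinarith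
        have hz' : (1 : ℝ) ≤ (n 0 : ℝ) ^ 2 - |(n 0 : ℝ) * n 1| + (n 1 : ℝ) ^ 2 := by
          exact_mod_cast hz
        have h7 : 2 * s * ((n 0 : ℝ) * n 1) ≤ |(n 0 : ℝ) * n 1| := by
          calc 2 * s * ((n 0 : ℝ) * n 1) ≤ |2 * s * ((n 0 : ℝ) * n 1)| := le_abs_self _
            _ = |2 * s| * |(n 0 : ℝ) * n 1| := abs_mul _ _
            _ ≤ 1 * |(n 0 : ℝ) * n 1| := by
              refine mul_le_mul_of_nonneg_right ?_ (abs_nonneg _)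
              rw [abs_le]; constructor <;> linarith
            _ = _ := one_mul _
        nlinarith
      have h8 : 0 ≤ Real.pi ^ 2 * ‖fc v n‖ ^ 2 := by positivity
      nlinarith [mul_le_mul_of_nonneg_left hq h8]

end Fourier

/-! ### Diffeomorphisms of the torus -/

section Diffeo

lemma jacobian_eq_toMatrix' (F : Plane → Plane) (x : Plane) :
    jacobian F x = LinearMap.toMatrix' (fderiv ℝ F x : Plane →ₗ[ℝ] Plane) := by
  ext k i
  simp [jacobian, LinearMap.toMatrix'_apply]

lemma det_jacobian (F : Plane → Plane) (x : Plane) :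
    (jacobian F x).det = (fderiv ℝ F x).det := by
  rw [jacobian_eq_toMatrix', LinearMap.det_toMatrix']

lemma fderiv_apply_eq_sum {E : Type*} [NormedAddCommGroup E] [NormedSpace ℝ E]
    (L : Plane →L[ℝ] E) (v : Plane) : L v = ∑ k, v k • L (Pi.single k 1) := by
  conv_lhs => rw [← Finset.univ_sum_single v]
  rw [map_sum]
  refine Finset.sum_congr rfl fun k _ => ?_
  rw [← map_smul, ← Pi.single_smul]; simp

lemma jacobian_comp {F G : Plane → Plane} {x : Plane} (hG : DifferentiableAt ℝ G (F x))
    (hF : DifferentiableAt ℝ F x) :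
    jacobian (fun y => G (F y)) x = jacobian G (F x) * jacobian F x := by
  simp only [jacobian_eq_toMatrix']
  rw [← LinearMap.toMatrix'_comp]
  congr 1
  have := fderiv_comp x hG hF
  ext v j
  simp only [Function.comp_def] at this
  simp [this]

lemma TorusDiffeo.lift_spec (Φ : TorusDiffeo) : IsSmoothLift Φ.lift Φ.toEquiv :=
  Classical.choose_spec Φ.smooth

/-- The inverse diffeomorphism. -/
def TorusDiffeo.symm (Φ : TorusDiffeo) : TorusDiffeo :=
  ⟨Φ.toEquiv.symm, Φ.smooth_symm, Φ.smooth⟩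

/-- The composition `Ψ ∘ Φ`. -/
def TorusDiffeo.trans (Φ Ψ : TorusDiffeo) : TorusDiffeo where
  toEquiv := Φ.toEquiv.trans Ψ.toEquiv
  smooth := by
    obtain ⟨F, hF, hF'⟩ := Φ.smooth
    obtain ⟨G, hG, hG'⟩ := Ψ.smooth
    exact ⟨fun x => G (F x), hG.comp hF, fun x => by simp [hG', hF']⟩
  smooth_symm := by
    obtain ⟨F, hF, hF'⟩ := Φ.smooth_symm
    obtain ⟨G, hG, hG'⟩ := Ψ.smooth_symm
    exact ⟨fun x => F (G x), hF.comp hG, fun x => by simp [hG', hF']⟩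

lemma TorusDiffeo.differentiable_lift (Φ : TorusDiffeo) : Differentiable ℝ Φ.lift :=
  Φ.lift_spec.1.differentiable (by simp)

lemma TorusDiffeo.det_jacobian_ne_zero (Φ : TorusDiffeo) (x : Plane) :
    (jacobian Φ.lift x).det ≠ 0 := by
  set F := Φ.lift
  set G := Φ.symm.lift
  have hF := Φ.lift_spec
  have hG := Φ.symm.lift_spec
  have hconst : ∀ y, G (F y) - y = G (F 0) - 0 := fun y =>
    const_of_proj_const (f := fun y => G (F y) - y)
      ((hG.1.continuous.comp hF.1.continuous).sub continuous_id) 0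
      (fun z => by
        rw [proj_sub, hG.2, hF.2]
        simp [TorusDiffeo.symm]) y 0
  have hGF : (fun y => G (F y)) = fun y => y + (G (F 0) - 0) := by
    funext y; rw [← hconst y]; abel
  have h1 := jacobian_comp (x := x) (Φ.symm.differentiable_lift (F x)) (Φ.differentiable_lift x)
  have h2 : jacobian (fun y => G (F y)) x = 1 := by
    rw [hGF, jacobian_eq_toMatrix', fderiv_add_const]
    simp
  intro h0
  have h3 := congrArg Matrix.det (h2.symm.trans h1)
  rw [Matrix.det_mul, h0, mul_zero, Matrix.det_one] at h3
  exact one_ne_zero h3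

variable {E : Type*} [NormedAddCommGroup E] [NormedSpace ℝ E]

lemma SmoothOfOrder.comp_diffeo {n : ℕ∞} {u : Torus → E} (hu : SmoothOfOrder n u)
    (Φ : TorusDiffeo) : SmoothOfOrder n (fun p => u (Φ.toEquiv p)) := by
  unfold SmoothOfOrder
  simp only [← Φ.lift_spec.2]
  exact ContDiff.comp (g := fun x => u (proj x)) hu
    (Φ.lift_spec.1.of_le (by exact_mod_cast le_top))

/-- The chain rule for a function composed with a diffeomorphism. -/
lemma pd_comp_diffeo {u : Torus → E} (hu : SmoothOfOrder 1 u) (Φ : TorusDiffeo) (i : Fin 2)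
    (x : Plane) : pd i (fun p => u (Φ.toEquiv p)) (proj x) =
      ∑ k, jacobian Φ.lift x k i • pd k u (Φ.toEquiv (proj x)) := by
  rw [pd_proj (hu.comp_diffeo Φ)]
  simp only [← Φ.lift_spec.2]
  have h := fderiv_comp x (g := fun x => u (proj x)) (hu.differentiable (Φ.lift x))
    (Φ.differentiable_lift x)
  simp only [Function.comp_def] at h
  rw [h, ContinuousLinearMap.comp_apply, fderiv_apply_eq_sum]
  refine Finset.sum_congr rfl fun k _ => ?_
  rw [pd_proj hu]
  rfl

lemma pullback_proj_lift (Φ : TorusDiffeo) (k : TensorField) (x : Plane) :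
    pullback Φ k (proj x) =
      (jacobian Φ.lift x).transpose * k (Φ.toEquiv (proj x)) * jacobian Φ.lift x :=
  pullback_proj Φ k Φ.lift_spec x

lemma pullback_trans (Φ Ψ : TorusDiffeo) (k : TensorField) :
    pullback (Φ.trans Ψ) k = pullback Φ (pullback Ψ k) := by
  funext p
  obtain ⟨x, rfl⟩ := surjective_proj p
  have h : IsSmoothLift (fun y => Ψ.lift (Φ.lift y)) (Φ.trans Ψ).toEquiv :=
    ⟨Ψ.lift_spec.1.comp Φ.lift_spec.1, fun y => by
      simp [Ψ.lift_spec.2, Φ.lift_spec.2, TorusDiffeo.trans]⟩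
  rw [pullback_proj _ _ h, pullback_proj_lift, ← Φ.lift_spec.2, pullback_proj_lift,
    jacobian_comp (Ψ.differentiable_lift _) (Φ.differentiable_lift _), Matrix.transpose_mul]
  simp only [Matrix.mul_assoc, Φ.lift_spec.2, TorusDiffeo.trans, Equiv.trans_apply]

/-- Naturality of the induced metric. -/
lemma inducedMetric_comp_diffeo {H : Type*} [NormedAddCommGroup H] [InnerProductSpace ℝ H]
    {φ : Torus → H} (hφ : SmoothOfOrder 1 φ) (Φ : TorusDiffeo) :
    inducedMetric (fun p => φ (Φ.toEquiv p)) = pullback Φ (inducedMetric φ) := by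
  funext p
  obtain ⟨x, rfl⟩ := surjective_proj p
  rw [pullback_proj_lift]
  ext i j
  simp only [inducedMetric, Matrix.of_apply, pd_comp_diffeo hφ Φ, Matrix.mul_apply,
    Matrix.transpose_apply, Fin.sum_univ_two, inner_add_left, inner_add_right, inner_smul_left,
    inner_smul_right]
  simp
  ring

/-- The pairing `g^{ij} ∂_i u ∂_j v` of the differentials of two functions. -/
def gradPairing (g : TensorField) (u v : Torus → ℝ) (p : Torus) : ℝ :=
  ∑ i, ∑ j, g p i j * pd i u p * pd j v p

lemma energyDensity_eq_gradPairing (g : TensorField) (u : Torus → ℝ) :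
    energyDensity g u = gradPairing g u u := rfl

lemma inv_pullback (Φ : TorusDiffeo) (k : TensorField) (x : Plane) :
    dualMetric (pullback Φ k) (proj x) = (jacobian Φ.lift x)⁻¹ * dualMetric k (Φ.toEquiv (proj x)) *
      ((jacobian Φ.lift x)⁻¹).transpose := by
  simp only [dualMetric]
  rw [pullback_proj_lift, Matrix.mul_inv_rev, Matrix.mul_inv_rev, Matrix.transpose_nonsing_inv,
    Matrix.mul_assoc]

/-- Naturality of the pairing of differentials. -/
lemma gradPairing_comp_diffeo {u v : Torus → ℝ} (hu : SmoothOfOrder 1 u) (hv : SmoothOfOrder 1 v)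
    (Φ : TorusDiffeo) (k : TensorField) (p : Torus) :
    gradPairing (dualMetric (pullback Φ k)) (fun p => u (Φ.toEquiv p)) (fun p => v (Φ.toEquiv p)) p =
      gradPairing (dualMetric k) u v (Φ.toEquiv p) := by
  obtain ⟨x, rfl⟩ := surjective_proj p
  set J := jacobian Φ.lift x with hJ
  have hdet : J.det ≠ 0 := Φ.det_jacobian_ne_zero x
  have hJu : IsUnit J.det := isUnit_iff_ne_zero.2 hdet
  have hform : ∀ (g : TensorField) (u v : Torus → ℝ) (q : Torus), gradPairing g u v q =
      (fun i => pd i u q) ⬝ᵥ (g q).mulVec (fun j => pd j v q) := by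
    intro g u v q
    simp only [gradPairing, dotProduct, Matrix.mulVec, Fin.sum_univ_two]
    ring
  have hgrad : ∀ {w : Torus → ℝ}, SmoothOfOrder 1 w →
      (fun i => pd i (fun p => w (Φ.toEquiv p)) (proj x)) =
        J.transpose.mulVec (fun i => pd i w (Φ.toEquiv (proj x))) := by
    intro w hw
    funext i
    rw [pd_comp_diffeo hw]
    simp [Matrix.mulVec, dotProduct, hJ]
  rw [hform, hform, hgrad hu, hgrad hv, inv_pullback, ← hJ, Matrix.mulVec_mulVec,
    Matrix.mulVec_transpose, ← Matrix.dotProduct_mulVec, Matrix.mulVec_mulVec]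
  congr 2
  rw [Matrix.mul_assoc _ _ J.transpose, ← Matrix.transpose_mul, Matrix.mul_nonsing_inv _ hJu,
    Matrix.transpose_one, Matrix.mul_one, ← Matrix.mul_assoc, Matrix.mul_nonsing_inv _ hJu,
    Matrix.one_mul]

lemma pairing_eq_trace (g h : TensorField) (p : Torus) :
    pairing g h p = (g p * (h p).transpose).trace := by
  simp [pairing, Matrix.trace, Matrix.mul_apply]

lemma pairing_smul_pullback (Φ : TorusDiffeo) (k k' : TensorField) (c : ℝ) (p : Torus) :
    pairing (dualMetric (pullback Φ k)) (c • pullback Φ k') p =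
      c * pairing (dualMetric k) k' (Φ.toEquiv p) := by
  obtain ⟨x, rfl⟩ := surjective_proj p
  have hJu : IsUnit (jacobian Φ.lift x).det := isUnit_iff_ne_zero.2 (Φ.det_jacobian_ne_zero x)
  rw [pairing_eq_trace, pairing_eq_trace, inv_pullback, Pi.smul_apply, pullback_proj_lift]
  set J := jacobian Φ.lift x
  set A := dualMetric k (Φ.toEquiv (proj x))
  set B := k' (Φ.toEquiv (proj x))
  have h1 : J⁻¹.transpose * J.transpose = 1 := by
    rw [← Matrix.transpose_mul, Matrix.mul_nonsing_inv _ hJu, Matrix.transpose_one]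
  have h2 : J⁻¹ * A * J⁻¹.transpose * (c • (J.transpose * B * J)).transpose =
      c • (J⁻¹ * (A * B.transpose * J)) := by
    rw [Matrix.transpose_smul, Matrix.transpose_mul, Matrix.transpose_mul,
      Matrix.transpose_transpose, Matrix.mul_smul]
    congr 1
    calc J⁻¹ * A * J⁻¹.transpose * (J.transpose * (B.transpose * J))
        = J⁻¹ * A * (J⁻¹.transpose * J.transpose) * (B.transpose * J) := by
          simp only [Matrix.mul_assoc]
      _ = _ := by rw [h1]; simp only [Matrix.mul_assoc, Matrix.one_mul]
  rw [h2, Matrix.trace_smul, Matrix.trace_mul_comm, Matrix.mul_assoc, Matrix.mul_nonsing_inv _ hJu,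
    Matrix.mul_one, smul_eq_mul]

end Diffeo

section ChangeOfVariables

/-- The lattice of deck transformations of the covering `proj`. -/
def deckGroup : AddSubgroup Plane :=
  (AddMonoidHom.mk' proj proj_add).ker

lemma mem_deckGroup {x : Plane} : x ∈ deckGroup ↔ proj x = 0 := Iff.rfl

instance : Countable deckGroup := by
  have : Set.Countable (deckGroup : Set Plane) := by
    refine (Set.countable_range (fun n : Fin 2 → ℤ => (fun i => (n i : ℝ) : Plane))).mono ?_
    intro x hx
    obtain ⟨n, hn⟩ := proj_eq_zero_iff.1 hx
    exact ⟨n, hn.symm⟩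
  exact this.to_subtype

/-- The half-open unit square. -/
def unitSquare : Set Plane := {x | ∀ i, x i ∈ Set.Ioc (0 : ℝ) (0 + 1)}

lemma measurableSet_unitSquare : MeasurableSet unitSquare :=
  MeasurableSet.univ_pi' fun _ => measurableSet_Ioc

lemma existsUnique_unitSquare (p : Torus) : ∃! x, x ∈ unitSquare ∧ proj x = p := by
  refine ⟨fun i => (AddCircle.equivIoc 1 0 (p i)).1,
    ⟨fun i => (AddCircle.equivIoc 1 0 (p i)).2, ?_⟩, ?_⟩
  · funext i
    exact (AddCircle.equivIoc 1 0).symm_apply_apply (p i)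
  · rintro y ⟨hy, rfl⟩
    funext i
    have := (AddCircle.equivIoc (1 : ℝ) 0).apply_symm_apply ⟨y i, hy i⟩
    exact (congrArg Subtype.val this).symm

lemma integral_eq_setIntegral_unitSquare {E : Type*} [NormedAddCommGroup E] [NormedSpace ℝ E]
    (f : Torus → E) : ∫ p, f p = ∫ x in unitSquare, f (proj x) := by
  rw [volume_eq_pi_haar]
  exact UnitAddTorus.integral_preimage f 0

/-- A measurable set of representatives of the points of the torus is a fundamental domain. -/
lemma isAddFundamentalDomain_of_existsUnique {S : Set Plane} (hS : MeasurableSet S)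
    (h : ∀ p, ∃! x, x ∈ S ∧ proj x = p) : IsAddFundamentalDomain deckGroup S volume := by
  refine IsAddFundamentalDomain.mk' hS.nullMeasurableSet fun y => ?_
  obtain ⟨x, ⟨hx, hxy⟩, huniq⟩ := h (proj y)
  refine ⟨⟨x - y, by rw [mem_deckGroup, proj_sub, hxy, sub_self]⟩, ?_, ?_⟩
  · change x - y + y ∈ S
    rwa [sub_add_cancel]
  · rintro ⟨g, hg⟩ hgy
    change g + y ∈ S at hgy
    have := huniq (g + y) ⟨hgy, by rw [proj_add, mem_deckGroup.1 hg, zero_add]⟩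
    exact Subtype.ext (eq_sub_of_add_eq this)

/-- Change of variables on the torus: the image of the unit square under a lift of a
diffeomorphism is again a fundamental domain of the covering. -/
lemma integral_comp_diffeo {E : Type*} [NormedAddCommGroup E] [NormedSpace ℝ E]
    (Φ : TorusDiffeo) (f : Torus → E) :
    ∫ p, |(jacobian Φ.lift (rep p)).det| • f (Φ.toEquiv p) = ∫ p, f p := by
  set F := Φ.lift with hFdef
  have hF := Φ.lift_spec
  have hdet : ∀ x, (jacobian F (rep (proj x))).det = (jacobian F x).det := fun x => by
    unfold jacobian
    rw [fderiv_lift_eq hF hF (proj_rep (proj x))]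
  have hinj : Set.InjOn F unitSquare := by
    intro x hx y hy hxy
    have h1 : proj x = proj y := Φ.toEquiv.injective (by rw [← hF.2, ← hF.2, ← hFdef, hxy])
    exact (existsUnique_unitSquare (proj y)).unique ⟨hx, h1⟩ ⟨hy, rfl⟩
  have hder : ∀ x ∈ unitSquare, HasFDerivWithinAt F (fderiv ℝ F x) unitSquare x := fun x _ =>
    (Φ.differentiable_lift x).hasFDerivAt.hasFDerivWithinAt
  have hmeas : MeasurableSet (F '' unitSquare) :=
    measurable_image_of_fderivWithin measurableSet_unitSquare hder hinj
  have hdom : ∀ p, ∃! x, x ∈ F '' unitSquare ∧ proj x = p := by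
    intro p
    obtain ⟨x, ⟨hx, hxp⟩, huniq⟩ := existsUnique_unitSquare (Φ.toEquiv.symm p)
    refine ⟨F x, ⟨⟨x, hx, rfl⟩, by rw [hF.2, hxp]; simp⟩, ?_⟩
    rintro _ ⟨⟨y, hy, rfl⟩, hyp⟩
    rw [hF.2] at hyp
    rw [huniq y ⟨hy, by rw [← hyp]; simp⟩]
  rw [integral_eq_setIntegral_unitSquare, integral_eq_setIntegral_unitSquare,
    (isAddFundamentalDomain_of_existsUnique measurableSet_unitSquare
      existsUnique_unitSquare).setIntegral_eq
      (isAddFundamentalDomain_of_existsUnique hmeas hdom)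
      (f := fun x => f (proj x)),
    integral_image_eq_integral_abs_det_fderiv_smul volume measurableSet_unitSquare hder hinj]
  · refine setIntegral_congr_fun measurableSet_unitSquare fun x _ => ?_
    change |(jacobian F (rep (proj x))).det| • f _ = |(fderiv ℝ F x).det| • f (proj (F x))
    rw [hdet, det_jacobian, hFdef, hF.2]
  · rintro ⟨g, hg⟩ x
    change f (proj (g + x)) = _
    rw [proj_add, mem_deckGroup.1 hg, zero_add]

end ChangeOfVariables

/-! ### Riemannian metrics, volume elements and Green's formula -/

section Metrics

lemma IsRiemannianMetric.det_pos {h : TensorField} (hh : IsRiemannianMetric h) (p : Torus) :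
    0 < (h p).det := (hh.2 p).det_pos

lemma IsRiemannianMetric.smooth_det {h : TensorField} (hh : IsRiemannianMetric h) :
    SmoothOfOrder ⊤ (fun p => (h p).det) := by
  simp only [Matrix.det_fin_two]
  exact ((hh.1 0 0).mul (hh.1 1 1)).sub ((hh.1 0 1).mul (hh.1 1 0))

lemma IsRiemannianMetric.smooth_sqrt_det {h : TensorField} (hh : IsRiemannianMetric h) :
    SmoothOfOrder ⊤ (fun p => Real.sqrt (h p).det) :=
  ContDiff.sqrt hh.smooth_det fun x => (hh.det_pos (proj x)).ne'

lemma IsRiemannianMetric.smooth_dualMetric {h : TensorField} (hh : IsRiemannianMetric h) :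
    IsSmoothTensor (dualMetric h) := by
  have hinv : SmoothOfOrder ⊤ (fun p => ((h p).det)⁻¹) :=
    ContDiff.inv hh.smooth_det fun x => (hh.det_pos (proj x)).ne'
  intro i j
  simp only [dualMetric, Matrix.inv_def, Matrix.adjugate_fin_two, Ring.inverse_eq_inv',
    Matrix.smul_apply, smul_eq_mul]
  refine hinv.mul ?_
  fin_cases i <;> fin_cases j
  · exact hh.1 1 1
  · exact ContDiff.neg (hh.1 0 1)
  · exact ContDiff.neg (hh.1 1 0)
  · exact hh.1 0 0

lemma IsRiemannianMetric.isCometric_dualMetric {h : TensorField} (hh : IsRiemannianMetric h) :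
    IsCometric (dualMetric h) :=
  ⟨hh.smooth_dualMetric, fun p => (hh.2 p).inv.posSemidef⟩

lemma isRiemannianMetric_const {K : Matrix (Fin 2) (Fin 2) ℝ} (hK : K.PosDef) :
    IsRiemannianMetric (fun _ => K) :=
  ⟨fun _ _ => SmoothOfOrder.const _, fun _ => hK⟩

lemma IsRiemannianMetric.pullback {k : TensorField} (hk : IsRiemannianMetric k) (Φ : TorusDiffeo) :
    IsRiemannianMetric (pullback Φ k) := by
  constructor
  · have hJ : ∀ i j, ContDiff ℝ ∞ (fun x => jacobian Φ.lift x i j) := fun i j =>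
      (contDiff_apply ℝ ℝ i).comp
        ((Φ.lift_spec.1.fderiv_right (m := ∞) (by simp)).clm_apply contDiff_const)
    intro i j
    unfold SmoothOfOrder
    simp only [pullback_proj_lift, Matrix.mul_apply, Matrix.transpose_apply]
    exact ContDiff.sum fun l _ => (ContDiff.sum fun m _ => (hJ m i).mul
      ((hk.1 m l).comp_diffeo Φ)).mul (hJ l j)
  · intro p
    obtain ⟨x, rfl⟩ := surjective_proj p
    rw [pullback_proj_lift, ← Matrix.conjTranspose_eq_transpose_of_trivial]
    refine (hk.2 _).conjTranspose_mul_mul_same ?_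
    exact Matrix.mulVec_injective_of_isUnit
      ((Matrix.isUnit_iff_isUnit_det _).2 (isUnit_iff_ne_zero.2 (Φ.det_jacobian_ne_zero x)))

lemma IsRiemannianMetric.smul {k : TensorField} (hk : IsRiemannianMetric k) {c : ℝ} (hc : 0 < c) :
    IsRiemannianMetric (c • k) :=
  ⟨fun i j => (SmoothOfOrder.const c).mul (hk.1 i j), fun p => (hk.2 p).smul hc⟩

variable {E : Type*} [NormedAddCommGroup E] [NormedSpace ℝ E]

lemma IsRiemannianMetric.integral_volumeElement {h : TensorField} (hh : IsRiemannianMetric h)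
    (f : Torus → E) : ∫ p, f p ∂(volumeElement h) = ∫ p, Real.sqrt (h p).det • f p := by
  rw [volumeElement, integral_withDensity_eq_integral_toReal_smul
    (hh.smooth_sqrt_det.continuous.measurable.ennreal_ofReal) (by simp)]
  simp [ENNReal.toReal_ofReal (Real.sqrt_nonneg _)]

lemma IsRiemannianMetric.isFiniteMeasure {h : TensorField} (hh : IsRiemannianMetric h) :
    IsFiniteMeasure (volumeElement h) :=
  isFiniteMeasure_withDensity_ofReal
    (integrable_of_continuous hh.smooth_sqrt_det.continuous _).2

lemma IsRiemannianMetric.isOpenPosMeasure {h : TensorField} (hh : IsRiemannianMetric h) :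
    (volumeElement h).IsOpenPosMeasure := by
  have : (volume : Measure Torus) ≪ volumeElement h :=
    withDensity_absolutelyContinuous'
      (hh.smooth_sqrt_det.continuous.measurable.ennreal_ofReal).aemeasurable
      (Filter.Eventually.of_forall fun p => by
        simpa using hh.det_pos p)
  exact this.isOpenPosMeasure

/-- Green's formula for the Laplacian of a Riemannian metric on the torus. -/
lemma IsRiemannianMetric.green {h : TensorField} (hh : IsRiemannianMetric h) {u v : Torus → ℝ}
    (hu : SmoothOfOrder ⊤ u) (hv : SmoothOfOrder 1 v) :
    ∫ p, laplacian h u p * v p ∂(volumeElement h) =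
      -∫ p, gradPairing (dualMetric h) u v p ∂(volumeElement h) := by
  set X : Fin 2 → Torus → ℝ := fun i q =>
    Real.sqrt (h q).det * ∑ j, dualMetric h q i j * pd j u q with hX
  have hXs : ∀ i, SmoothOfOrder ⊤ (X i) := fun i =>
    hh.smooth_sqrt_det.mul (SmoothOfOrder.sum fun j _ => (hh.smooth_dualMetric i j).mul (hu.pd j))
  rw [hh.integral_volumeElement, hh.integral_volumeElement]
  have e1 : ∀ p, Real.sqrt (h p).det • (laplacian h u p * v p) =
      ∑ i, pd i (X i) p * v p := by
    intro p
    have : Real.sqrt (h p).det ≠ 0 := (Real.sqrt_pos.2 (hh.det_pos p)).ne'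
    simp only [laplacian, smul_eq_mul, ← Finset.sum_mul]
    rw [mul_assoc, mul_inv_cancel_left₀ this]
  have e2 : ∀ p, Real.sqrt (h p).det • gradPairing (dualMetric h) u v p =
      ∑ i, X i p * pd i v p := by
    intro p
    have hs := (hh.2 p).inv.isHermitian
    have h01 : (h p)⁻¹ 1 0 = (h p)⁻¹ 0 1 := by simpa using (hs.apply 0 1)
    simp only [gradPairing, hX, Fin.sum_univ_two, smul_eq_mul, dualMetric, h01]
    ring
  simp only [e1, e2]
  have hXc := fun i => (hXs i).of_top (n := 1)
  rw [integral_finsetSum (f := fun i p => pd i (X i) p * v p) _ fun i _ =>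
      integrable_of_continuous (((hXc i).continuous_pd i).mul hv.continuous) _,
    integral_finsetSum (f := fun i p => X i p * pd i v p) _ fun i _ => integrable_of_continuous
      ((hXc i).continuous.mul (hv.continuous_pd i)) _, ← Finset.sum_neg_distrib]
  exact Finset.sum_congr rfl fun i _ => integral_pd_mul (hXc i) hv i

lemma IsRiemannianMetric.smooth_laplacian {h : TensorField} (hh : IsRiemannianMetric h)
    {u : Torus → ℝ} (hu : SmoothOfOrder ⊤ u) : SmoothOfOrder ⊤ (laplacian h u) := by
  have h1 : SmoothOfOrder ⊤ (fun p => (Real.sqrt (h p).det)⁻¹) :=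
    ContDiff.inv hh.smooth_sqrt_det fun x => (Real.sqrt_pos.2 (hh.det_pos (proj x))).ne'
  exact h1.mul (SmoothOfOrder.sum fun i _ => (hh.smooth_sqrt_det.mul
    (SmoothOfOrder.sum fun j _ => (hh.smooth_dualMetric i j).mul (hu.pd j))).pd i)

lemma gradPairing_continuous {g : TensorField} (hg : IsSmoothTensor g) {u v : Torus → ℝ}
    (hu : SmoothOfOrder 1 u) (hv : SmoothOfOrder 1 v) : Continuous (gradPairing g u v) :=
  continuous_finsetSum _ fun i _ => continuous_finsetSum _ fun j _ =>
    ((hg i j).continuous.mul (hu.continuous_pd i)).mul (hv.continuous_pd j)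

/-- Integration against the volume element of a metric pulled back from a constant one. -/
lemma integral_volumeElement_pullback {Φ : TorusDiffeo} {c : ℝ} (hc : 0 < c)
    {K : Matrix (Fin 2) (Fin 2) ℝ} (hK : K.PosDef) (f : Torus → E) :
    ∫ p, f (Φ.toEquiv p) ∂(volumeElement (c • pullback Φ (fun _ => K))) =
      (c * Real.sqrt K.det) • ∫ p, f p := by
  rw [((((isRiemannianMetric_const hK).pullback Φ).smul hc)).integral_volumeElement,
    ← integral_comp_diffeo Φ f, ← integral_smul]
  congr 1; funext p
  rw [smul_smul]
  congr 1
  simp only [Pi.smul_apply, Matrix.det_smul, pullback, Matrix.det_mul, Matrix.det_transpose,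
    Fintype.card_fin]
  rw [show c ^ 2 * ((jacobian Φ.lift (rep p)).det * K.det * (jacobian Φ.lift (rep p)).det) =
    (c * |(jacobian Φ.lift (rep p)).det|) ^ 2 * K.det by rw [mul_pow, sq_abs]; ring,
    Real.sqrt_mul (by positivity), Real.sqrt_sq (by positivity)]
  ring

lemma integral_normalized (μ : Measure Torus) (f : Torus → E) :
    ∫ p, f p ∂(normalized μ) = (μ.real Set.univ)⁻¹ • ∫ p, f p ∂μ := by
  rw [normalized, integral_smul_measure, ENNReal.toReal_inv, Measure.real]

lemma measureReal_volumeElement_pullback {Φ : TorusDiffeo} {c : ℝ} (hc : 0 < c)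
    {K : Matrix (Fin 2) (Fin 2) ℝ} (hK : K.PosDef) :
    (volumeElement (c • pullback Φ (fun _ => K))).real Set.univ = c * Real.sqrt K.det := by
  simpa using integral_volumeElement_pullback (Φ := Φ) hc hK (fun _ => (1 : ℝ))

/-- The diffeomorphism `Φ` carries the normalized volume element of `c Φ^* k`, `k` constant, to
the Lebesgue measure. -/
lemma integral_normalized_pullback {Φ : TorusDiffeo} {c : ℝ} (hc : 0 < c)
    {K : Matrix (Fin 2) (Fin 2) ℝ} (hK : K.PosDef) (f : Torus → E) :
    ∫ p, f (Φ.toEquiv p) ∂(normalized (volumeElement (c • pullback Φ (fun _ => K)))) =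
      ∫ p, f p := by
  have : c * Real.sqrt K.det ≠ 0 := (mul_pos hc (Real.sqrt_pos.2 hK.det_pos)).ne'
  rw [integral_normalized, integral_volumeElement_pullback hc hK,
    measureReal_volumeElement_pullback hc hK, smul_smul, inv_mul_cancel₀ this, one_smul]

lemma eq_zero_of_integral_sq {μ : Measure Torus} [IsFiniteMeasure μ] [μ.IsOpenPosMeasure]
    {w : Torus → ℝ} (hw : Continuous w) (h : ∫ p, w p ^ 2 ∂μ = 0) : w = 0 := by
  by_contra hne
  obtain ⟨p, hp⟩ := Function.ne_iff.1 hne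
  have := (hw.pow 2).integral_pos_of_hasCompactSupport_nonneg_nonzero (μ := μ) (x := p)
    (HasCompactSupport.of_compactSpace _) (fun q => sq_nonneg (w q)) (pow_ne_zero 2 hp)
  exact this.ne' h

/-- Naturality of the Laplacian, for the pull-back of a constant metric. -/
lemma laplacian_comp_diffeo {K : Matrix (Fin 2) (Fin 2) ℝ} (hK : K.PosDef) (Φ : TorusDiffeo)
    {u : Torus → ℝ} (hu : SmoothOfOrder ⊤ u) (p : Torus) :
    laplacian (pullback Φ (fun _ => K)) (fun q => u (Φ.toEquiv q)) p =
      laplacian (fun _ => K) u (Φ.toEquiv p) := by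
  set k : TensorField := fun _ => K with hk
  have hkR : IsRiemannianMetric k := isRiemannianMetric_const hK
  have hR := hkR.pullback Φ
  have := hR.isFiniteMeasure
  have := hR.isOpenPosMeasure
  set w : Torus → ℝ := fun p => laplacian (pullback Φ k) (fun q => u (Φ.toEquiv q)) p -
    laplacian k u (Φ.toEquiv p) with hw
  have hs1 := hR.smooth_laplacian (hu.comp_diffeo Φ)
  have hs2 := (hkR.smooth_laplacian hu).comp_diffeo Φ
  have hws : SmoothOfOrder ⊤ w := ContDiff.sub hs1 hs2
  -- Green's formula holds on both sides, and the Dirichlet form is natural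
  have key : ∀ v : Torus → ℝ, SmoothOfOrder ⊤ v →
      ∫ p, w p * v (Φ.toEquiv p) ∂(volumeElement (pullback Φ k)) = 0 := by
    intro v hv
    have hone : pullback Φ k = (1 : ℝ) • pullback Φ k := (one_smul _ _).symm
    have g1 := hR.green (hu.comp_diffeo Φ) ((hv.comp_diffeo Φ).of_top (n := 1))
    simp only [gradPairing_comp_diffeo (hu.of_top (n := 1)) (hv.of_top (n := 1)) Φ k] at g1
    have g2 := hkR.green hu (hv.of_top (n := 1))
    have t1 := integral_volumeElement_pullback (Φ := Φ) one_pos hK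
      (fun p => gradPairing (dualMetric k) u v p)
    have t2 := integral_volumeElement_pullback (Φ := Φ) one_pos hK
      (fun p => laplacian k u p * v p)
    rw [← hk, ← hone] at t1 t2
    rw [hkR.integral_volumeElement, hkR.integral_volumeElement] at g2
    simp only [hk, integral_smul] at g2
    have e : ∀ p, w p * v (Φ.toEquiv p) =
        laplacian (pullback Φ k) (fun q => u (Φ.toEquiv q)) p * v (Φ.toEquiv p) -
        laplacian k u (Φ.toEquiv p) * v (Φ.toEquiv p) := fun p => sub_mul _ _ _
    simp only [e]
    rw [integral_sub
      (f := fun p => laplacian (pullback Φ k) (fun q => u (Φ.toEquiv q)) p * v (Φ.toEquiv p))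
      (g := fun p => laplacian k u (Φ.toEquiv p) * v (Φ.toEquiv p))
      (integrable_of_continuous (hs1.continuous.mul (hv.comp_diffeo Φ).continuous) _)
      (integrable_of_continuous (hs2.continuous.mul (hv.comp_diffeo Φ).continuous) _), g1, t1, t2]
    simp only [smul_eq_mul, one_mul, hk] at g2 ⊢
    linarith
  have hz := key (fun q => w (Φ.symm.toEquiv q)) (hws.comp_diffeo Φ.symm)
  simp only [TorusDiffeo.symm, Equiv.symm_apply_apply, ← pow_two] at hz
  have := congrFun (eq_zero_of_integral_sq hws.continuous hz) p
  simp only [hw, Pi.zero_apply] at this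
  linarith

end Metrics

/-! ### Weak duality between inflated maps and the eigenvalue problem -/

section Duality

/-- The pairing of positive semidefinite tensors is nonnegative, as their Hadamard product is
positive semidefinite. -/
lemma pairing_nonneg {g h : TensorField} {p : Torus} (hg : (g p).PosSemidef)
    (hh : (h p).PosSemidef) : 0 ≤ pairing g h p := by
  have := (hg.hadamard hh).dotProduct_mulVec_nonneg (fun _ => 1)
  simpa [dotProduct, Matrix.mulVec, Matrix.hadamard_apply, pairing] using this

lemma energyDensity_nonneg {g : TensorField} {p : Torus} (hg : (g p).PosSemidef)
    (u : Torus → ℝ) : 0 ≤ energyDensity g u p := by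
  have := hg.dotProduct_mulVec_nonneg (fun i => pd i u p)
  refine this.trans_eq ?_
  simp only [energyDensity, dotProduct, Matrix.mulVec, Fin.sum_univ_two, Pi.star_apply,
    star_trivial]
  ring

lemma energyDensity_continuous {g : TensorField} (hg : IsSmoothTensor g) {u : Torus → ℝ}
    (hu : SmoothOfOrder 1 u) : Continuous (energyDensity g u) :=
  gradPairing_continuous hg hu hu

lemma pairing_continuous {g h : TensorField} (hg : IsSmoothTensor g) (hh : IsSmoothTensor h) :
    Continuous (pairing g h) :=
  continuous_finsetSum _ fun i _ => continuous_finsetSum _ fun j _ =>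
    (hg i j).continuous.mul (hh i j).continuous

variable {μ : Measure Torus} [IsFiniteMeasure μ] [μ.IsOpenPosMeasure]

lemma integral_sq_pos {u : Torus → ℝ} (hu : Continuous u) (hne : u ≠ 0) :
    0 < ∫ p, u p ^ 2 ∂μ :=
  (integral_nonneg fun p => sq_nonneg (u p)).lt_of_ne' fun h =>
    hne (eq_zero_of_integral_sq hu h)

/-- Functions with mean value zero, including `0`, are test functions for `λ₁`. -/
lemma lambda1_mul_integral_sq_le {g : TensorField} (hg : IsCometric g) {u : Torus → ℝ}
    (hu : SmoothOfOrder 1 u) (h0 : ∫ p, u p ∂μ = 0) :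
    lambda1 μ g * ∫ p, u p ^ 2 ∂μ ≤ ∫ p, energyDensity g u p ∂μ := by
  by_cases hne : u = 0
  · subst hne
    simpa using integral_nonneg (μ := μ) fun p => energyDensity_nonneg (hg.2 p) (0 : Torus → ℝ)
  · have hpos := integral_sq_pos (μ := μ) hu.continuous hne
    rw [← le_div_iff₀ hpos]
    refine csInf_le ⟨0, ?_⟩ ⟨u, hu, hne, h0, rfl⟩
    rintro r ⟨v, -, -, -, rfl⟩
    exact div_nonneg (integral_nonneg fun p => energyDensity_nonneg (hg.2 p) v)
      (integral_nonneg fun p => sq_nonneg _)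

/-- Pointwise, the energy densities of the coordinates of a short map add up to at most
`(g*, h)`. -/
lemma sum_energyDensity_le_pairing {h g : TensorField} {p : Torus} (hg : (g p).PosSemidef)
    {ψ : Torus → ℓ2} (hψ : SmoothOfOrder 1 ψ) (hs : (h p - inducedMetric ψ p).PosSemidef)
    (s : Finset ℕ) :
    ∑ k ∈ s, energyDensity g (fun q => (ψ q : ℕ → ℝ) k) p ≤ pairing g h p := by
  have hpd : ∀ (k : ℕ) (i : Fin 2), pd i (fun q => (ψ q : ℕ → ℝ) k) p = ((pd i ψ p : ℓ2) : ℕ → ℝ) k :=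
    fun k i => pd_clm hψ (lp.evalCLM ℝ (fun _ : ℕ => ℝ) 2 k) i p
  have hsum : HasSum (fun k => energyDensity g (fun q => (ψ q : ℕ → ℝ) k) p)
      (pairing g (inducedMetric ψ) p) := by
    simp only [energyDensity, pairing, inducedMetric, Matrix.of_apply, hpd]
    refine hasSum_sum fun i _ => hasSum_sum fun j _ => ?_
    have := (lp.hasSum_inner (𝕜 := ℝ) (pd i ψ p) (pd j ψ p)).mul_left (g p i j)
    refine this.congr_fun fun k => ?_
    rw [Real.inner_apply, mul_assoc]
  refine (sum_le_hasSum s (fun k _ => energyDensity_nonneg hg _) hsum).trans ?_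
  have := pairing_nonneg (g := g) (h := fun p => h p - inducedMetric ψ p) hg hs
  simp only [pairing, Matrix.sub_apply, mul_sub, Finset.sum_sub_distrib] at this ⊢
  linarith

/-- **Weak duality**: `λ₁(dμ, g*) ∫ ‖ψ‖² dμ₁ ≤ ∫ (g*, h) dμ₁` for every short map `ψ` with mean
value zero.  Each coordinate of `ψ` is a test function for `λ₁`. -/
theorem lambda1_mul_variance_le {h g : TensorField} (hh : IsSmoothTensor h) (hg : IsCometric g)
    {ψ : Torus → ℓ2} (hψ : IsFeasible μ h ψ) :
    lambda1 μ g * variance μ ψ ≤ ∫ p, pairing g h p ∂(normalized μ) := by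
  obtain ⟨hsm, hshort, hmean⟩ := hψ
  have hψ1 : SmoothOfOrder 1 ψ := hsm.of_top
  have hV : 0 ≤ (μ.real Set.univ)⁻¹ := by positivity
  rw [variance, integral_normalized, integral_normalized, smul_eq_mul, smul_eq_mul, mul_left_comm]
  refine mul_le_mul_of_nonneg_left ?_ hV
  have hcoord : ∀ k : ℕ, SmoothOfOrder 1 (fun q => (ψ q : ℕ → ℝ) k) := fun k =>
    (lp.evalCLM ℝ (fun _ : ℕ => ℝ) 2 k).contDiff.comp hψ1
  have hint0 : ∀ k : ℕ, ∫ p, (ψ p : ℕ → ℝ) k ∂μ = 0 := by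
    intro k
    by_cases hμ : μ = 0
    · simp [hμ]
    rw [integral_normalized] at hmean
    have hne : (μ.real Set.univ)⁻¹ ≠ 0 := by
      refine inv_ne_zero fun h0 => hμ ?_
      rwa [measureReal_eq_zero_iff, Measure.measure_univ_eq_zero] at h0
    have h1 := (smul_eq_zero.1 hmean).resolve_left hne
    have h2 := (lp.evalCLM ℝ (fun _ : ℕ => ℝ) 2 k).integral_comp_comm
      (integrable_of_continuous hψ1.continuous μ)
    rw [h1, map_zero] at h2
    exact h2
  -- the inequality for the first `n` coordinates
  have hfin : ∀ n : ℕ, lambda1 μ g * ∫ p, ∑ k ∈ Finset.range n, ((ψ p : ℕ → ℝ) k) ^ 2 ∂μ ≤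
      ∫ p, pairing g h p ∂μ := by
    intro n
    rw [integral_finsetSum (f := fun k p => ((ψ p : ℕ → ℝ) k) ^ 2) _ fun k _ =>
      integrable_of_continuous ((hcoord k).continuous.pow 2) _, Finset.mul_sum]
    calc ∑ k ∈ Finset.range n, lambda1 μ g * ∫ p, ((ψ p : ℕ → ℝ) k) ^ 2 ∂μ
        ≤ ∑ k ∈ Finset.range n, ∫ p, energyDensity g (fun q => (ψ q : ℕ → ℝ) k) p ∂μ :=
          Finset.sum_le_sum fun k _ => lambda1_mul_integral_sq_le hg (hcoord k) (hint0 k)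
      _ = ∫ p, ∑ k ∈ Finset.range n, energyDensity g (fun q => (ψ q : ℕ → ℝ) k) p ∂μ :=
          (integral_finsetSum _ fun k _ =>
            integrable_of_continuous (energyDensity_continuous hg.1 (hcoord k)) _).symm
      _ ≤ ∫ p, pairing g h p ∂μ := by
          refine integral_mono (integrable_of_continuous (continuous_finsetSum _ fun k _ =>
            energyDensity_continuous hg.1 (hcoord k)) _)
            (integrable_of_continuous (pairing_continuous hg.1 hh) _) fun p => ?_
          exact sum_energyDensity_le_pairing (hg.2 p) hψ1 (hshort p) _
  have hnorm : ∀ p, HasSum (fun k => ((ψ p : ℕ → ℝ) k) ^ 2) (‖ψ p‖ ^ 2) := by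
    intro p
    have := lp.hasSum_inner (𝕜 := ℝ) (ψ p) (ψ p)
    simpa only [real_inner_self_eq_norm_sq, Real.norm_eq_abs, sq_abs] using this
  have hlim := tendsto_integral_of_dominated_convergence (μ := μ)
    (F := fun n p => ∑ k ∈ Finset.range n, ((ψ p : ℕ → ℝ) k) ^ 2) (fun p => ‖ψ p‖ ^ 2)
    (fun n => (integrable_of_continuous (continuous_finsetSum _ fun k _ =>
      (hcoord k).continuous.pow 2) _).aestronglyMeasurable)
    (integrable_of_continuous (hψ1.continuous.norm.pow 2) _)
    (fun n => Filter.Eventually.of_forall fun p => by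
      rw [Real.norm_of_nonneg (Finset.sum_nonneg fun k _ => sq_nonneg _)]
      exact sum_le_hasSum _ (fun k _ => sq_nonneg _) (hnorm p))
    (Filter.Eventually.of_forall fun p => (hnorm p).tendsto_sum_nat)
  exact le_of_tendsto (hlim.const_mul _) (Filter.Eventually.of_forall hfin)

/-- If equality holds in weak duality for `ψ` and `g*`, then `ψ` is inflated. -/
lemma isInflated_of_eq {h g : TensorField} (hh : IsSmoothTensor h) (hg : IsCometric g)
    {ψ : Torus → ℓ2} (hψ : IsFeasible μ h ψ) (hpos : 0 < lambda1 μ g)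
    (heq : ∫ p, pairing g h p ∂(normalized μ) ≤ lambda1 μ g * variance μ ψ) :
    IsInflated μ h ψ :=
  ⟨hψ, fun _ hψ' => le_of_mul_le_mul_left ((lambda1_mul_variance_le hh hg hψ').trans heq) hpos⟩

/-- If equality holds in weak duality for `ψ` and `g*`, then `g*` solves the eigenvalue
problem. -/
lemma solvesSpecProblem_of_eq {h g : TensorField} (hh : IsRiemannianMetric h) (hg : IsCometric g)
    {ψ : Torus → ℓ2} (hψ : IsFeasible μ h ψ) (hvar : 0 < variance μ ψ)
    (hpos : 0 < ∫ p, pairing g h p ∂(normalized μ))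
    (heq : ∫ p, pairing g h p ∂(normalized μ) ≤ lambda1 μ g * variance μ ψ) :
    SolvesSpecProblem μ h g := by
  refine ⟨hg, ?_, fun g' hg' _ => ?_⟩
  · rintro rfl
    simp [pairing] at hpos
  · have h1 : specFunctional μ h g' ≤ (variance μ ψ)⁻¹ := by
      have h0 : 0 ≤ ∫ p, pairing g' h p ∂(normalized μ) :=
        integral_nonneg fun p => pairing_nonneg (hg'.2 p) (hh.2 p).posSemidef
      -- if `∫ (g*, h)` vanishes, then the functional has the value `x / 0 = 0`
      rcases h0.eq_or_lt with h0 | h0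
      · rw [specFunctional, ← h0, div_zero]
        positivity
      · rw [specFunctional, div_le_iff₀ h0, ← div_eq_inv_mul, le_div_iff₀ hvar]
        exact lambda1_mul_variance_le hh.1 hg' hψ
    refine h1.trans ?_
    rw [specFunctional, le_div_iff₀ hpos, ← div_eq_inv_mul, div_le_iff₀ hvar]
    exact heq

end Duality

/-! ### The first eigenvalue of a flat metric -/

section FirstEigenvalue

lemma posDef_hMetric (a : ℝ) {b : ℝ} (hb : b ≠ 0) (p : Torus) : (hMetric a b p).PosDef := by
  refine Matrix.PosDef.of_dotProduct_mulVec_pos ?_ fun x hx => ?_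
  · ext i j
    fin_cases i <;> fin_cases j <;> simp [hMetric]
  · have h1 : star x ⬝ᵥ (hMetric a b p).mulVec x = (x 0 + a * x 1) ^ 2 + (b * x 1) ^ 2 := by
      simp [hMetric, dotProduct, Matrix.mulVec, Fin.sum_univ_two]
      ring
    rw [h1]
    by_cases h : x 1 = 0
    · have h0 : x 0 ≠ 0 := fun h0 => hx (by funext i; fin_cases i <;> simp [h, h0])
      rw [h, mul_zero, mul_zero, add_zero]
      positivity
    · positivity

/-- The metric `dx² + 2s dx dy + dy²`; the metrics `h_{s,√(1-s²)}` are of this form. -/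
lemma hMetric_sqrt {s : ℝ} (hs : s ^ 2 < 1) (p : Torus) :
    hMetric s (Real.sqrt (1 - s ^ 2)) p = !![1, s; s, 1] := by
  simp [hMetric, Real.sq_sqrt (by linarith : (0 : ℝ) ≤ 1 - s ^ 2)]

lemma dualMetric_hMetric_sqrt {s : ℝ} (hs : s ^ 2 < 1) (p : Torus) :
    dualMetric (hMetric s (Real.sqrt (1 - s ^ 2))) p = (1 - s ^ 2)⁻¹ • !![1, -s; -s, 1] := by
  rw [dualMetric, hMetric_sqrt hs, Matrix.inv_def, Matrix.adjugate_fin_two_of,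
    Ring.inverse_eq_inv', Matrix.det_fin_two_of]
  ring_nf

lemma sqrt_ne_zero_of {s : ℝ} (hs : s ^ 2 < 1) : Real.sqrt (1 - s ^ 2) ≠ 0 :=
  (Real.sqrt_pos.2 (by linarith)).ne'

lemma sq_lt_one_of_le_half {s : ℝ} (hs0 : 0 ≤ s) (hs1 : s ≤ 1 / 2) : s ^ 2 < 1 := by nlinarith

/-- Wirtinger's inequality, transported by a diffeomorphism. -/
lemma wirtinger_pullback {s : ℝ} (hs0 : 0 ≤ s) (hs1 : s ≤ 1 / 2) (Φ : TorusDiffeo) {c : ℝ}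
    (hc : 0 < c) {K : Matrix (Fin 2) (Fin 2) ℝ} (hK : K.PosDef) {u : Torus → ℝ}
    (hu : SmoothOfOrder 1 u) (h0 : ∫ p, u p ∂(volumeElement (c • pullback Φ (fun _ => K))) = 0) :
    4 * Real.pi ^ 2 / (1 - s ^ 2) * ∫ p, u p ^ 2 ∂(volumeElement (c • pullback Φ (fun _ => K))) ≤
      ∫ p, energyDensity (dualMetric (pullback Φ (hMetric s (Real.sqrt (1 - s ^ 2))))) u p
        ∂(volumeElement (c • pullback Φ (fun _ => K))) := by
  have hs := sq_lt_one_of_le_half hs0 hs1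
  have hCpos : 0 < c * Real.sqrt K.det := mul_pos hc (Real.sqrt_pos.2 hK.det_pos)
  obtain ⟨v, hv, rfl⟩ : ∃ v : Torus → ℝ, SmoothOfOrder 1 v ∧ u = fun p => v (Φ.toEquiv p) :=
    ⟨fun p => u (Φ.symm.toEquiv p), hu.comp_diffeo Φ.symm, by
      funext p; simp [TorusDiffeo.symm]⟩
  rw [integral_volumeElement_pullback hc hK, smul_eq_mul] at h0
  have h0' := (mul_eq_zero.1 h0).resolve_left hCpos.ne'
  have hW := wirtinger (by linarith) hs1 hv h0'
  simp only [energyDensity_eq_gradPairing, gradPairing_comp_diffeo hv hv]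
  rw [integral_volumeElement_pullback hc hK (fun p => v p ^ 2),
    integral_volumeElement_pullback hc hK (fun p => gradPairing _ v v p), smul_eq_mul, smul_eq_mul]
  have hE : ∀ p, gradPairing (dualMetric (hMetric s (Real.sqrt (1 - s ^ 2)))) v v p =
      (1 - s ^ 2)⁻¹ * (pd 0 v p ^ 2 - 2 * s * (pd 0 v p * pd 1 v p) + pd 1 v p ^ 2) := by
    intro p
    rw [gradPairing, dualMetric_hMetric_sqrt hs]
    simp [Fin.sum_univ_two]
    ring
  simp only [hE]
  rw [integral_const_mul]
  have h1 : 0 ≤ c * Real.sqrt K.det * (1 - s ^ 2)⁻¹ :=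
    mul_nonneg hCpos.le (inv_nonneg.2 (by linarith))
  calc _ = c * Real.sqrt K.det * (1 - s ^ 2)⁻¹ * (4 * Real.pi ^ 2 * ∫ p, v p ^ 2) := by ring
    _ ≤ _ := mul_le_mul_of_nonneg_left hW h1
    _ = _ := by ring

/-- The positive eigenvalues of `Φ^* h_{s,√(1-s²)}` are at least `4π²/(1-s²)`. -/
lemma le_of_isEigenvalue {s : ℝ} (hs0 : 0 ≤ s) (hs1 : s ≤ 1 / 2) (Φ : TorusDiffeo) {l : ℝ}
    (hl : 0 < l) (h : IsEigenvalue (pullback Φ (hMetric s (Real.sqrt (1 - s ^ 2)))) l) :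
    4 * Real.pi ^ 2 / (1 - s ^ 2) ≤ l := by
  obtain ⟨u, hu, hne, heq⟩ := h
  have hs := sq_lt_one_of_le_half hs0 hs1
  have hK := posDef_hMetric s (sqrt_ne_zero_of hs) 0
  set k := hMetric s (Real.sqrt (1 - s ^ 2)) with hk
  have hkc : k = fun _ => k 0 := rfl
  have hR : IsRiemannianMetric (pullback Φ k) := (isRiemannianMetric_const hK).pullback Φ
  have hone : pullback Φ k = (1 : ℝ) • pullback Φ (fun _ => k 0) := (one_smul _ _).symm
  have := hR.isFiniteMeasure
  have := hR.isOpenPosMeasure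
  have hlap : ∀ p, laplacian (pullback Φ k) u p = -l * u p := fun p => by
    rw [neg_mul, ← heq p, neg_neg]
  -- Green's formula with the functions `1` and `u`: the mean value of `u` is zero, and the
  -- Rayleigh quotient of `u` is `l`
  have g1 := hR.green hu (SmoothOfOrder.const (1 : ℝ))
  have g2 := hR.green hu (hu.of_top (n := 1))
  have hz : ∀ p, gradPairing (dualMetric (pullback Φ k)) u (fun _ => 1) p = 0 := by
    intro p
    simp [gradPairing, pd]
  simp only [hlap, hz, mul_one, integral_const_mul, integral_zero, neg_zero] at g1
  have hmean := (mul_eq_zero.1 g1).resolve_left (neg_ne_zero.2 hl.ne')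
  simp only [hlap, mul_assoc, integral_const_mul, ← pow_two] at g2
  rw [neg_mul, neg_inj] at g2
  have hW := wirtinger_pullback hs0 hs1 Φ one_pos hK (hu.of_top (n := 1)) (by
    rw [← hone]; exact hmean)
  rw [← hk, ← hone, energyDensity_eq_gradPairing, ← g2] at hW
  exact le_of_mul_le_mul_right hW (integral_sq_pos hu.continuous hne)

end FirstEigenvalue

/-! ### Embeddings of flat tori by trigonometric functions -/

section Embedding

open UnitAddTorus

/-- The function `cos (2π ⟨n, x⟩)` on the torus. -/
def cosT (n : Fin 2 → ℤ) (p : Torus) : ℝ := (mFourier n p).re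

/-- The function `sin (2π ⟨n, x⟩)` on the torus. -/
def sinT (n : Fin 2 → ℤ) (p : Torus) : ℝ := (mFourier n p).im

lemma smooth_cosT (m : ℕ∞) (n : Fin 2 → ℤ) : SmoothOfOrder m (cosT n) :=
  Complex.reCLM.contDiff.comp (smooth_mFourier m n)

lemma smooth_sinT (m : ℕ∞) (n : Fin 2 → ℤ) : SmoothOfOrder m (sinT n) :=
  Complex.imCLM.contDiff.comp (smooth_mFourier m n)

lemma pd_cosT (n : Fin 2 → ℤ) (i : Fin 2) (p : Torus) :
    pd i (cosT n) p = -(2 * Real.pi * n i) * sinT n p := by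
  have h := pd_clm (smooth_mFourier 1 n) Complex.reCLM i p
  rw [pd_mFourier] at h
  refine h.trans ?_
  simp [sinT, Complex.mul_re, Complex.mul_im]

lemma pd_sinT (n : Fin 2 → ℤ) (i : Fin 2) (p : Torus) :
    pd i (sinT n) p = 2 * Real.pi * n i * cosT n p := by
  have h := pd_clm (smooth_mFourier 1 n) Complex.imCLM i p
  rw [pd_mFourier] at h
  refine h.trans ?_
  simp [cosT, Complex.mul_re, Complex.mul_im]

lemma cosT_sq_add_sinT_sq (n : Fin 2 → ℤ) (p : Torus) : cosT n p ^ 2 + sinT n p ^ 2 = 1 := by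
  have h : ‖mFourier n p‖ = 1 := by
    simp only [mFourier, ContinuousMap.coe_mk, Fin.prod_univ_two, fourier_apply, norm_mul,
      Circle.norm_coe, mul_one]
  have h2 := Complex.sq_norm (mFourier n p)
  rw [h, Complex.normSq_apply] at h2
  simp only [cosT, sinT]
  linarith

lemma integral_cosT {n : Fin 2 → ℤ} {i : Fin 2} (hn : n i ≠ 0) : ∫ p, cosT n p = 0 := by
  have h := integral_pd (smooth_sinT 1 n) i
  simp only [pd_sinT, integral_const_mul] at h
  refine (mul_eq_zero.1 h).resolve_left ?_
  have := Real.pi_ne_zero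
  simp [hn, this]

lemma integral_sinT {n : Fin 2 → ℤ} {i : Fin 2} (hn : n i ≠ 0) : ∫ p, sinT n p = 0 := by
  have h := integral_pd (smooth_cosT 1 n) i
  simp only [pd_cosT, integral_const_mul] at h
  refine (mul_eq_zero.1 h).resolve_left ?_
  have := Real.pi_ne_zero
  simp [hn, this]

lemma pd_const_mul {u : Torus → ℝ} (hu : SmoothOfOrder 1 u) (c : ℝ) (i : Fin 2) (p : Torus) :
    pd i (fun q => c * u q) p = c * pd i u p :=
  ((hasDerivAt_pd_zero hu i p).const_mul c).deriv

/-- The Laplacian of a constant metric on a function with `∂_i u = α_i v`, `∂_i v = -α_i u`. -/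
lemma laplacian_const {K : Matrix (Fin 2) (Fin 2) ℝ} (hK : K.PosDef) {u v : Torus → ℝ}
    {α : Fin 2 → ℝ} (hv : SmoothOfOrder 1 v) (hu' : ∀ i p, pd i u p = α i * v p)
    (hv' : ∀ i p, pd i v p = -(α i * u p)) (p : Torus) :
    laplacian (fun _ => K) u p = -(∑ i, ∑ j, K⁻¹ i j * α i * α j) * u p := by
  have hd : Real.sqrt K.det ≠ 0 := (Real.sqrt_pos.2 hK.det_pos).ne'
  have h1 : ∀ i : Fin 2, (fun q => Real.sqrt K.det * ∑ j, dualMetric (fun _ : Torus => K) q i j *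
      pd j u q) = fun q => (Real.sqrt K.det * ∑ j, K⁻¹ i j * α j) * v q := by
    intro i
    funext q
    simp only [dualMetric, hu', Fin.sum_univ_two]
    ring
  simp only [laplacian, h1]
  simp only [pd_const_mul hv, hv', Fin.sum_univ_two]
  field_simp
  ring

lemma laplacian_cosT {K : Matrix (Fin 2) (Fin 2) ℝ} (hK : K.PosDef) (n : Fin 2 → ℤ) (p : Torus) :
    laplacian (fun _ => K) (cosT n) p =
      -(4 * Real.pi ^ 2 * ∑ i, ∑ j, K⁻¹ i j * n i * n j) * cosT n p := by
  rw [laplacian_const hK (α := fun i => -(2 * Real.pi * n i)) (smooth_sinT 1 n) (pd_cosT n)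
    (fun i p => by rw [pd_sinT]; ring)]
  simp only [Fin.sum_univ_two]
  ring

lemma laplacian_sinT {K : Matrix (Fin 2) (Fin 2) ℝ} (hK : K.PosDef) (n : Fin 2 → ℤ) (p : Torus) :
    laplacian (fun _ => K) (sinT n) p =
      -(4 * Real.pi ^ 2 * ∑ i, ∑ j, K⁻¹ i j * n i * n j) * sinT n p := by
  rw [laplacian_const hK (α := fun i => 2 * Real.pi * n i) (smooth_cosT 1 n) (pd_sinT n)
    (fun i p => by rw [pd_cosT]; ring)]
  simp only [Fin.sum_univ_two]
  ring

/-- The map `(r₁ e(x), r₂ e(y), r₃ e(x + y))` to `ℂ³ = ℝ⁶`, where `e(t) = exp (2πit)`. -/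
def trigMap (r₁ r₂ r₃ : ℝ) (p : Torus) : EuclideanSpace ℝ (Fin 6) :=
  !₂[r₁ * cosT ![1, 0] p, r₁ * sinT ![1, 0] p, r₂ * cosT ![0, 1] p, r₂ * sinT ![0, 1] p,
    r₃ * cosT ![1, 1] p, r₃ * sinT ![1, 1] p]

variable (r₁ r₂ r₃ : ℝ)

lemma smooth_trigMap (m : ℕ∞) : SmoothOfOrder m (trigMap r₁ r₂ r₃) := by
  refine contDiff_euclidean.2 fun k => ?_
  have hc := fun n => smooth_cosT m n
  have hs := fun n => smooth_sinT m n
  fin_cases k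
  · exact (SmoothOfOrder.const r₁).mul (hc ![1, 0])
  · exact (SmoothOfOrder.const r₁).mul (hs ![1, 0])
  · exact (SmoothOfOrder.const r₂).mul (hc ![0, 1])
  · exact (SmoothOfOrder.const r₂).mul (hs ![0, 1])
  · exact (SmoothOfOrder.const r₃).mul (hc ![1, 1])
  · exact (SmoothOfOrder.const r₃).mul (hs ![1, 1])

lemma pd_euclidean {N : ℕ} {φ : Torus → EuclideanSpace ℝ (Fin N)} (hφ : SmoothOfOrder 1 φ)
    (i : Fin 2) (p : Torus) (k : Fin N) : pd i φ p k = pd i (fun q => φ q k) p :=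
  (pd_clm hφ (EuclideanSpace.proj k) i p).symm

lemma inducedMetric_trigMap (p : Torus) : inducedMetric (trigMap r₁ r₂ r₃) p =
    (4 * Real.pi ^ 2) • !![r₁ ^ 2 + r₃ ^ 2, r₃ ^ 2; r₃ ^ 2, r₂ ^ 2 + r₃ ^ 2] := by
  have key : ∀ i j : Fin 2, inner ℝ (pd i (trigMap r₁ r₂ r₃) p) (pd j (trigMap r₁ r₂ r₃) p) =
      4 * Real.pi ^ 2 * (r₁ ^ 2 * ((![1, 0] : Fin 2 → ℤ) i * (![1, 0] : Fin 2 → ℤ) j) +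
        r₂ ^ 2 * ((![0, 1] : Fin 2 → ℤ) i * (![0, 1] : Fin 2 → ℤ) j) +
        r₃ ^ 2 * ((![1, 1] : Fin 2 → ℤ) i * (![1, 1] : Fin 2 → ℤ) j)) := by
    intro i j
    have h1 := cosT_sq_add_sinT_sq ![1, 0] p
    have h2 := cosT_sq_add_sinT_sq ![0, 1] p
    have h3 := cosT_sq_add_sinT_sq ![1, 1] p
    rw [PiLp.inner_apply]
    simp only [pd_euclidean (smooth_trigMap r₁ r₂ r₃ 1), Fin.sum_univ_six, Real.inner_apply]
    have e : ∀ l : Fin 2, pd l (fun q => trigMap r₁ r₂ r₃ q 0) p =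
          r₁ * (-(2 * Real.pi * (![1, 0] : Fin 2 → ℤ) l) * sinT ![1, 0] p) ∧
        pd l (fun q => trigMap r₁ r₂ r₃ q 1) p =
          r₁ * (2 * Real.pi * (![1, 0] : Fin 2 → ℤ) l * cosT ![1, 0] p) ∧
        pd l (fun q => trigMap r₁ r₂ r₃ q 2) p =
          r₂ * (-(2 * Real.pi * (![0, 1] : Fin 2 → ℤ) l) * sinT ![0, 1] p) ∧
        pd l (fun q => trigMap r₁ r₂ r₃ q 3) p =
          r₂ * (2 * Real.pi * (![0, 1] : Fin 2 → ℤ) l * cosT ![0, 1] p) ∧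
        pd l (fun q => trigMap r₁ r₂ r₃ q 4) p =
          r₃ * (-(2 * Real.pi * (![1, 1] : Fin 2 → ℤ) l) * sinT ![1, 1] p) ∧
        pd l (fun q => trigMap r₁ r₂ r₃ q 5) p =
          r₃ * (2 * Real.pi * (![1, 1] : Fin 2 → ℤ) l * cosT ![1, 1] p) := by
      intro l
      simp only [← pd_cosT, ← pd_sinT]
      refine ⟨?_, ?_, ?_, ?_, ?_, ?_⟩
      · exact pd_const_mul (smooth_cosT 1 _) r₁ l p
      · exact pd_const_mul (smooth_sinT 1 _) r₁ l p
      · exact pd_const_mul (smooth_cosT 1 _) r₂ l p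
      · exact pd_const_mul (smooth_sinT 1 _) r₂ l p
      · exact pd_const_mul (smooth_cosT 1 _) r₃ l p
      · exact pd_const_mul (smooth_sinT 1 _) r₃ l p
    simp only [(e _).1, (e _).2.1, (e _).2.2.1, (e _).2.2.2.1, (e _).2.2.2.2.1, (e _).2.2.2.2.2]
    linear_combination
      (4 * Real.pi ^ 2 * r₁ ^ 2 * ((![1, 0] : Fin 2 → ℤ) i * (![1, 0] : Fin 2 → ℤ) j)) * h1 +
      (4 * Real.pi ^ 2 * r₂ ^ 2 * ((![0, 1] : Fin 2 → ℤ) i * (![0, 1] : Fin 2 → ℤ) j)) * h2 +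
      (4 * Real.pi ^ 2 * r₃ ^ 2 * ((![1, 1] : Fin 2 → ℤ) i * (![1, 1] : Fin 2 → ℤ) j)) * h3
  ext i j
  rw [inducedMetric, Matrix.of_apply, key]
  fin_cases i <;> fin_cases j <;> simp

lemma norm_sq_trigMap (p : Torus) : ‖trigMap r₁ r₂ r₃ p‖ ^ 2 = r₁ ^ 2 + r₂ ^ 2 + r₃ ^ 2 := by
  have h1 := cosT_sq_add_sinT_sq ![1, 0] p
  have h2 := cosT_sq_add_sinT_sq ![0, 1] p
  have h3 := cosT_sq_add_sinT_sq ![1, 1] p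
  rw [EuclideanSpace.norm_sq_eq]
  simp [Fin.sum_univ_six, trigMap]
  linear_combination r₁ ^ 2 * h1 + r₂ ^ 2 * h2 + r₃ ^ 2 * h3

lemma integral_trigMap : ∫ p, trigMap r₁ r₂ r₃ p = 0 := by
  have hint := integrable_of_continuous (smooth_trigMap r₁ r₂ r₃ 1).continuous
    (volume : Measure Torus)
  ext k
  have h := (EuclideanSpace.proj (𝕜 := ℝ) k).integral_comp_comm hint
  refine h.symm.trans ?_
  fin_cases k
  · exact (integral_const_mul r₁ _).trans (by rw [integral_cosT (i := 0) (by simp), mul_zero]; rfl)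
  · exact (integral_const_mul r₁ _).trans (by rw [integral_sinT (i := 0) (by simp), mul_zero]; rfl)
  · exact (integral_const_mul r₂ _).trans (by rw [integral_cosT (i := 1) (by simp), mul_zero]; rfl)
  · exact (integral_const_mul r₂ _).trans (by rw [integral_sinT (i := 1) (by simp), mul_zero]; rfl)
  · exact (integral_const_mul r₃ _).trans (by rw [integral_cosT (i := 0) (by simp), mul_zero]; rfl)
  · exact (integral_const_mul r₃ _).trans (by rw [integral_sinT (i := 0) (by simp), mul_zero]; rfl)

lemma injective_trigMap {r₁ r₂ : ℝ} (h₁ : r₁ ≠ 0) (h₂ : r₂ ≠ 0) :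
    Function.Injective (trigMap r₁ r₂ r₃) := by
  intro p q hpq
  have hk : ∀ k, trigMap r₁ r₂ r₃ p k = trigMap r₁ r₂ r₃ q k := fun k => by rw [hpq]
  have e0 : mFourier ![1, 0] p = mFourier ![1, 0] q :=
    Complex.ext (mul_left_cancel₀ h₁ (hk 0)) (mul_left_cancel₀ h₁ (hk 1))
  have e1 : mFourier ![0, 1] p = mFourier ![0, 1] q :=
    Complex.ext (mul_left_cancel₀ h₂ (hk 2)) (mul_left_cancel₀ h₂ (hk 3))
  simp only [mFourier, ContinuousMap.coe_mk, Fin.prod_univ_two, Matrix.cons_val_zero,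
    Matrix.cons_val_one, fourier_zero, fourier_one, mul_one, one_mul] at e0 e1
  funext i
  fin_cases i
  · exact AddCircle.injective_toCircle one_ne_zero (Circle.coe_injective e0)
  · exact AddCircle.injective_toCircle one_ne_zero (Circle.coe_injective e1)

/-! ### Euclidean spaces in `ℓ²` -/

lemma inner_toℓ2 {N : ℕ} (v w : EuclideanSpace ℝ (Fin N)) :
    inner ℝ (toℓ2 v) (toℓ2 w) = inner ℝ v w := by
  simp only [toℓ2, sum_inner, lp.inner_single_left, PiLp.inner_apply]
  refine Finset.sum_congr rfl fun i _ => ?_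
  congr 1
  rw [lp.coeFn_sum, Finset.sum_apply, Finset.sum_eq_single i]
  · simp
  · intro j _ hj
    exact lp.single_apply_ne _ _ _ fun h => hj (Fin.ext h.symm)
  · simp

/-- The inclusion `ℝ^N ⊂ ℓ²` as a continuous linear map. -/
def toℓ2CLM (N : ℕ) : EuclideanSpace ℝ (Fin N) →L[ℝ] ℓ2 :=
  ∑ i : Fin N, (lp.singleContinuousLinearMap ℝ (fun _ : ℕ => ℝ) 2 (i : ℕ)).comp
    (EuclideanSpace.proj i)

lemma toℓ2CLM_apply {N : ℕ} (v : EuclideanSpace ℝ (Fin N)) : toℓ2CLM N v = toℓ2 v := by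
  simp [toℓ2CLM, toℓ2]

lemma smooth_toℓ2 {N : ℕ} {m : ℕ∞} {φ : Torus → EuclideanSpace ℝ (Fin N)}
    (hφ : SmoothOfOrder m φ) : SmoothOfOrder m (fun p => toℓ2 (φ p)) := by
  simp only [← toℓ2CLM_apply]
  exact (toℓ2CLM N).contDiff.comp hφ

lemma inducedMetric_toℓ2 {N : ℕ} {φ : Torus → EuclideanSpace ℝ (Fin N)}
    (hφ : SmoothOfOrder 1 φ) : inducedMetric (fun p => toℓ2 (φ p)) = inducedMetric φ := by
  funext p
  ext i j
  simp only [inducedMetric, Matrix.of_apply, ← toℓ2CLM_apply, pd_clm hφ]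
  simp only [toℓ2CLM_apply, inner_toℓ2]

lemma norm_toℓ2 {N : ℕ} (v : EuclideanSpace ℝ (Fin N)) : ‖toℓ2 v‖ ^ 2 = ‖v‖ ^ 2 := by
  rw [← real_inner_self_eq_norm_sq, inner_toℓ2, real_inner_self_eq_norm_sq]

end Embedding

/-! ### Inflated embeddings and solutions of the eigenvalue problem -/

section Solutions

lemma cosT_zero (n : Fin 2 → ℤ) : cosT n 0 = 1 := by
  have h := mFourier_proj n 0
  rw [proj_zero] at h
  simp [cosT, h]

/-- The lower bound for `λ₁` given by Wirtinger's inequality. -/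
lemma le_lambda1 {s : ℝ} (hs0 : 0 ≤ s) (hs1 : s ≤ 1 / 2) (Φ : TorusDiffeo) {c : ℝ}
    (hc : 0 < c) {K : Matrix (Fin 2) (Fin 2) ℝ} (hK : K.PosDef) :
    4 * Real.pi ^ 2 / (1 - s ^ 2) ≤ lambda1 (volumeElement (c • pullback Φ (fun _ => K)))
      (dualMetric (pullback Φ (hMetric s (Real.sqrt (1 - s ^ 2))))) := by
  have hR := ((isRiemannianMetric_const hK).pullback Φ).smul hc
  have := hR.isFiniteMeasure
  have := hR.isOpenPosMeasure
  -- the set of Rayleigh quotients is nonempty, so that its infimum is not a default value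
  refine le_csInf ?_ ?_
  · refine ⟨_, fun p => cosT ![1, 0] (Φ.toEquiv p), (smooth_cosT 1 _).comp_diffeo Φ, ?_, ?_, rfl⟩
    · intro h0
      have := congrFun h0 (Φ.toEquiv.symm 0)
      simp [cosT_zero] at this
    · rw [integral_volumeElement_pullback hc hK, integral_cosT (i := 0) (by simp), smul_zero]
  · rintro r ⟨u, hu, hne, h0, rfl⟩
    rw [le_div_iff₀ (integral_sq_pos hu.continuous hne)]
    exact wirtinger_pullback hs0 hs1 Φ hc hK hu h0

lemma integral_pairing {s : ℝ} (hs : s ^ 2 < 1) (Φ : TorusDiffeo) {c a b : ℝ}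
    (hc : 0 < c) (hb : b ≠ 0) :
    ∫ p, pairing (dualMetric (pullback Φ (hMetric s (Real.sqrt (1 - s ^ 2)))))
      (c • pullback Φ (hMetric a b)) p ∂(normalized (volumeElement (c • pullback Φ (hMetric a b)))) =
      c * ((1 - 2 * s * a + (a ^ 2 + b ^ 2)) / (1 - s ^ 2)) := by
  have h := integral_normalized_pullback (Φ := Φ) hc (posDef_hMetric a hb 0) (fun p : Torus =>
    c * pairing (dualMetric (hMetric s (Real.sqrt (1 - s ^ 2)))) (hMetric a b) p)
  simp only [pairing_smul_pullback]
  refine h.trans ?_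
  have e : ∀ p : Torus, pairing (dualMetric (hMetric s (Real.sqrt (1 - s ^ 2)))) (hMetric a b) p =
      (1 - 2 * s * a + (a ^ 2 + b ^ 2)) / (1 - s ^ 2) := by
    intro p
    rw [pairing, dualMetric_hMetric_sqrt hs]
    simp [hMetric, Fin.sum_univ_two]
    ring
  simp [e]

/-- The radius `r` of a circle for which `t ↦ r exp (2πit)` has squared speed `c v`. -/
def radius (c v : ℝ) : ℝ := Real.sqrt (c * v) / (2 * Real.pi)

lemma radius_sq {c t : ℝ} (hc : 0 < c) (ht : 0 ≤ t) : radius c t ^ 2 = c * t / (4 * Real.pi ^ 2) := by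
  rw [radius, div_pow, Real.sq_sqrt (by positivity)]
  ring

lemma radius_ne_zero {c t : ℝ} (hc : 0 < c) (ht : 0 < t) : radius c t ≠ 0 := by
  unfold radius
  have := Real.pi_pos
  positivity

/-- The map `(r₁ e(x), r₂ e(y), r₃ e(x + y))` that induces the metric `c h_{a,b}`. The metric
`r₁² dx² + r₂² dy² + r₃² (dx + dy)²` has to be `c (dx² + 2a dx dy + (a² + b²) dy²) / 4π²`, which
determines the radii. -/
def inflatedMap (c a b : ℝ) : Torus → EuclideanSpace ℝ (Fin 6) :=
  trigMap (radius c (1 - a)) (radius c (a ^ 2 + b ^ 2 - a)) (radius c a)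

variable {c a b : ℝ}

/-- The shape `a + ib` of a reduced lattice lies in the upper half-plane, outside the open unit
disk. -/
lemma IsNormalForm.one_le {h : TensorField} {Φ : TorusDiffeo} (hN : IsNormalForm h Φ c a b) :
    0 < b ∧ 1 ≤ a ^ 2 + b ^ 2 := by
  obtain ⟨-, ha0, ha1, hb, -⟩ := hN
  have h1 : a ^ 2 < 1 := sq_lt_one_of_le_half ha0 ha1
  have h2 : 0 < Real.sqrt (1 - a ^ 2) := Real.sqrt_pos.2 (by linarith)
  have h3 := Real.sq_sqrt (show 0 ≤ 1 - a ^ 2 by linarith)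
  exact ⟨h2.trans_le hb, by nlinarith⟩

lemma inducedMetric_inflatedMap (hc : 0 < c) (ha0 : 0 ≤ a) (ha1 : a ≤ 1 / 2)
    (hab : 1 ≤ a ^ 2 + b ^ 2) : inducedMetric (inflatedMap c a b) = c • hMetric a b := by
  have hpi := Real.pi_ne_zero
  funext p
  rw [inflatedMap, inducedMetric_trigMap, radius_sq hc (t := 1 - a) (by linarith),
    radius_sq hc (t := a ^ 2 + b ^ 2 - a) (by linarith), radius_sq hc ha0]
  ext i j
  fin_cases i <;> fin_cases j <;> simp [hMetric] <;> field_simp <;> ring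

lemma norm_sq_inflatedMap (hc : 0 < c) (ha0 : 0 ≤ a) (ha1 : a ≤ 1 / 2)
    (hab : 1 ≤ a ^ 2 + b ^ 2) (p : Torus) :
    ‖inflatedMap c a b p‖ ^ 2 = c * (1 - a + (a ^ 2 + b ^ 2)) / (4 * Real.pi ^ 2) := by
  rw [inflatedMap, norm_sq_trigMap, radius_sq hc (t := 1 - a) (by linarith),
    radius_sq hc (t := a ^ 2 + b ^ 2 - a) (by linarith), radius_sq hc ha0]
  ring

lemma inducedMetric_inflatedMap_comp {h : TensorField} {Φ : TorusDiffeo}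
    (hN : IsNormalForm h Φ c a b) :
    inducedMetric (fun p => inflatedMap c a b (Φ.toEquiv p)) = h := by
  have hab := hN.one_le.2
  obtain ⟨hc, ha0, ha1, hb, rfl⟩ := hN
  rw [inducedMetric_comp_diffeo (φ := inflatedMap c a b) (smooth_trigMap _ _ _ 1) Φ,
    inducedMetric_inflatedMap hc ha0 ha1 hab]
  funext p
  simp [pullback]

lemma isIsometricEmbedding_inflatedMap {h : TensorField} {Φ : TorusDiffeo}
    (hN : IsNormalForm h Φ c a b) :
    IsIsometricEmbedding h (fun p => inflatedMap c a b (Φ.toEquiv p)) := by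
  have hm := inducedMetric_inflatedMap_comp hN
  have hab := hN.one_le.2
  obtain ⟨hc, ha0, ha1, hb, -⟩ := hN
  have hs : SmoothOfOrder ⊤ (fun p => inflatedMap c a b (Φ.toEquiv p)) :=
    (smooth_trigMap _ _ _ ⊤).comp_diffeo Φ
  refine ⟨hs, (hs.continuous.isClosedEmbedding ?_).isEmbedding, hm⟩
  exact (injective_trigMap _ (radius_ne_zero hc (by linarith))
    (radius_ne_zero hc (by linarith))).comp Φ.toEquiv.injective

lemma isFeasible_inflatedMap {h : TensorField} {Φ : TorusDiffeo}
    (hN : IsNormalForm h Φ c a b) :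
    IsFeasible (volumeElement h) h (fun p => toℓ2 (inflatedMap c a b (Φ.toEquiv p))) := by
  have hm := inducedMetric_inflatedMap_comp hN
  have hb := hN.one_le.1
  have hs : SmoothOfOrder ⊤ (fun p => inflatedMap c a b (Φ.toEquiv p)) :=
    (smooth_trigMap _ _ _ ⊤).comp_diffeo Φ
  refine ⟨smooth_toℓ2 hs, fun p => ?_, ?_⟩
  · rw [inducedMetric_toℓ2 hs.of_top, hm, sub_self]
    exact Matrix.PosSemidef.zero
  · obtain ⟨hc, ha0, ha1, -, rfl⟩ := hN
    have h1 := integral_normalized_pullback (Φ := Φ) hc (posDef_hMetric a hb.ne' 0)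
      (fun p => toℓ2 (inflatedMap c a b p))
    refine h1.trans ?_
    have h2 := (toℓ2CLM 6).integral_comp_comm (integrable_of_continuous
      (smooth_trigMap (radius c (1 - a)) (radius c (a ^ 2 + b ^ 2 - a)) (radius c a) 1).continuous
      (volume : Measure Torus))
    rw [integral_trigMap, map_zero] at h2
    simp only [toℓ2CLM_apply] at h2
    exact h2

lemma variance_inflatedMap {h : TensorField} {Φ : TorusDiffeo} (hN : IsNormalForm h Φ c a b) :
    variance (volumeElement h) (fun p => toℓ2 (inflatedMap c a b (Φ.toEquiv p))) =
      c * (1 - a + (a ^ 2 + b ^ 2)) / (4 * Real.pi ^ 2) := by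
  obtain ⟨hb, hab⟩ := hN.one_le
  obtain ⟨hc, ha0, ha1, -, rfl⟩ := hN
  have h1 := integral_normalized_pullback (Φ := Φ) hc (posDef_hMetric a hb.ne' 0)
    (fun p => ‖inflatedMap c a b p‖ ^ 2)
  simp only [variance, norm_toℓ2]
  refine h1.trans ?_
  simp [norm_sq_inflatedMap hc ha0 ha1 hab]

/-- Equality in weak duality.  The condition `2 s a = a` says that `s = 1/2`, or that `a = 0`. -/
lemma integral_pairing_le {h : TensorField} {Φ : TorusDiffeo} (hN : IsNormalForm h Φ c a b)
    {s : ℝ} (hs0 : 0 ≤ s) (hs1 : s ≤ 1 / 2) (hsa : 2 * s * a = a) :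
    (∫ p, pairing (dualMetric (pullback Φ (hMetric s (Real.sqrt (1 - s ^ 2))))) h p
        ∂(normalized (volumeElement h)) ≤
      lambda1 (volumeElement h) (dualMetric (pullback Φ (hMetric s (Real.sqrt (1 - s ^ 2))))) *
        variance (volumeElement h) (fun p => toℓ2 (inflatedMap c a b (Φ.toEquiv p)))) ∧
    0 < lambda1 (volumeElement h) (dualMetric (pullback Φ (hMetric s (Real.sqrt (1 - s ^ 2))))) ∧
    0 < variance (volumeElement h) (fun p => toℓ2 (inflatedMap c a b (Φ.toEquiv p))) ∧
    0 < ∫ p, pairing (dualMetric (pullback Φ (hMetric s (Real.sqrt (1 - s ^ 2))))) h p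
        ∂(normalized (volumeElement h)) := by
  rw [variance_inflatedMap hN]
  obtain ⟨hb, hab⟩ := hN.one_le
  obtain ⟨hc, ha0, ha1, -, rfl⟩ := hN
  have hs := sq_lt_one_of_le_half hs0 hs1
  have hs' : 0 < 1 - s ^ 2 := by linarith
  have hpi := Real.pi_pos
  have hl := le_lambda1 hs0 hs1 Φ hc (posDef_hMetric a hb.ne' 0)
  change 4 * Real.pi ^ 2 / (1 - s ^ 2) ≤ lambda1 (volumeElement (c • pullback Φ (hMetric a b))) _
    at hl
  rw [integral_pairing hs Φ hc hb.ne', hsa]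
  have hA : 0 < 1 - a + (a ^ 2 + b ^ 2) := by linarith
  refine ⟨?_, lt_of_lt_of_le (by positivity) hl, by positivity, by positivity⟩
  refine le_trans (le_of_eq ?_) (mul_le_mul_of_nonneg_right hl (by positivity))
  field_simp

lemma isRiemannianMetric_pullback_hMetric (Φ : TorusDiffeo) (hb : b ≠ 0) :
    IsRiemannianMetric (pullback Φ (hMetric a b)) :=
  (isRiemannianMetric_const (posDef_hMetric a hb 0)).pullback Φ

lemma IsNormalForm.isRiemannianMetric {h : TensorField} {Φ : TorusDiffeo}
    (hN : IsNormalForm h Φ c a b) : IsRiemannianMetric h := by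
  rw [hN.2.2.2.2]
  exact (isRiemannianMetric_pullback_hMetric Φ hN.one_le.1.ne').smul hN.1

lemma solvesSpecProblem_pullback {h : TensorField} {Φ : TorusDiffeo}
    (hN : IsNormalForm h Φ c a b) {s : ℝ} (hs0 : 0 ≤ s) (hs1 : s ≤ 1 / 2) (hsa : 2 * s * a = a) :
    SolvesSpecProblem (volumeElement h) h
      (dualMetric (pullback Φ (hMetric s (Real.sqrt (1 - s ^ 2))))) := by
  have hh := hN.isRiemannianMetric
  have := hh.isFiniteMeasure
  have := hh.isOpenPosMeasure
  obtain ⟨h1, -, h3, h4⟩ := integral_pairing_le hN hs0 hs1 hsa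
  exact solvesSpecProblem_of_eq hh (isRiemannianMetric_pullback_hMetric Φ
    (sqrt_ne_zero_of (sq_lt_one_of_le_half hs0 hs1))).isCometric_dualMetric
    (isFeasible_inflatedMap hN) h3 h4 h1

lemma isInflated_inflatedMap {h : TensorField} {Φ : TorusDiffeo} (hN : IsNormalForm h Φ c a b) :
    IsInflated (volumeElement h) h (fun p => toℓ2 (inflatedMap c a b (Φ.toEquiv p))) := by
  have hh := hN.isRiemannianMetric
  have := hh.isFiniteMeasure
  have := hh.isOpenPosMeasure
  obtain ⟨h1, h2, -, -⟩ := integral_pairing_le hN (s := 1 / 2) (by norm_num) le_rfl (by ring)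
  exact isInflated_of_eq hh.1 (isRiemannianMetric_pullback_hMetric Φ
    (sqrt_ne_zero_of (by norm_num))).isCometric_dualMetric (isFeasible_inflatedMap hN) h2 h1

/-- Eigenfunctions of `h_EL` for the eigenvalue `4π²/(1 - 1/4)`, pulled back by `Φ`, are first
eigenfunctions of `Φ^* h_EL`. -/
lemma isFirstEigenfunction_hEL (Φ : TorusDiffeo) {u : Torus → ℝ} (hu : SmoothOfOrder ⊤ u)
    (hlap : ∀ p, -laplacian hEL u p = 4 * Real.pi ^ 2 / (1 - (1 / 2) ^ 2) * u p) :
    IsFirstEigenfunction (pullback Φ hEL) (fun p => u (Φ.toEquiv p)) := by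
  have hs : ((1 : ℝ) / 2) ^ 2 < 1 := by norm_num
  have hK := posDef_hMetric (1 / 2) (sqrt_ne_zero_of hs) 0
  rw [hEL_eq] at hlap ⊢
  have heq : ∀ {w : Torus → ℝ}, SmoothOfOrder ⊤ w → (∀ p, -laplacian (hMetric (1 / 2)
      (Real.sqrt (1 - (1 / 2) ^ 2))) w p = 4 * Real.pi ^ 2 / (1 - (1 / 2) ^ 2) * w p) →
      ∀ p, -laplacian (pullback Φ (hMetric (1 / 2) (Real.sqrt (1 - (1 / 2) ^ 2))))
        (fun p => w (Φ.toEquiv p)) p = 4 * Real.pi ^ 2 / (1 - (1 / 2) ^ 2) * w (Φ.toEquiv p) := by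
    intro w hw hl p
    rw [← hl]
    exact congrArg Neg.neg (laplacian_comp_diffeo hK Φ hw p)
  refine ⟨hu.comp_diffeo Φ, _, ⟨⟨by have := Real.pi_pos; norm_num; positivity, ?_⟩, ?_⟩, heq hu hlap⟩
  · refine ⟨fun p => cosT ![1, 0] (Φ.toEquiv p), (smooth_cosT ⊤ _).comp_diffeo Φ, ?_,
      heq (smooth_cosT ⊤ _) fun p => ?_⟩
    · intro h0
      have := congrFun h0 (Φ.toEquiv.symm 0)
      simp [cosT_zero] at this
    · refine (congrArg Neg.neg (laplacian_cosT hK ![1, 0] p)).trans ?_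
      have hd := dualMetric_hMetric_sqrt hs 0
      rw [dualMetric] at hd
      rw [hd]
      simp [Fin.sum_univ_two]
      exact Or.inl (by ring)
  · rintro l ⟨hl, hE⟩
    exact le_of_isEigenvalue (by norm_num) le_rfl Φ hl hE

/-- The components of the map are first eigenfunctions, as `(1, 0)`, `(0, 1)` and `(1, 1)` are
solutions of `m² - mn + n² = 1`. -/
lemma isFirstEigenfunction_inflatedMap (Φ : TorusDiffeo) (k : Fin 6) :
    IsFirstEigenfunction (pullback Φ hEL) (fun p => inflatedMap c a b (Φ.toEquiv p) k) := by
  have hs : ((1 : ℝ) / 2) ^ 2 < 1 := by norm_num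
  have hK := posDef_hMetric (1 / 2) (sqrt_ne_zero_of hs) 0
  have hd := dualMetric_hMetric_sqrt hs 0
  rw [dualMetric] at hd
  have hlap : ∀ {w : Torus → ℝ} (r : ℝ), SmoothOfOrder ⊤ w → (∀ p, -laplacian (fun _ => hMetric (1 / 2)
      (Real.sqrt (1 - (1 / 2) ^ 2)) 0) w p = 4 * Real.pi ^ 2 / (1 - (1 / 2) ^ 2) * w p) →
      IsFirstEigenfunction (pullback Φ hEL) (fun p => r * w (Φ.toEquiv p)) := by
    intro w r hw hl
    refine isFirstEigenfunction_hEL Φ (u := fun q => r * w q) ((SmoothOfOrder.const r).mul hw)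
      fun p => ?_
    have hlin : laplacian (fun _ => hMetric (1 / 2) (Real.sqrt (1 - (1 / 2) ^ 2)) 0)
        (fun q => r * w q) p = r * laplacian (fun _ => hMetric (1 / 2)
          (Real.sqrt (1 - (1 / 2) ^ 2)) 0) w p := by
      have hR := isRiemannianMetric_const hK
      simp only [laplacian, pd_const_mul hw.of_top]
      have e : ∀ i : Fin 2, (fun q : Torus => Real.sqrt (hMetric (1 / 2)
          (Real.sqrt (1 - (1 / 2) ^ 2)) 0).det * ∑ j, dualMetric (fun _ => hMetric (1 / 2)
          (Real.sqrt (1 - (1 / 2) ^ 2)) 0) q i j * (r * pd j w q)) = fun q => r * (Real.sqrt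
          (hMetric (1 / 2) (Real.sqrt (1 - (1 / 2) ^ 2)) 0).det * ∑ j, dualMetric (fun _ =>
          hMetric (1 / 2) (Real.sqrt (1 - (1 / 2) ^ 2)) 0) q i j * pd j w q) := by
        intro i
        funext q
        simp only [Fin.sum_univ_two]
        ring
      simp only [e]
      rw [Finset.mul_sum, Finset.mul_sum, Finset.mul_sum]
      refine Finset.sum_congr rfl fun i _ => ?_
      rw [pd_const_mul (SmoothOfOrder.of_top (hR.smooth_sqrt_det.mul (SmoothOfOrder.sum fun j _ =>
        (hR.smooth_dualMetric i j).mul (hw.pd j))))]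
      ring
    rw [hEL_eq]
    refine (congrArg Neg.neg hlin).trans ?_
    rw [← mul_neg, hl]
    ring
  have hcos : ∀ n : Fin 2 → ℤ, (n 0 : ℝ) ^ 2 - n 0 * n 1 + (n 1 : ℝ) ^ 2 = 1 → ∀ p, -laplacian
      (fun _ => hMetric (1 / 2) (Real.sqrt (1 - (1 / 2) ^ 2)) 0) (cosT n) p =
        4 * Real.pi ^ 2 / (1 - (1 / 2) ^ 2) * cosT n p := by
    intro n hn p
    rw [laplacian_cosT hK, hd]
    simp [Fin.sum_univ_two]
    exact Or.inl (by linear_combination (4 * Real.pi ^ 2 / (1 - (2 ^ 2)⁻¹)) * hn)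
  have hsin : ∀ n : Fin 2 → ℤ, (n 0 : ℝ) ^ 2 - n 0 * n 1 + (n 1 : ℝ) ^ 2 = 1 → ∀ p, -laplacian
      (fun _ => hMetric (1 / 2) (Real.sqrt (1 - (1 / 2) ^ 2)) 0) (sinT n) p =
        4 * Real.pi ^ 2 / (1 - (1 / 2) ^ 2) * sinT n p := by
    intro n hn p
    rw [laplacian_sinT hK, hd]
    simp [Fin.sum_univ_two]
    exact Or.inl (by linear_combination (4 * Real.pi ^ 2 / (1 - (2 ^ 2)⁻¹)) * hn)
  fin_cases k
  · exact hlap _ (smooth_cosT ⊤ _) (hcos ![1, 0] (by simp))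
  · exact hlap _ (smooth_sinT ⊤ _) (hsin ![1, 0] (by simp))
  · exact hlap _ (smooth_cosT ⊤ _) (hcos ![0, 1] (by simp))
  · exact hlap _ (smooth_sinT ⊤ _) (hsin ![0, 1] (by simp))
  · exact hlap _ (smooth_cosT ⊤ _) (hcos ![1, 1] (by simp))
  · exact hlap _ (smooth_sinT ⊤ _) (hsin ![1, 1] (by simp))

/-- The cometrics `h_SQ^*` and `h_EL^*` are not proportional: the first is diagonal, the second is
not. -/
lemma not_proportional (Φ : TorusDiffeo) (k : ℝ) :
    dualMetric (pullback Φ hSQ) ≠ k • dualMetric (pullback Φ hEL) := by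
  intro h
  have h0 := congrFun h (proj 0)
  have hJu : IsUnit (jacobian Φ.lift 0).det := isUnit_iff_ne_zero.2 (Φ.det_jacobian_ne_zero 0)
  rw [Pi.smul_apply, inv_pullback, inv_pullback] at h0
  set J := jacobian Φ.lift 0
  have hcancel : ∀ A : Matrix (Fin 2) (Fin 2) ℝ, J * (J⁻¹ * A * J⁻¹.transpose) * J.transpose = A := by
    intro A
    rw [Matrix.mul_assoc J⁻¹, Matrix.mul_nonsing_inv_cancel_left _ _ hJu, Matrix.mul_assoc,
      ← Matrix.transpose_mul, Matrix.mul_nonsing_inv _ hJu, Matrix.transpose_one, Matrix.mul_one]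
  have h1 := congrArg (fun A => J * A * J.transpose) h0
  simp only [Matrix.mul_smul, Matrix.smul_mul, hcancel] at h1
  rw [hSQ_eq, hEL_eq, dualMetric_hMetric_sqrt (by norm_num), dualMetric_hMetric_sqrt (by norm_num)]
    at h1
  have h00 := congrFun (congrFun h1 0) 0
  have h01 := congrFun (congrFun h1 0) 1
  simp at h00 h01
  norm_num at h00 h01
  rw [h01] at h00
  norm_num at h00

end Solutions

/-! ### Rigidity of local isometries to the Euclidean plane -/

section Developing

/-- `f` is a local isometry on `U` from the metric `Q` to the Euclidean plane. The metric is given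
by its values `Q y u v` on the tangent vectors `u, v` at `y`. -/
def IsDev (Q : Plane → Plane → Plane → ℝ) (f : Plane → Plane) (U : Set Plane) : Prop :=
  ContDiffOn ℝ ∞ f U ∧ ∀ y ∈ U, ∀ u v, fderiv ℝ f y u ⬝ᵥ fderiv ℝ f y v = Q y u v

variable {Q : Plane → Plane → Plane → ℝ} {f g : Plane → Plane} {U V : Set Plane}

lemma IsDev.mono (hf : IsDev Q f U) (h : V ⊆ U) : IsDev Q f V :=
  ⟨hf.1.mono h, fun y hy => hf.2 y (h hy)⟩

/-- The differential of a local isometry is bijective, as the metric is nondegenerate. -/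
lemma IsDev.bijective (hQ : ∀ y u, u ≠ 0 → Q y u u ≠ 0) (hf : IsDev Q f U) {x : Plane}
    (hx : x ∈ U) : Function.Bijective (fderiv ℝ f x) := by
  have hinj : Function.Injective (fderiv ℝ f x) := by
    rw [injective_iff_map_eq_zero]
    intro u hu
    by_contra hne
    refine hQ x u hne ?_
    rw [← hf.2 x hx, hu, zero_dotProduct]
  exact ⟨hinj, 
    (LinearMap.injective_iff_surjective (f := (fderiv ℝ f x : Plane →ₗ[ℝ] Plane))).1 hinj⟩

/-- The dot product as a continuous bilinear map. -/
def dotL : Plane →L[ℝ] Plane →L[ℝ] ℝ :=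
  ∑ i, (ContinuousLinearMap.mul ℝ ℝ).bilinearComp (ContinuousLinearMap.proj i)
    (ContinuousLinearMap.proj i)

lemma dotL_apply (u v : Plane) : dotL u v = u ⬝ᵥ v := by
  simp [dotL, dotProduct]

lemma IsDev.contDiffAt (hU : IsOpen U) (hf : IsDev Q f U) {x : Plane} (hx : x ∈ U) :
    ContDiffAt ℝ ∞ f x := hf.1.contDiffAt (hU.mem_nhds hx)

lemma hasFDerivAt_fderiv {x : Plane} (hf : ContDiffAt ℝ ∞ f x) :
    HasFDerivAt (fderiv ℝ f) (fderiv ℝ (fderiv ℝ f) x) x :=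
  ((hf.fderiv_right (m := ∞) (by simp)).differentiableAt (by simp)).hasFDerivAt

lemma two_le_infty : (2 : WithTop ℕ∞) ≤ ∞ :=
  WithTop.coe_le_coe.2 (le_top (a := (2 : ℕ∞)))

/-- For a local isometry `f`, the products `⟨f''(w, u), f' v⟩` are determined by the metric (they
are its Christoffel symbols): the difference
`⟨f''(w, u), f' v⟩ - ⟨g''(w, u), g' v⟩` is symmetric in `w, u` and skew in `u, v`, hence zero. -/
lemma dot_second_derivative_eq (hU : IsOpen U) (hf : IsDev Q f U) (hg : IsDev Q g U) {x : Plane}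
    (hx : x ∈ U) (w u v : Plane) :
    fderiv ℝ (fderiv ℝ f) x w u ⬝ᵥ fderiv ℝ f x v =
      fderiv ℝ (fderiv ℝ g) x w u ⬝ᵥ fderiv ℝ g x v := by
  have hfx := hf.contDiffAt hU hx
  have hgx := hg.contDiffAt hU hx
  have key : ∀ {k : Plane → Plane}, ContDiffAt ℝ ∞ k x → ∀ u v w : Plane,
      HasFDerivAt (fun y => dotL (fderiv ℝ k y u) (fderiv ℝ k y v))
        (dotL.precompR Plane (fderiv ℝ k x u) ((fderiv ℝ (fderiv ℝ k) x).flip v) +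
          dotL.precompL Plane ((fderiv ℝ (fderiv ℝ k) x).flip u) (fderiv ℝ k x v)) x := by
    intro k hk u v w
    have h1 := hasFDerivAt_fderiv hk
    have hu : HasFDerivAt (fun y => fderiv ℝ k y u) ((fderiv ℝ (fderiv ℝ k) x).flip u) x := by
      have := h1.clm_apply (hasFDerivAt_const u x)
      simpa using this
    have hv : HasFDerivAt (fun y => fderiv ℝ k y v) ((fderiv ℝ (fderiv ℝ k) x).flip v) x := by
      have := h1.clm_apply (hasFDerivAt_const v x)
      simpa using this
    exact dotL.hasFDerivAt_of_bilinear hu hv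
  have skew : ∀ w u v : Plane,
      fderiv ℝ (fderiv ℝ f) x w u ⬝ᵥ fderiv ℝ f x v + fderiv ℝ (fderiv ℝ f) x w v ⬝ᵥ fderiv ℝ f x u =
      fderiv ℝ (fderiv ℝ g) x w u ⬝ᵥ fderiv ℝ g x v +
        fderiv ℝ (fderiv ℝ g) x w v ⬝ᵥ fderiv ℝ g x u := by
    intro w u v
    have e : (fun y => dotL (fderiv ℝ f y u) (fderiv ℝ f y v)) =ᶠ[nhds x]
        fun y => dotL (fderiv ℝ g y u) (fderiv ℝ g y v) := by
      filter_upwards [hU.mem_nhds hx] with y hy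
      rw [dotL_apply, dotL_apply, hf.2 y hy, hg.2 y hy]
    have h1 := ((key hgx u v w).congr_of_eventuallyEq e).unique (key hfx u v w)
    have h2 := congrArg (fun L => L w) h1
    simp [dotL_apply] at h2
    simp only [dotProduct, Fin.sum_univ_two]
    linear_combination -h2
  have symf : ∀ w u, fderiv ℝ (fderiv ℝ f) x w u = fderiv ℝ (fderiv ℝ f) x u w := fun w u =>
    (hfx.isSymmSndFDerivAt (by simpa using two_le_infty)).eq w u
  have symg : ∀ w u, fderiv ℝ (fderiv ℝ g) x w u = fderiv ℝ (fderiv ℝ g) x u w := fun w u =>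
    (hgx.isSymmSndFDerivAt (by simpa using two_le_infty)).eq w u
  have s1 := skew w u v
  have s2 := skew u v w
  have s3 := skew v w u
  rw [symf v w, symf v u, symg v w, symg v u] at s3
  rw [symf u w, symg u w] at s2
  linarith

/-- A linear map that preserves the Euclidean inner product. -/
def IsOrth (A : Plane →L[ℝ] Plane) : Prop := ∀ u v, A u ⬝ᵥ A v = u ⬝ᵥ v

/-- Local isometries with the same source metric differ by a rigid motion. -/
theorem IsDev.exists_rigid (hQ : ∀ y u, u ≠ 0 → Q y u u ≠ 0) (hU : IsOpen U)
    (hU' : IsPreconnected U) (hne : U.Nonempty) (hf : IsDev Q f U) (hg : IsDev Q g U) :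
    ∃ (A : Plane →L[ℝ] Plane) (b : Plane), IsOrth A ∧ ∀ x ∈ U, f x = A (g x) + b := by
  -- the orthogonal map `A x = f' (x) ∘ g' (x)⁻¹` does not depend on `x`
  set A : Plane → Plane →L[ℝ] Plane := fun x =>
    (fderiv ℝ f x).comp (ContinuousLinearMap.inverse (fderiv ℝ g x)) with hA
  have hequiv : ∀ x ∈ U, ∃ e : Plane ≃L[ℝ] Plane, (e : Plane →L[ℝ] Plane) = fderiv ℝ g x := by
    intro x hx
    exact ⟨(LinearEquiv.ofBijective (fderiv ℝ g x : Plane →ₗ[ℝ] Plane)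
      (hg.bijective hQ hx)).toContinuousLinearEquiv, by ext; simp⟩
  have hAG : ∀ x ∈ U, ∀ u, A x (fderiv ℝ g x u) = fderiv ℝ f x u := by
    intro x hx u
    obtain ⟨e, he⟩ := hequiv x hx
    simp [hA, ← he]
  have hAorth : ∀ x ∈ U, IsOrth (A x) := by
    intro x hx u v
    obtain ⟨u, rfl⟩ := (hg.bijective hQ hx).2 u
    obtain ⟨v, rfl⟩ := (hg.bijective hQ hx).2 v
    rw [hAG x hx, hAG x hx, hf.2 x hx, hg.2 x hx]
  have hAdiff : ∀ x ∈ U, DifferentiableAt ℝ A x := by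
    intro x hx
    obtain ⟨e, he⟩ := hequiv x hx
    have h1 : DifferentiableAt ℝ (ContinuousLinearMap.inverse : (Plane →L[ℝ] Plane) → _)
        (fderiv ℝ g x) := by
      rw [← he]
      exact (contDiffAt_map_inverse (n := 1) e).differentiableAt (by simp)
    have h2 : DifferentiableAt ℝ (fun y => ContinuousLinearMap.inverse (fderiv ℝ g y)) x :=
      h1.comp x (hasFDerivAt_fderiv (hg.contDiffAt hU hx)).differentiableAt
    exact (hasFDerivAt_fderiv (hf.contDiffAt hU hx)).differentiableAt.clm_comp h2
  have hA0 : ∀ x ∈ U, fderiv ℝ A x = 0 := by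
    intro x hx
    have e : (fun y => (A y).comp (fderiv ℝ g y)) =ᶠ[nhds x] fderiv ℝ f := by
      filter_upwards [hU.mem_nhds hx] with y hy
      ext1 u
      exact hAG y hy u
    have h1 := (hAdiff x hx).hasFDerivAt.clm_comp (hasFDerivAt_fderiv (hg.contDiffAt hU hx))
    have h2 := (h1.congr_of_eventuallyEq e.symm).unique
      (hasFDerivAt_fderiv (hf.contDiffAt hU hx))
    ext1 w
    ext1 z
    obtain ⟨u, rfl⟩ := (hg.bijective hQ hx).2 z
    have h3 := congrArg (fun L => L w u) h2
    simp at h3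
    -- `f''(w, u) = A g''(w, u)`, as both sides have the same products with the vectors `f' v`
    have h4 : fderiv ℝ (fderiv ℝ f) x w u = A x (fderiv ℝ (fderiv ℝ g) x w u) := by
      refine dotProduct_eq _ _ fun z => ?_
      obtain ⟨v, rfl⟩ := (hf.bijective hQ hx).2 z
      rw [dot_second_derivative_eq hU hf hg hx, ← hAG x hx, hAorth x hx]
    rw [h4] at h3
    simpa using h3
  obtain ⟨x₀, hx₀⟩ := hne
  have hconst : ∀ x ∈ U, A x = A x₀ := fun x hx =>
    hU.is_const_of_fderiv_eq_zero hU' (fun y hy => (hAdiff y hy).differentiableWithinAt)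
      (fun y hy => hA0 y hy) hx hx₀
  have hfd : ∀ {k : Plane → Plane}, IsDev Q k U → ∀ x ∈ U, DifferentiableAt ℝ k x := fun hk x hx =>
    (hk.contDiffAt hU hx).differentiableAt (by simp)
  obtain ⟨b, hb⟩ := hU.exists_eq_add_of_fderiv_eq hU' (f := f) (g := fun x => A x₀ (g x))
    (fun x hx => (hfd hf x hx).differentiableWithinAt)
    (fun x hx => ((A x₀).differentiableAt.comp x (hfd hg x hx)).differentiableWithinAt)
    (fun x hx => by
      have := ((A x₀).hasFDerivAt.comp x (hfd hg x hx).hasFDerivAt).fderiv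
      simp only [Function.comp_def] at this
      rw [this]
      ext1 u
      rw [← hconst x hx]
      exact (hAG x hx u).symm)
  exact ⟨A x₀, b, hAorth x₀ hx₀, hb⟩

lemma IsDev.comp_rigid (hU : IsOpen U) (hf : IsDev Q f U) {A : Plane →L[ℝ] Plane} (hA : IsOrth A)
    (b : Plane) : IsDev Q (fun x => A (f x) + b) U := by
  refine ⟨(A.contDiff.comp_contDiffOn hf.1).add contDiffOn_const, fun y hy u v => ?_⟩
  have hd : DifferentiableAt ℝ f y := (hf.contDiffAt hU hy).differentiableAt (by simp)
  have := ((A.hasFDerivAt.comp y hd.hasFDerivAt).add_const b).fderiv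
  simp only [Function.comp_def] at this
  rw [this, ContinuousLinearMap.comp_apply, ContinuousLinearMap.comp_apply, hA, hf.2 y hy]

/-- Unique continuation for local isometries. -/
lemma IsDev.eqOn (hQ : ∀ y u, u ≠ 0 → Q y u u ≠ 0) (hU : IsOpen U) (hU' : IsPreconnected U)
    (hf : IsDev Q f U) (hg : IsDev Q g U) (hV : IsOpen V) (hVne : V.Nonempty) (hVU : V ⊆ U)
    (h : Set.EqOn f g V) : Set.EqOn f g U := by
  obtain ⟨x, hx⟩ := hVne
  obtain ⟨A, b, -, hAb⟩ := hf.exists_rigid hQ hU hU' ⟨x, hVU hx⟩ hg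
  have hd : DifferentiableAt ℝ g x := (hg.contDiffAt hU (hVU hx)).differentiableAt (by simp)
  have h1 : fderiv ℝ g x = A.comp (fderiv ℝ g x) := by
    have h2 := ((A.hasFDerivAt.comp x hd.hasFDerivAt).add_const b).congr_of_eventuallyEq
      (f₁ := g) (by
        filter_upwards [hV.mem_nhds hx] with y hy
        rw [← h hy, hAb y (hVU hy)]; rfl)
    exact h2.fderiv
  have hA : ∀ z, A z = z := by
    intro z
    obtain ⟨u, rfl⟩ := (hg.bijective hQ (hVU hx)).2 z
    exact (congrArg (fun L => L u) h1).symm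
  have hb : b = 0 := by
    have := hAb x (hVU hx)
    rw [h hx, hA] at this
    simpa using this
  intro y hy
  rw [hAb y hy, hA, hb, add_zero]

/-- Local isometries that agree on overlaps can be glued. -/
lemma IsDev.glue {ι : Type*} {W : ι → Set Plane} (hW : ∀ i, IsOpen (W i))
    {k : ι → Plane → Plane} (hk : ∀ i, IsDev Q (k i) (W i))
    (hagree : ∀ i j, Set.EqOn (k i) (k j) (W i ∩ W j)) :
    ∃ F, IsDev Q F (⋃ i, W i) ∧ ∀ i, Set.EqOn F (k i) (W i) := by
  classical
  set F : Plane → Plane := fun x => if hx : ∃ i, x ∈ W i then k hx.choose x else 0 with hF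
  have hFi : ∀ i, Set.EqOn F (k i) (W i) := by
    intro i x hx
    have hex : ∃ i, x ∈ W i := ⟨i, hx⟩
    simp only [hF, dif_pos hex]
    exact hagree _ _ ⟨hex.choose_spec, hx⟩
  refine ⟨F, ⟨?_, ?_⟩, hFi⟩
  · intro x hx
    obtain ⟨i, hi⟩ := Set.mem_iUnion.1 hx
    refine ContDiffAt.contDiffWithinAt (((hk i).contDiffAt (hW i) hi).congr_of_eventuallyEq ?_)
    filter_upwards [(hW i).mem_nhds hi] with y hy using hFi i hy
  · intro x hx
    obtain ⟨i, hi⟩ := Set.mem_iUnion.1 hx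
    have : F =ᶠ[nhds x] k i := by
      filter_upwards [(hW i).mem_nhds hi] with y hy using hFi i hy
    rw [this.fderiv_eq]
    exact (hk i).2 x hi

/-- A local isometry on a connected open set `U` can be moved so as to agree with a given one on
an open subset. -/
lemma IsDev.exists_normalized (hQ : ∀ y u, u ≠ 0 → Q y u u ≠ 0) (hU : IsOpen U)
    (hV : IsOpen V) (hV' : IsPreconnected V) (hVne : V.Nonempty) (hVU : V ⊆ U)
    (hf : IsDev Q f U) (hg : IsDev Q g V) : ∃ f', IsDev Q f' U ∧ Set.EqOn f' g V := by
  obtain ⟨A, b, hA, hAb⟩ := hg.exists_rigid hQ hV hV' hVne (hf.mono hVU)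
  exact ⟨fun x => A (f x) + b, hf.comp_rigid hU hA b, fun x hx => (hAb x hx).symm⟩

/-- A local isometry on a ball can be extended past the boundary, so that the metric has one on a
larger concentric ball: it is continued along balls about the points of the closed ball. -/
lemma IsDev.extend_ball (hQ : ∀ y u, u ≠ 0 → Q y u u ≠ 0)
    (hloc : ∀ x, ∃ r > 0, ∃ f, IsDev Q f (Metric.ball x r)) {r : ℝ} (hr : 0 < r)
    (hf : IsDev Q f (Metric.ball 0 r)) :
    ∃ ε > 0, ∃ f', IsDev Q f' (Metric.ball 0 (r + ε)) := by
  set B : Set Plane := Metric.ball 0 r with hB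
  have hcl : closure B = Metric.closedBall 0 r := closure_ball 0 hr.ne'
  have hmeet : ∀ {O : Set Plane}, IsOpen O → (∃ z ∈ O, z ∈ Metric.closedBall (0 : Plane) r) →
      (O ∩ B).Nonempty := by
    rintro O hO ⟨z, hz, hz'⟩
    rw [← hcl] at hz'
    exact mem_closure_iff.1 hz' O hO hz
  have hex : ∀ y : Metric.closedBall (0 : Plane) r, ∃ ρ > 0, ∃ k, IsDev Q k (Metric.ball y.1 ρ) ∧
      Set.EqOn k f (Metric.ball y.1 ρ ∩ B) := by
    intro y
    obtain ⟨ρ, hρ, k, hk⟩ := hloc y.1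
    obtain ⟨k', hk', hkf⟩ := hk.exists_normalized hQ Metric.isOpen_ball
      (Metric.isOpen_ball.inter Metric.isOpen_ball)
      ((convex_ball _ _).inter (convex_ball _ _)).isPreconnected
      (hmeet Metric.isOpen_ball ⟨y.1, Metric.mem_ball_self hρ, y.2⟩) Set.inter_subset_left
      (hf.mono Set.inter_subset_right)
    exact ⟨ρ, hρ, k', hk', hkf⟩
  choose ρ hρ k hk hkf using hex
  obtain ⟨F, hF, -⟩ := IsDev.glue (W := fun y : Metric.closedBall (0 : Plane) r =>
    Metric.ball y.1 (ρ y)) (fun _ => Metric.isOpen_ball) hk (by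
      rintro y y' z ⟨hz, hz'⟩
      set O := Metric.ball y.1 (ρ y) ∩ Metric.ball y'.1 (ρ y') with hO
      have hOo : IsOpen O := Metric.isOpen_ball.inter Metric.isOpen_ball
      -- the balls meet on the segment between their centres, which lies in the closed ball
      have hOB : (O ∩ B).Nonempty := by
        refine hmeet hOo ?_
        have hd : dist y.1 y'.1 < ρ y + ρ y' := by
          calc dist y.1 y'.1 ≤ dist y.1 z + dist z y'.1 := dist_triangle _ _ _
            _ < ρ y + ρ y' := add_lt_add (by rw [dist_comm]; exact hz) hz'
        have hs : 0 < ρ y + ρ y' := add_pos (hρ y) (hρ y')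
        have h1 : ρ y' / (ρ y + ρ y') + ρ y / (ρ y + ρ y') = 1 := by field_simp; ring
        refine ⟨(ρ y' / (ρ y + ρ y')) • y.1 + (ρ y / (ρ y + ρ y')) • y'.1, ⟨?_, ?_⟩, ?_⟩
        · have e : (ρ y' / (ρ y + ρ y')) • y.1 + (ρ y / (ρ y + ρ y')) • y'.1 - y.1 =
              (ρ y / (ρ y + ρ y')) • (y'.1 - y.1) := by
            rw [eq_sub_of_add_eq h1]; module
          rw [Metric.mem_ball, dist_eq_norm, e, norm_smul, Real.norm_of_nonneg
            (div_nonneg (hρ y).le hs.le), ← dist_eq_norm, dist_comm, div_mul_eq_mul_div,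
            div_lt_iff₀ hs]
          exact mul_lt_mul_of_pos_left hd (hρ y)
        · have e : (ρ y' / (ρ y + ρ y')) • y.1 + (ρ y / (ρ y + ρ y')) • y'.1 - y'.1 =
              (ρ y' / (ρ y + ρ y')) • (y.1 - y'.1) := by
            rw [eq_sub_of_add_eq' h1]; module
          rw [Metric.mem_ball, dist_eq_norm, e, norm_smul, Real.norm_of_nonneg
            (div_nonneg (hρ y').le hs.le), ← dist_eq_norm, div_mul_eq_mul_div,
            div_lt_iff₀ hs]
          exact mul_lt_mul_of_pos_left hd (hρ y')
        · exact convex_closedBall (0 : Plane) r y.2 y'.2 (div_nonneg (hρ y').le hs.le)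
            (div_nonneg (hρ y).le hs.le) h1
      refine IsDev.eqOn hQ hOo ((convex_ball _ _).inter (convex_ball _ _)).isPreconnected
        ((hk y).mono Set.inter_subset_left) ((hk y').mono Set.inter_subset_right)
        (hOo.inter Metric.isOpen_ball) hOB Set.inter_subset_left ?_ ⟨hz, hz'⟩
      rintro w ⟨⟨hw, hw'⟩, hwB⟩
      rw [hkf y ⟨hw, hwB⟩, hkf y' ⟨hw', hwB⟩])
  have hsub : Metric.closedBall (0 : Plane) r ⊆ ⋃ y : Metric.closedBall (0 : Plane) r,
      Metric.ball y.1 (ρ y) := fun y hy =>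
    Set.mem_iUnion.2 ⟨⟨y, hy⟩, Metric.mem_ball_self (hρ _)⟩
  obtain ⟨ε, hε, hthick⟩ := (isCompact_closedBall (0 : Plane) r).exists_thickening_subset_open
    (isOpen_iUnion fun _ => Metric.isOpen_ball) hsub
  refine ⟨ε, hε, F, hF.mono (Set.Subset.trans ?_ hthick)⟩
  rw [thickening_closedBall hε hr.le, add_comm]

/-- A flat metric on the plane has a global developing map: the supremum of the radii of the balls
about the origin with a local isometry is infinite. -/
theorem exists_isDev_univ (hQ : ∀ y u, u ≠ 0 → Q y u u ≠ 0)
    (hloc : ∀ x, ∃ r > 0, ∃ f, IsDev Q f (Metric.ball x r)) : ∃ f, IsDev Q f Set.univ := by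
  obtain ⟨r₀, hr₀, f₀, hf₀⟩ := hloc 0
  set I : Set ℝ := {r | 0 < r ∧ ∃ f, IsDev Q f (Metric.ball 0 r)} with hI
  have hnorm : ∀ r : I, ∃ f, IsDev Q f (Metric.ball 0 r.1) ∧
      Set.EqOn f f₀ (Metric.ball 0 (min r.1 r₀)) := by
    rintro ⟨r, hr, f, hf⟩
    exact hf.exists_normalized hQ Metric.isOpen_ball Metric.isOpen_ball
      (convex_ball _ _).isPreconnected ⟨0, Metric.mem_ball_self (lt_min hr hr₀)⟩
      (Metric.ball_subset_ball (min_le_left _ _))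
      (hf₀.mono (Metric.ball_subset_ball (min_le_right _ _)))
  choose k hk hk₀ using hnorm
  obtain ⟨F, hF, -⟩ := IsDev.glue (W := fun r : I => Metric.ball (0 : Plane) r.1)
    (fun _ => Metric.isOpen_ball) hk (by
      intro r r'
      have hpos : 0 < min (min r.1 r'.1) r₀ := lt_min (lt_min r.2.1 r'.2.1) hr₀
      refine IsDev.eqOn hQ (Metric.isOpen_ball.inter Metric.isOpen_ball)
        ((convex_ball _ _).inter (convex_ball _ _)).isPreconnected
        ((hk r).mono Set.inter_subset_left) ((hk r').mono Set.inter_subset_right)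
        (V := Metric.ball 0 (min (min r.1 r'.1) r₀)) Metric.isOpen_ball
        ⟨0, Metric.mem_ball_self hpos⟩ ?_ ?_
      · exact Set.subset_inter (Metric.ball_subset_ball ((min_le_left _ _).trans (min_le_left _ _)))
          (Metric.ball_subset_ball ((min_le_left _ _).trans (min_le_right _ _)))
      · intro z hz
        rw [hk₀ r (Metric.ball_subset_ball (min_le_min_right _ (min_le_left _ _)) hz),
          hk₀ r' (Metric.ball_subset_ball (min_le_min_right _ (min_le_right _ _)) hz)])
  refine ⟨F, hF.mono fun x _ => ?_⟩
  by_cases hb : BddAbove I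
  · exfalso
    have h0 : r₀ ∈ I := ⟨hr₀, f₀, hf₀⟩
    have hR : 0 < sSup I := hr₀.trans_le (le_csSup hb h0)
    have hsub : Metric.ball (0 : Plane) (sSup I) ⊆ ⋃ r : I, Metric.ball (0 : Plane) r.1 := by
      intro y hy
      obtain ⟨r, hr, hyr⟩ := exists_lt_of_lt_csSup ⟨r₀, h0⟩ (Metric.mem_ball.1 hy)
      exact Set.mem_iUnion.2 ⟨⟨r, hr⟩, hyr⟩
    obtain ⟨ε, hε, f', hf'⟩ := IsDev.extend_ball hQ hloc hR (hF.mono hsub)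
    have := le_csSup hb (show sSup I + ε ∈ I from ⟨by linarith, f', hf'⟩)
    linarith
  · obtain ⟨r, hr, hxr⟩ := not_bddAbove_iff.1 hb (dist x 0)
    exact Set.mem_iUnion.2 ⟨⟨r, hr⟩, hxr⟩

end Developing

/-! ### Periodic functions and diffeomorphisms defined by their lifts -/

section Periodic

/-- A function on the plane with periods `e_0` and `e_1` factors through the covering map. -/
lemma eq_of_periodic {X : Type*} {f : Plane → X} (hf : ∀ i x, f (x + Pi.single i 1) = f x)
    {x y : Plane} (hxy : proj x = proj y) : f x = f y := by
  obtain ⟨n, hn⟩ := proj_eq_zero_iff.1 (show proj (x - y) = 0 by rw [proj_sub, hxy, sub_self])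
  have h0 : Function.Periodic f (n 0 • (Pi.single 0 1 : Plane)) := Function.Periodic.zsmul (hf 0) _
  have h1 : Function.Periodic f (n 1 • (Pi.single 1 1 : Plane)) := Function.Periodic.zsmul (hf 1) _
  have hx : x = y + n 0 • (Pi.single 0 1 : Plane) + n 1 • (Pi.single 1 1 : Plane) := by
    rw [← sub_add_cancel x y, hn]
    ext i; fin_cases i <;> simp <;> ring
  rw [hx, h1, h0]

/-- A continuous periodic function attains its maximum, as the torus is compact. -/
lemma exists_max_of_periodic {f : Plane → ℝ} (hc : Continuous f)
    (hf : ∀ i x, f (x + Pi.single i 1) = f x) : ∃ x, ∀ y, f y ≤ f x := by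
  have hlift : ∀ y, f (rep (proj y)) = f y := fun y => eq_of_periodic hf (proj_rep _)
  have hcont : Continuous (fun p => f (rep p)) := by
    rw [continuous_iff_lift]
    simpa only [hlift] using hc
  obtain ⟨p, -, hp⟩ := isCompact_univ.exists_isMaxOn Set.univ_nonempty hcont.continuousOn
  exact ⟨rep p, fun y => by rw [← hlift y]; exact hp (Set.mem_univ (proj y))⟩

/-- The diffeomorphism of the torus with lift `F`, where `G` is a smooth inverse of `F`. -/
def TorusDiffeo.ofLift (F G : Plane → Plane) (hF : ContDiff ℝ ∞ F) (hG : ContDiff ℝ ∞ G)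
    (hGF : ∀ x, G (F x) = x) (hFG : ∀ x, F (G x) = x)
    (hF' : ∀ i x, proj (F (x + Pi.single i 1)) = proj (F x))
    (hG' : ∀ i x, proj (G (x + Pi.single i 1)) = proj (G x)) : TorusDiffeo where
  toEquiv :=
    { toFun := fun p => proj (F (rep p))
      invFun := fun p => proj (G (rep p))
      left_inv := fun p => by
        beta_reduce
        rw [eq_of_periodic (f := fun x => proj (G x)) hG' (proj_rep (proj (F (rep p)))), hGF,
          proj_rep]
      right_inv := fun p => by
        beta_reduce
        rw [eq_of_periodic (f := fun x => proj (F x)) hF' (proj_rep (proj (G (rep p)))), hFG,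
          proj_rep] }
  smooth := ⟨F, hF, fun x => eq_of_periodic (f := fun x => proj (F x)) hF' (proj_rep _).symm⟩
  smooth_symm := ⟨G, hG, fun x => eq_of_periodic (f := fun x => proj (G x)) hG' (proj_rep _).symm⟩

lemma TorusDiffeo.isSmoothLift_ofLift {F G : Plane → Plane} (hF : ContDiff ℝ ∞ F)
    (hG : ContDiff ℝ ∞ G) (hGF : ∀ x, G (F x) = x) (hFG : ∀ x, F (G x) = x)
    (hF' : ∀ i x, proj (F (x + Pi.single i 1)) = proj (F x))
    (hG' : ∀ i x, proj (G (x + Pi.single i 1)) = proj (G x)) :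
    IsSmoothLift F (TorusDiffeo.ofLift F G hF hG hGF hFG hF' hG').toEquiv :=
  ⟨hF, fun _ => eq_of_periodic (f := fun x => proj (F x)) hF' (proj_rep _).symm⟩

end Periodic

/-! ### Equivariant immersions of the plane -/

section EquivariantImmersion

/-- An immersion of the plane into itself which commutes with the deck transformations is
bijective: it is at bounded distance from the identity, hence proper, hence a covering. -/
theorem exists_inverse_of_equivariant {F : Plane → Plane} (hF : ContDiff ℝ ∞ F)
    (hbij : ∀ x, Function.Bijective (fderiv ℝ F x))
    (hper : ∀ i x, F (x + Pi.single i 1) = F x + Pi.single i 1) :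
    ∃ G : Plane → Plane, ContDiff ℝ ∞ G ∧ (∀ x, G (F x) = x) ∧ ∀ x, F (G x) = x := by
  obtain ⟨M, hM⟩ := exists_max_of_periodic (f := fun x => ‖F x - x‖)
    ((hF.continuous.sub continuous_id).norm) (fun i x => by rw [hper, add_sub_add_right_eq_sub])
  have hder : ∀ x, ∃ e : Plane ≃L[ℝ] Plane, HasFDerivAt F (e : Plane →L[ℝ] Plane) x := by
    intro x
    have h : ((LinearEquiv.ofBijective (fderiv ℝ F x : Plane →ₗ[ℝ] Plane)
        (hbij x)).toContinuousLinearEquiv : Plane →L[ℝ] Plane) = fderiv ℝ F x := by ext; simp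
    exact ⟨_, h ▸ (hF.differentiable (by simp) x).hasFDerivAt⟩
  choose e he using hder
  -- `F x - x` is periodic, so that `‖F x‖ ≥ ‖x‖ - ‖F M - M‖`
  have hproper : IsProperMap F := by
    rw [isProperMap_iff_tendsto_cocompact]
    refine ⟨hF.continuous, ?_⟩
    rw [Metric.cobounded_eq_cocompact.symm, tendsto_norm_atTop_iff_cobounded.symm]
    refine Filter.tendsto_atTop_mono (f := fun x => ‖x‖ - ‖F M - M‖) (fun x => ?_)
      (Filter.tendsto_atTop_add_const_right _ _ tendsto_norm_cobounded_atTop)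
    have h1 := hM x
    have h2 := norm_sub_norm_le x (F x)
    rw [norm_sub_rev] at h2
    linarith
  have hopen : ∀ x, ∃ φ : OpenPartialHomeomorph Plane Plane, x ∈ φ.source ∧ ↑φ = F := fun x =>
    ⟨hF.contDiffAt.toOpenPartialHomeomorph F (he x) (by simp),
      hF.contDiffAt.mem_toOpenPartialHomeomorph_source (he x) (by simp), rfl⟩
  have hcov : IsCoveringMap F := by
    rw [isCoveringMap_iff_isCoveringMapOn_univ]
    refine hproper.isClosedMap.isCoveringMapOn_of_isLocalHomeomorphOn (fun y _ => ?_) ?_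
    · exact (hproper.isCompact_preimage isCompact_singleton).finite
        (IsDiscrete.of_openPartialHomeomorph F subset_rfl fun x _ => hopen x)
    · rintro x -
      obtain ⟨φ, hx, hφ⟩ := hopen x
      exact ⟨φ, hx, hφ.symm⟩
  -- the plane is simply connected, so that the identity lifts to a section `G` of the covering
  obtain ⟨G, ⟨hG0, hFG⟩, -⟩ :=
    hcov.existsUnique_continuousMap_lifts (ContinuousMap.id Plane) (F 0) 0 rfl
  have hFG' : ∀ x, F (G x) = x := fun x => congrFun hFG x
  have hGF : G ∘ F = id := hcov.eq_of_comp_eq (G.continuous.comp hF.continuous) continuous_id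
    (by funext x; exact hFG' (F x)) 0 hG0
  let H : Plane ≃ₜ Plane :=
    { toFun := F
      invFun := G
      left_inv := congrFun hGF
      right_inv := hFG'
      continuous_toFun := hF.continuous
      continuous_invFun := G.continuous }
  exact ⟨G, H.contDiff_symm he hF, congrFun hGF, hFG'⟩

end EquivariantImmersion

/-! ### The holonomy of a flat torus -/

section Holonomy

variable {Q : Plane → Plane → Plane → ℝ} {D : Plane → Plane}

lemma IsDev.contDiff (hD : IsDev Q D Set.univ) : ContDiff ℝ ∞ D := contDiffOn_univ.1 hD.1

lemma IsDev.hasFDerivAt (hD : IsDev Q D Set.univ) (x : Plane) :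
    HasFDerivAt D (fderiv ℝ D x) x :=
  (hD.contDiff.differentiable (by simp) x).hasFDerivAt

lemma IsDev.comp_add (hD : IsDev Q D Set.univ) {v : Plane} (hv : ∀ y, Q (y + v) = Q y) :
    IsDev Q (fun x => D (x + v)) Set.univ := by
  refine ⟨contDiffOn_univ.2 (hD.contDiff.comp (by fun_prop)), fun y _ u w => ?_⟩
  rw [fderiv_comp_add_right, hD.2 _ (Set.mem_univ _), hv]

lemma IsOrth.dot_single {A : Plane →L[ℝ] Plane} (hA : IsOrth A) (i j : Fin 2) :
    A (Pi.single i 1) ⬝ᵥ A (Pi.single j 1) = if i = j then 1 else 0 := by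
  rw [hA]
  simp [Pi.single_apply, eq_comm]

lemma det_eq_single (A : Plane →L[ℝ] Plane) : A.det =
    A (Pi.single 0 1) 0 * A (Pi.single 1 1) 1 - A (Pi.single 1 1) 0 * A (Pi.single 0 1) 1 := by
  change LinearMap.det (A : Plane →ₗ[ℝ] Plane) = _
  rw [← LinearMap.det_toMatrix', Matrix.det_fin_two]
  simp [LinearMap.toMatrix'_apply]

/-- The plane as the complex numbers. -/
def toComplex (x : Plane) : ℂ := ⟨x 0, x 1⟩

lemma toComplex_add (x y : Plane) : toComplex (x + y) = toComplex x + toComplex y := by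
  apply Complex.ext <;> simp [toComplex]

/-- An orientation preserving orthogonal map is multiplication by a complex number of norm one. -/
lemma IsOrth.exists_rotation {A : Plane →L[ℝ] Plane} (hA : IsOrth A) (hdet : 0 < A.det) :
    ∃ a : ℂ, ‖a‖ = 1 ∧ ∀ x, toComplex (A x) = a * toComplex x := by
  have h00 := hA.dot_single 0 0
  have h01 := hA.dot_single 0 1
  have h11 := hA.dot_single 1 1
  rw [det_eq_single] at hdet
  have hlin : ∀ x k, A x k = x 0 * A (Pi.single 0 1) k + x 1 * A (Pi.single 1 1) k := by
    intro x k
    rw [fderiv_apply_eq_sum A x]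
    simp [Fin.sum_univ_two]
  set p := A (Pi.single 0 1)
  set q := A (Pi.single 1 1)
  simp [dotProduct, Fin.sum_univ_two] at h00 h01 h11
  have hd : (p 0 * q 1 - q 0 * p 1) ^ 2 = 1 := by
    linear_combination h00 * (q 0 * q 0 + q 1 * q 1) + h11 - (p 0 * q 0 + p 1 * q 1) * h01
  have hd1 : p 0 * q 1 - q 0 * p 1 = 1 := by nlinarith
  have hq1 : q 1 = p 0 := by
    linear_combination (-q 1) * h00 + p 1 * h01 + p 0 * hd1
  have hq0 : q 0 = -p 1 := by
    linear_combination (-q 0) * h00 + p 0 * h01 - p 1 * hd1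
  refine ⟨⟨p 0, p 1⟩, ?_, fun x => ?_⟩
  · rw [← sq_eq_sq₀ (norm_nonneg _) zero_le_one, Complex.sq_norm, Complex.normSq_mk, h00, one_pow]
  · apply Complex.ext
    · simp [toComplex, hlin x, hq0]; ring
    · simp [toComplex, hlin x, hq1]; ring

/-- A nowhere vanishing continuous function on a connected space has constant sign. -/
lemma mul_pos_of_ne_zero {X : Type*} [TopologicalSpace X] [PreconnectedSpace X] {g : X → ℝ}
    (hg : Continuous g) (h0 : ∀ x, g x ≠ 0) (x y : X) : 0 < g x * g y := by
  by_contra! h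
  rcases mul_nonpos_iff.1 h with ⟨hx, hy⟩ | ⟨hx, hy⟩
  · obtain ⟨z, hz⟩ := mem_range_of_exists_le_of_exists_ge hg ⟨y, hy⟩ ⟨x, hx⟩
    exact h0 z hz
  · obtain ⟨z, hz⟩ := mem_range_of_exists_le_of_exists_ge hg ⟨x, hx⟩ ⟨y, hy⟩
    exact h0 z hz

/-- A period `v` of the metric acts on the developing map by a rigid motion, which preserves the
orientation because `det D'` has constant sign. -/
lemma IsDev.exists_holonomy (hQ : ∀ y u, u ≠ 0 → Q y u u ≠ 0) (hD : IsDev Q D Set.univ) {v : Plane}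
    (hv : ∀ y, Q (y + v) = Q y) :
    ∃ a b : ℂ, ‖a‖ = 1 ∧ ∀ x, toComplex (D (x + v)) = a * toComplex (D x) + b := by
  obtain ⟨A, b, hA, hAb⟩ := (hD.comp_add hv).exists_rigid hQ isOpen_univ isPreconnected_univ
    Set.univ_nonempty hD
  have hder : ∀ x, fderiv ℝ D (x + v) = A.comp (fderiv ℝ D x) := by
    intro x
    rw [← fderiv_comp_add_right, show (fun x => D (x + v)) = fun x => A (D x) + b from
      funext fun x => hAb x (Set.mem_univ _)]
    exact ((A.hasFDerivAt.comp x (hD.hasFDerivAt x)).add_const b).fderiv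
  have hdetmul : (fderiv ℝ D (0 + v)).det = A.det * (fderiv ℝ D 0).det := by
    rw [hder]; exact LinearMap.det_comp _ _
  have hcont : Continuous fun x => (fderiv ℝ D x).det :=
    ContinuousLinearMap.continuous_det.comp (hD.contDiff.continuous_fderiv (by simp))
  have hne : ∀ x, (fderiv ℝ D x).det ≠ 0 := by
    intro x
    have := (LinearEquiv.ofBijective (fderiv ℝ D x : Plane →ₗ[ℝ] Plane)
      (hD.bijective hQ (Set.mem_univ x))).isUnit_det'
    exact this.ne_zero
  have hpos := mul_pos_of_ne_zero hcont hne (0 + v) 0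
  rw [hdetmul, mul_assoc] at hpos
  obtain ⟨a, ha, haA⟩ := hA.exists_rotation (pos_of_mul_pos_left hpos (mul_self_nonneg _))
  exact ⟨a, toComplex b, ha, fun x => by rw [hAb x (Set.mem_univ _), toComplex_add, haA]⟩

/-- A linear function `⟨w, D⟩` of the developing map has no critical point unless `w = 0`. -/
lemma IsDev.eq_zero_of_dot_eq_zero (hQ : ∀ y u, u ≠ 0 → Q y u u ≠ 0) (hD : IsDev Q D Set.univ)
    {x w : Plane} (h : ∀ u, w ⬝ᵥ fderiv ℝ D x u = 0) : w = 0 := by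
  obtain ⟨u, hu⟩ := (hD.bijective hQ (Set.mem_univ x)).2 w
  have := h u
  rwa [hu, dotProduct_self_eq_zero] at this

/-- The holonomy has no fixed point: the distance of the developing map to such a point would
attain a maximum. -/
lemma IsDev.no_fixed_point (hQ : ∀ y u, u ≠ 0 → Q y u u ≠ 0) (hD : IsDev Q D Set.univ)
    (P : Plane) (hP : ∀ i x, (D (x + Pi.single i 1) - P) ⬝ᵥ (D (x + Pi.single i 1) - P) =
      (D x - P) ⬝ᵥ (D x - P)) : False := by
  have hcont : Continuous D := hD.contDiff.continuous
  obtain ⟨x, hx⟩ := exists_max_of_periodic (f := fun x => (D x - P) ⬝ᵥ (D x - P))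
    (by simp only [dotProduct]; fun_prop) hP
  have hder : HasFDerivAt (fun x => dotL (D x - P) (D x - P))
      (dotL.precompR Plane (D x - P) (fderiv ℝ D x) +
        dotL.precompL Plane (fderiv ℝ D x) (D x - P)) x :=
    dotL.hasFDerivAt_of_bilinear ((hD.hasFDerivAt x).sub_const P) ((hD.hasFDerivAt x).sub_const P)
  have hmax : IsLocalMax (fun x => dotL (D x - P) (D x - P)) x :=
    Filter.Eventually.of_forall fun y => by simpa only [dotL_apply] using hx y
  have h0 := hmax.hasFDerivAt_eq_zero hder
  have hxP : D x - P = 0 := by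
    refine hD.eq_zero_of_dot_eq_zero hQ (x := x) fun u => ?_
    have h1 := congrArg (fun L => L u) h0
    replace h1 : dotL (D x - P) (fderiv ℝ D x u) + dotL (fderiv ℝ D x u) (D x - P) = 0 := h1
    rw [dotL_apply, dotL_apply, dotProduct_comm (fderiv ℝ D x u)] at h1
    linarith
  have hDP : ∀ y, D y = P := by
    intro y
    have h1 := hx y
    beta_reduce at h1
    rw [hxP, zero_dotProduct] at h1
    refine sub_eq_zero.1 (dotProduct_self_eq_zero.1 (le_antisymm h1 ?_))
    exact Finset.sum_nonneg fun i _ => mul_self_nonneg _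
  have h2 : fderiv ℝ D x = 0 := by
    rw [show D = fun _ => P from funext hDP]; simp
  have h3 : (Pi.single 0 1 : Plane) = 0 := hD.eq_zero_of_dot_eq_zero hQ (x := x) (by simp [h2])
  simpa using congrFun h3 0

lemma dot_self_sub_eq (x y : Plane) :
    (x - y) ⬝ᵥ (x - y) = ‖toComplex x - toComplex y‖ ^ 2 := by
  rw [Complex.sq_norm, Complex.normSq_apply]
  simp [toComplex, dotProduct, Fin.sum_univ_two]

/-- The holonomy of a flat torus consists of translations: two commuting rotations, one of which
is not trivial, have a common fixed point. -/
theorem IsDev.holonomy_translation (hQ : ∀ y u, u ≠ 0 → Q y u u ≠ 0) (hD : IsDev Q D Set.univ)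
    (hper : ∀ i y, Q (y + Pi.single i 1) = Q y) :
    ∃ b : Fin 2 → Plane, ∀ i x, D (x + Pi.single i 1) = D x + b i := by
  -- the holonomy along `e_i` is `z ↦ a_i z + b_i`
  choose a b ha hab using fun i => hD.exists_holonomy hQ (hper i)
  have hcomm : ∀ i j, a i * b j + b i = a j * b i + b j := by
    intro i j
    have h1 := hab i (0 + Pi.single j 1)
    have h2 := hab j (0 + Pi.single i 1)
    rw [add_right_comm, h2, hab i, hab j] at h1
    linear_combination -h1
  have ha1 : ∀ i, a i = 1 := by
    by_contra! h
    obtain ⟨i, hi⟩ := h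
    have hi' : 1 - a i ≠ 0 := sub_ne_zero.2 (Ne.symm hi)
    -- the fixed point of the holonomy along `e_i`
    set P : ℂ := b i / (1 - a i) with hP
    have hfix : ∀ j, b j = P - a j * P := by
      intro j
      rw [hP]
      field_simp
      linear_combination -hcomm i j
    refine hD.no_fixed_point hQ ![P.re, P.im] fun j x => ?_
    have hPc : toComplex ![P.re, P.im] = P := by apply Complex.ext <;> simp [toComplex]
    rw [dot_self_sub_eq, dot_self_sub_eq, hPc, hab, hfix j,
      show a j * toComplex (D x) + (P - a j * P) - P = a j * (toComplex (D x) - P) by ring,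
      norm_mul, ha, one_mul]
  refine ⟨fun i => ![(b i).re, (b i).im], fun i x => ?_⟩
  have h := hab i x
  rw [ha1, one_mul] at h
  ext k
  fin_cases k
  · simpa [toComplex] using congrArg Complex.re h
  · simpa [toComplex] using congrArg Complex.im h

/-- The translations of the holonomy are linearly independent: otherwise a nonzero linear
function of the developing map would attain a maximum. -/
theorem IsDev.det_holonomy_ne_zero (hQ : ∀ y u, u ≠ 0 → Q y u u ≠ 0) (hD : IsDev Q D Set.univ)
    {B : Matrix (Fin 2) (Fin 2) ℝ} (hB : ∀ i x, D (x + Pi.single i 1) = D x + B.col i) :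
    B.det ≠ 0 := by
  intro hdet
  obtain ⟨l, hl, hlB⟩ := Matrix.exists_vecMul_eq_zero_iff.2 hdet
  have hcont : Continuous D := hD.contDiff.continuous
  obtain ⟨x, hx⟩ := exists_max_of_periodic (f := fun x => dotL l (D x)) (by fun_prop) (by
    intro i x
    have : l ⬝ᵥ B.col i = 0 := congrFun hlB i
    rw [hB, map_add, dotL_apply l (B.col i), this, add_zero])
  have h0 := IsLocalMax.hasFDerivAt_eq_zero (Filter.Eventually.of_forall hx)
    ((dotL l).hasFDerivAt.comp x (hD.hasFDerivAt x))
  refine hl (hD.eq_zero_of_dot_eq_zero hQ (x := x) fun u => ?_)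
  rw [← dotL_apply]
  exact congrArg (fun L => L u) h0

end Holonomy

section FlatTorus

/-- A flat metric on the torus is the pull-back of a constant one: the columns of `B` are the
holonomy translations, and `B⁻¹ D` is a lift of the diffeomorphism, where `D` is the developing
map. -/
theorem exists_pullback_const {h : TensorField} (hflat : IsFlatMetric h) :
    ∃ (Φ : TorusDiffeo) (B : Matrix (Fin 2) (Fin 2) ℝ), B.det ≠ 0 ∧
      h = pullback Φ (fun _ => B.transpose * B) := by
  set Q : Plane → Plane → Plane → ℝ := fun y u v => u ⬝ᵥ (h (proj y)).mulVec v with hQdef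
  have hQ : ∀ y u, u ≠ 0 → Q y u u ≠ 0 := fun y u hu =>
    ((hflat.1.2 (proj y)).dotProduct_mulVec_pos hu).ne'
  have hjac : ∀ (f : Plane → Plane) (y u v : Plane), fderiv ℝ f y u ⬝ᵥ fderiv ℝ f y v =
      u ⬝ᵥ ((jacobian f y).transpose * jacobian f y).mulVec v := by
    intro f y u v
    have hmul : ∀ u, fderiv ℝ f y u = (jacobian f y).mulVec u := fun u => by
      rw [jacobian_eq_toMatrix', LinearMap.toMatrix'_mulVec]; rfl
    rw [hmul, hmul, ← Matrix.mulVec_mulVec, Matrix.dotProduct_mulVec u, Matrix.vecMul_transpose]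
  have hloc : ∀ x, ∃ r > 0, ∃ f, IsDev Q f (Metric.ball x r) := by
    intro x
    obtain ⟨U, hU, hxU, f, hf, hfh⟩ := hflat.2 x
    obtain ⟨r, hr, hrU⟩ := Metric.isOpen_iff.1 hU x hxU
    exact ⟨r, hr, f, hf.mono hrU, fun y hy u v => by rw [hjac, ← hfh y (hrU hy)]⟩
  obtain ⟨D, hD⟩ := exists_isDev_univ hQ hloc
  obtain ⟨b, hb⟩ := hD.holonomy_translation hQ (by
    intro i y; simp only [hQdef]; rw [proj_add, proj_single_one, add_zero])
  set B : Matrix (Fin 2) (Fin 2) ℝ := Matrix.of fun k i => b i k with hBdef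
  have hB : ∀ i x, D (x + Pi.single i 1) = D x + B.col i := hb
  have hdet := hD.det_holonomy_ne_zero hQ hB
  have hu : IsUnit B.det := isUnit_iff_ne_zero.2 hdet
  -- the developing map in the basis of the lattice of periods commutes with the deck group
  set L : Plane →L[ℝ] Plane := LinearMap.toContinuousLinearMap (Matrix.toLin' B⁻¹) with hL
  have hLa : ∀ x, L x = B⁻¹.mulVec x := fun x => by simp [hL]
  set F : Plane → Plane := fun x => L (D x) with hF
  have hFs : ContDiff ℝ ∞ F := L.contDiff.comp hD.contDiff
  have hFper : ∀ i x, F (x + Pi.single i 1) = F x + Pi.single i 1 := by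
    intro i x
    have : B.col i = B.mulVec (Pi.single i 1) := by simp
    simp only [hF]
    rw [hB, map_add, hLa (B.col i), this, Matrix.mulVec_mulVec, Matrix.nonsing_inv_mul _ hu,
      Matrix.one_mulVec]
  have hDF : D = fun x => LinearMap.toContinuousLinearMap (Matrix.toLin' B) (F x) := by
    funext x
    change D x = B.mulVec (L (D x))
    rw [hLa, Matrix.mulVec_mulVec, Matrix.mul_nonsing_inv _ hu, Matrix.one_mulVec]
  have hFder : ∀ x, fderiv ℝ F x = L.comp (fderiv ℝ D x) := fun x =>
    (L.hasFDerivAt.comp x (hD.hasFDerivAt x)).fderiv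
  have hLbij : Function.Bijective L := by
    refine Function.bijective_iff_has_inverse.2 ⟨B.mulVec, fun x => ?_, fun x => ?_⟩
    · rw [hLa, Matrix.mulVec_mulVec, Matrix.mul_nonsing_inv _ hu, Matrix.one_mulVec]
    · rw [hLa, Matrix.mulVec_mulVec, Matrix.nonsing_inv_mul _ hu, Matrix.one_mulVec]
  have hFbij : ∀ x, Function.Bijective (fderiv ℝ F x) := fun x => by
    rw [hFder]; exact hLbij.comp (hD.bijective hQ (Set.mem_univ x))
  obtain ⟨G, hG, hGF, hFG⟩ := exists_inverse_of_equivariant hFs hFbij hFper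
  have hGper : ∀ i x, G (x + Pi.single i 1) = G x + Pi.single i 1 := by
    intro i x
    rw [← hGF (G x + Pi.single i 1), hFper, hFG]
  have hproj : ∀ {K : Plane → Plane}, (∀ i x, K (x + Pi.single i 1) = K x + Pi.single i 1) →
      ∀ i x, proj (K (x + Pi.single i 1)) = proj (K x) := by
    intro K hK i x
    rw [hK, proj_add, proj_single_one, add_zero]
  refine ⟨TorusDiffeo.ofLift F G hFs hG hGF hFG (hproj hFper) (hproj hGper), B, hdet, ?_⟩
  funext p
  obtain ⟨x, rfl⟩ := surjective_proj p
  rw [pullback_proj _ _ (TorusDiffeo.isSmoothLift_ofLift hFs hG hGF hFG _ _)]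
  have hJ : jacobian D x = B * jacobian F x := by
    conv_lhs => rw [hDF]
    rw [jacobian_comp (F := F) (ContinuousLinearMap.differentiableAt _)
      (hFs.differentiable (by simp) x)]
    congr 1
    rw [jacobian_eq_toMatrix', ContinuousLinearMap.fderiv]
    simp
  have hh : h (proj x) = (jacobian D x).transpose * jacobian D x := by
    ext i j
    have h1 := hD.2 x (Set.mem_univ x) (Pi.single i 1) (Pi.single j 1)
    rw [hjac, hQdef] at h1
    simpa only [Matrix.mulVec_single_one, single_one_dotProduct, Matrix.col_apply] using h1.symm
  rw [hh, hJ, Matrix.transpose_mul]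
  simp only [Matrix.mul_assoc]

end FlatTorus

/-! ### Reduction of plane lattices -/

section Reduction

/-- Reduction of positive definite binary quadratic forms: `K` is, up to a factor, the Gram matrix
of the basis `1, z` of a lattice in `ℂ`. If `(αz + β) / (γz + δ)` lies in the fundamental domain of
the modular group, then `γz + δ, αz + β` is a reduced basis. -/
theorem exists_reduced_form {K : Matrix (Fin 2) (Fin 2) ℝ} (hK : K.PosDef) :
    ∃ (N N' : Matrix (Fin 2) (Fin 2) ℤ) (c a b : ℝ), N * N' = 1 ∧ N' * N = 1 ∧ 0 < c ∧ 0 ≤ a ∧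
      a ≤ 1 / 2 ∧ Real.sqrt (1 - a ^ 2) ≤ b ∧
      K = c • ((N.map (Int.cast : ℤ → ℝ)).transpose * !![1, a; a, a ^ 2 + b ^ 2] *
        N.map (Int.cast : ℤ → ℝ)) := by
  have h00 : 0 < K 0 0 := hK.diag_pos
  have hdet : 0 < K.det := hK.det_pos
  have hsymm : K 1 0 = K 0 1 := by simpa using hK.1.apply 0 1
  -- `z = x + iy`
  set x := K 0 1 / K 0 0 with hx
  set y := Real.sqrt K.det / K 0 0 with hy
  have hypos : 0 < y := div_pos (Real.sqrt_pos.2 hdet) h00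
  have hx' : K 0 1 = K 0 0 * x := by rw [hx]; field_simp
  have hxy : K 1 1 = K 0 0 * (x ^ 2 + y ^ 2) := by
    rw [hx, hy, div_pow, div_pow, Real.sq_sqrt hdet.le, Matrix.det_fin_two, hsymm]
    field_simp
    ring
  obtain ⟨g, hg⟩ := ModularGroup.exists_smul_mem_fd ⟨⟨x, y⟩, hypos⟩
  set w := g • (⟨⟨x, y⟩, hypos⟩ : UpperHalfPlane) with hw
  have hdg : (g 0 0 : ℝ) * g 1 1 - g 0 1 * g 1 0 = 1 := by
    have := g.det_coe
    rw [Matrix.det_fin_two] at this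
    exact_mod_cast this
  have hdg' : g 0 0 * g 1 1 - g 0 1 * g 1 0 = 1 := by exact_mod_cast hdg
  set α := g 0 0
  set β := g 0 1
  set γ := g 1 0
  set δ := g 1 1
  have hden : 0 < ((γ : ℝ) * x + δ) ^ 2 + (γ * y) ^ 2 := by
    by_contra! h
    have h1 : (γ : ℝ) * y = 0 := by nlinarith [sq_nonneg ((γ : ℝ) * x + δ), sq_nonneg ((γ : ℝ) * y)]
    have h2 : (γ : ℝ) * x + δ = 0 := by
      nlinarith [sq_nonneg ((γ : ℝ) * x + δ), sq_nonneg ((γ : ℝ) * y)]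
    have h3 : (γ : ℝ) = 0 := (mul_eq_zero.1 h1).resolve_right hypos.ne'
    rw [h3, zero_mul, zero_add] at h2
    rw [h3, h2] at hdg
    simp at hdg
  have hwz : (w : ℂ) * (γ * (⟨x, y⟩ : ℂ) + δ) = α * (⟨x, y⟩ : ℂ) + β := by
    have hne : (γ : ℂ) * (⟨x, y⟩ : ℂ) + δ ≠ 0 := by
      intro h
      have h1 := congrArg Complex.re h
      have h2 := congrArg Complex.im h
      simp at h1 h2
      rw [h1] at hden
      rcases h2 with h2 | h2
      · rw [h2] at hden; simp at hden
      · rw [h2] at hden; simp at hden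
    rw [hw, UpperHalfPlane.specialLinearGroup_apply]
    simp only [algebraMap_int_eq, eq_intCast, Complex.ofReal_intCast]
    exact div_mul_cancel₀ _ hne
  have e1 := congrArg Complex.re hwz
  have e2 := congrArg Complex.im hwz
  simp at e1 e2
  obtain ⟨hfd1, hfd2⟩ := hg
  rw [Complex.normSq_apply] at hfd1
  have hYpos : 0 < (w : ℂ).im := w.im_pos
  simp only [UpperHalfPlane.coe_re, UpperHalfPlane.coe_im] at hfd1 hYpos
  set X := w.re
  set Y := w.im
  set d := ((γ : ℝ) * x + δ) ^ 2 + (γ * y) ^ 2 with hd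
  -- with `d = |γz + δ|²`, these are `⟨γz + δ, αz + β⟩` and `|αz + β|²`
  have m1 : X * d = (α * x + β) * (γ * x + δ) + α * y * (γ * y) := by
    rw [hd]
    linear_combination (γ * x + δ) * e1 + γ * y * e2
  have m2 : (X ^ 2 + Y ^ 2) * d = (α * x + β) ^ 2 + (α * y) ^ 2 := by
    rw [hd]
    linear_combination (X * (γ * x + δ) - Y * (γ * y) + (α * x + β)) * e1 +
      (X * (γ * y) + Y * (γ * x + δ) + α * y) * e2
  -- the scalar products of `1 = α(γz + δ) - γ(αz + β)` and `z = -β(γz + δ) + δ(αz + β)`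
  have q00 : d * (α ^ 2 - 2 * α * γ * X + γ ^ 2 * (X ^ 2 + Y ^ 2)) = 1 := by
    linear_combination (-2 * α * γ) * m1 + γ ^ 2 * m2 + (α * δ - β * γ + 1) * hdg + α ^ 2 * hd
  have q01 : d * (-(α * β) + (α * δ + β * γ) * X - γ * δ * (X ^ 2 + Y ^ 2)) = x := by
    linear_combination (α * δ + β * γ) * m1 - γ * δ * m2 + x * (α * δ - β * γ + 1) * hdg -
      α * β * hd
  have q11 : d * (β ^ 2 - 2 * β * δ * X + δ ^ 2 * (X ^ 2 + Y ^ 2)) = x ^ 2 + y ^ 2 := by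
    linear_combination (-2 * β * δ) * m1 + δ ^ 2 * m2 +
      (x ^ 2 + y ^ 2) * (α * δ - β * γ + 1) * hdg + β ^ 2 * hd
  have hsqrt : ∀ a : ℝ, a ^ 2 = X ^ 2 → Real.sqrt (1 - a ^ 2) ≤ Y := fun a ha =>
    Real.sqrt_le_iff.2 ⟨hYpos.le, by rw [ha]; linarith⟩
  have hc : 0 < K 0 0 * d := mul_pos h00 hden
  rcases le_or_gt 0 X with hX | hX
  · rw [abs_of_nonneg hX] at hfd2
    refine ⟨!![α, -β; -γ, δ], !![δ, β; γ, α], K 0 0 * d, X, Y, ?_, ?_, hc, hX, hfd2,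
      hsqrt X rfl, ?_⟩
    · ext i j
      fin_cases i <;> fin_cases j <;> simp [Matrix.mul_apply, Fin.sum_univ_two] <;>
        first | ring1 | linear_combination hdg'
    · ext i j
      fin_cases i <;> fin_cases j <;> simp [Matrix.mul_apply, Fin.sum_univ_two] <;>
        first | ring1 | linear_combination hdg'
    · ext i j
      fin_cases i <;> fin_cases j <;> simp [Matrix.mul_apply, Fin.sum_univ_two]
      · linear_combination (-K 0 0) * q00
      · rw [hx']; linear_combination (-K 0 0) * q01
      · rw [hsymm, hx']; linear_combination (-K 0 0) * q01
      · rw [hxy]; linear_combination (-K 0 0) * q11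
  -- a reflection makes the angle of the reduced basis acute
  · rw [abs_of_neg hX] at hfd2
    refine ⟨!![α, -β; γ, -δ], !![δ, -β; γ, -α], K 0 0 * d, -X, Y, ?_, ?_, hc, by linarith, hfd2,
      hsqrt (-X) (neg_sq X), ?_⟩
    · ext i j
      fin_cases i <;> fin_cases j <;> simp [Matrix.mul_apply, Fin.sum_univ_two] <;>
        first | ring1 | linear_combination hdg'
    · ext i j
      fin_cases i <;> fin_cases j <;> simp [Matrix.mul_apply, Fin.sum_univ_two] <;>
        first | ring1 | linear_combination hdg'
    · ext i j
      fin_cases i <;> fin_cases j <;> simp [Matrix.mul_apply, Fin.sum_univ_two]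
      · linear_combination (-K 0 0) * q00
      · rw [hx']; linear_combination (-K 0 0) * q01
      · rw [hsymm, hx']; linear_combination (-K 0 0) * q01
      · rw [hxy]; linear_combination (-K 0 0) * q11

lemma pullback_smul (Φ : TorusDiffeo) (c : ℝ) (k : TensorField) :
    pullback Φ (c • k) = c • pullback Φ k := by
  funext p
  simp [pullback]

/-- An integer matrix with an integer inverse is the lift of a diffeomorphism of the torus. -/
lemma exists_linear_diffeo {N N' : Matrix (Fin 2) (Fin 2) ℤ} (h : N * N' = 1) (h' : N' * N = 1) :
    ∃ Φ : TorusDiffeo, ∀ K : Matrix (Fin 2) (Fin 2) ℝ, pullback Φ (fun _ => K) = fun _ =>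
      (N.map (Int.cast : ℤ → ℝ)).transpose * K * N.map (Int.cast : ℤ → ℝ) := by
  set L : Matrix (Fin 2) (Fin 2) ℤ → Plane →L[ℝ] Plane := fun M =>
    LinearMap.toContinuousLinearMap (Matrix.toLin' (M.map (Int.cast : ℤ → ℝ))) with hL
  have hLa : ∀ M x, L M x = (M.map (Int.cast : ℤ → ℝ)).mulVec x := fun M x => rfl
  have hinv : ∀ {M M' : Matrix (Fin 2) (Fin 2) ℤ}, M * M' = 1 → ∀ x, L M (L M' x) = x := by
    intro M M' hM x
    have hmap : M.map (Int.cast : ℤ → ℝ) * M'.map (Int.cast : ℤ → ℝ) = 1 := by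
      have := congrArg (fun A => A.map (Int.castRingHom ℝ)) hM
      beta_reduce at this
      rw [Matrix.map_mul, Matrix.map_one _ (map_zero _) (map_one _)] at this
      exact this
    rw [hLa, hLa, Matrix.mulVec_mulVec, hmap, Matrix.one_mulVec]
  have hper : ∀ M (i : Fin 2) x, proj (L M (x + Pi.single i 1)) = proj (L M x) := by
    intro M i x
    have h0 : proj (L M (Pi.single i 1)) = 0 :=
      proj_eq_zero_iff.2 ⟨fun k => M k i, by rw [hLa, Matrix.mulVec_single_one]; rfl⟩
    rw [map_add, proj_add, h0, add_zero]
  refine ⟨TorusDiffeo.ofLift (L N) (L N') (L N).contDiff (L N').contDiff (hinv h') (hinv h)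
    (hper N) (hper N'), fun K => ?_⟩
  funext p
  obtain ⟨x, rfl⟩ := surjective_proj p
  rw [pullback_proj _ _ (TorusDiffeo.isSmoothLift_ofLift (L N).contDiff (L N').contDiff (hinv h')
    (hinv h) (hper N) (hper N'))]
  have hJ : jacobian (L N) x = N.map (Int.cast : ℤ → ℝ) := by
    rw [jacobian_eq_toMatrix', ContinuousLinearMap.fderiv]
    exact LinearMap.toMatrix'_toLin' _
  rw [hJ]

/-- Every flat metric on the torus has a normal form. -/
theorem exists_isNormalForm {h : TensorField} (hflat : IsFlatMetric h) :
    ∃ Φ c a b, IsNormalForm h Φ c a b := by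
  obtain ⟨Φ, B, hB, hh⟩ := exists_pullback_const hflat
  have hK : (B.transpose * B).PosDef := by
    have := Matrix.PosDef.conjTranspose_mul_self B
      (Matrix.mulVec_injective_iff_isUnit.2 ((Matrix.isUnit_iff_isUnit_det B).2
        (isUnit_iff_ne_zero.2 hB)))
    rwa [Matrix.conjTranspose_eq_transpose_of_trivial] at this
  obtain ⟨N, N', c, a, b, hN, hN', hc, ha, ha', hb, hKN⟩ := exists_reduced_form hK
  obtain ⟨Ψ, hΨ⟩ := exists_linear_diffeo hN hN'
  refine ⟨Φ.trans Ψ, c, a, b, hc, ha, ha', hb, ?_⟩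
  rw [pullback_trans, ← pullback_smul, hh]
  congr 1
  unfold hMetric
  rw [hΨ]
  funext p
  exact hKN

/-- A rectangular metric has a normal form with `a = 0`: exchange the coordinates if the first
side of the rectangle is longer than the second. -/
theorem exists_isNormalForm_of_isRectangular {h : TensorField} (hrect : IsRectangular h) :
    ∃ Φ c b, IsNormalForm h Φ c 0 b := by
  have key : ∀ (Φ : TorusDiffeo) (α β : ℝ), 0 < α → α ≤ β →
      h = pullback Φ (fun _ => !![α ^ 2, 0; 0, β ^ 2]) → ∃ Φ c b, IsNormalForm h Φ c 0 b := by
    intro Φ α β hα hαβ hh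
    refine ⟨Φ, α ^ 2, β / α, by positivity, le_rfl, by norm_num, ?_, ?_⟩
    · simpa using (one_le_div hα).2 hαβ
    · rw [← pullback_smul, hh]
      congr 1
      funext p
      ext i j
      fin_cases i <;> fin_cases j <;> simp [hMetric]
      field_simp
  obtain ⟨Φ, α, β, hα, hβ, hh⟩ := hrect
  rcases le_total α β with hle | hle
  · exact key Φ α β hα hle hh
  · obtain ⟨Ψ, hΨ⟩ := exists_linear_diffeo (N := !![0, 1; 1, 0]) (N' := !![0, 1; 1, 0])
      (by decide) (by decide)
    refine key (Φ.trans Ψ) β α hβ hle ?_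
    rw [pullback_trans, hΨ, hh]
    congr 1
    funext p
    ext i j
    fin_cases i <;> fin_cases j <;> simp [Matrix.mul_apply, Fin.sum_univ_two]

end Reduction

end FlatTori

end

open FlatTori

theorem mainTheorem6 (h : TensorField) (hflat : IsFlatMetric h) :
    (∃ Φ c a b, IsNormalForm h Φ c a b) ∧
    (IsRectangular h → ∃ Φ c b, IsNormalForm h Φ c 0 b) ∧
    ∀ Φ c a b, IsNormalForm h Φ c a b →
      (∃ φ : Torus → EuclideanSpace ℝ (Fin 6),
        IsIsometricEmbedding h φ ∧
        (∀ k, IsFirstEigenfunction (pullback Φ hEL) (fun p => φ p k)) ∧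
        IsInflated (volumeElement h) h (fun p => toℓ2 (φ p)) ∧
        (a = 0 → ∀ p, φ p 4 = 0 ∧ φ p 5 = 0)) ∧
      SolvesSpecProblem (volumeElement h) h (dualMetric (pullback Φ hEL)) ∧
      (a = 0 →
        SolvesSpecProblem (volumeElement h) h (dualMetric (pullback Φ hSQ)) ∧
        (∀ k : ℝ, dualMetric (pullback Φ hSQ) ≠ k • dualMetric (pullback Φ hEL)) ∧
        ∀ s : ℝ, 0 ≤ s → s ≤ 1 / 2 →
          SolvesSpecProblem (volumeElement h) h
            (dualMetric (pullback Φ (hMetric s (Real.sqrt (1 - s ^ 2)))))) := by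
  refine ⟨exists_isNormalForm hflat, exists_isNormalForm_of_isRectangular, ?_⟩
  intro Φ c a b hN
  refine ⟨⟨fun p => inflatedMap c a b (Φ.toEquiv p), isIsometricEmbedding_inflatedMap hN,
    isFirstEigenfunction_inflatedMap Φ, isInflated_inflatedMap hN, ?_⟩, ?_, ?_⟩
  · rintro rfl p
    simp [inflatedMap, trigMap, radius]
  · rw [hEL_eq]
    exact solvesSpecProblem_pullback hN (by norm_num) le_rfl (by ring)
  · rintro rfl
    refine ⟨?_, not_proportional Φ, fun s hs0 hs1 => solvesSpecProblem_pullback hN hs0 hs1 (by ring)⟩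
    rw [hSQ_eq]
    exact solvesSpecProblem_pullback hN le_rfl (by norm_num) (by ring)
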